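/- **Setting.** For a finite set $P\subset\mathbb{R}^d$ and $\varepsilon>0$, an $\varepsilon$-net of $P$ is a subset $N\subseteq P$ such that every point of $P$ is at distance at most $\varepsilon$ from $N$ and any two distinct points of $N$ are at distance at least $\varepsilon$. A number $s\ge 0$ is a growth exponent of a family $\mathcal F$ of finite subsets of $\mathbb{R}^d$ if there is a constant $C$ such that $|N\cap \mathrm{ball}(x,r)|\le C\,(r/\varepsilon)^s$ for all $P\in\mathcal F$, all $\varepsilon>0$ and $r\ge 2\varepsilon$, all $\varepsilon$-nets $N$ of $P$ and all $x\in\mathbb{R}^d$. The fractal dimension $\dim_{\mathsf f}(\mathcal F)$ is the infimum of the growth exponents of $\mathcal F$. The model of computation is the real RAM: a finite program with natural and rational constants that works on an array of natural numbers (addition, truncated subtraction, comparison, indirect addressing) and an array of real numbers (addition, subtraction, multiplication, division, square root, comparison), with loops and recursive procedures, no rounding, and unit cost per operation and memory access. The input consists of $n$, the number $\delta$, and the coordinates of $n$ distinct points $p_0,\dots,p_{n-1}$; the output is a permutation of $\{0,\dots,n-1\}$. **Theorem.** Let $d\ge 2$ be an integer, let $\delta\in(0,d]$ be a real number, and let $\mathcal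 F$ be a family of finite subsets of $\mathbb{R}^d$ of fractal dimension at most $\delta$ (in particular, of fractal dimension $\delta$); if $\delta\ge 1$, assume that $\delta$ itself is a growth exponent of $\mathcal F$. Then there are a program and a constant $K$, depending only on $d$, $\delta$ and $\mathcal F$, such that for every enumeration $p_0,\dots,p_{n-1}$ of the $n$ points of any $P\in\mathcal F$ the program halts and outputs the visiting order of an optimal Euclidean TSP tour of $P$ (a shortest closed tour through all points of $P$), and such that, whenever $n\ge 2$, it does so in at most $T(n)$ steps, where $$T(n)=\begin{cases} n^{K\,n^{1-1/\delta}} & \text{if } \delta>1,\\ n^{K\log^2 n} & \text{if } \delta=1,\\ n^{K\log n} & \text{if } \delta<1.\end{cases}$$ -/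

import Mathlib

open scoped ENNReal

namespace FractalTSP

/-- `d`-dimensional Euclidean space. -/
abbrev Pt (d : ℕ) := EuclideanSpace ℝ (Fin d)

/-! ### Fractal dimension of a family of finite point sets -/

/-- `N` is an `ε`-net of `P`: a subset of `P` that is an `ε`-covering of `P` and an `ε`-packing. -/
structure IsNet {d : ℕ} (ε : ℝ) (P N : Finset (Pt d)) : Prop where
  subset : N ⊆ P
  covering : ∀ x ∈ P, ∃ y ∈ N, dist x y ≤ ε
  packing : ∀ x ∈ N, ∀ y ∈ N, x ≠ y → ε ≤ dist x y

/-- `|N ∩ ball(x, r)| = O((r / ε) ^ s)` for all `ε`-nets `N` of the members of the family `F`, all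
centres `x` and all `r ≥ 2 ε > 0`; the implied constant depends on the family only. -/
def IsGrowthExponent {d : ℕ} (F : Set (Finset (Pt d))) (s : ℝ) : Prop :=
  ∃ C : ℝ, ∀ P ∈ F, ∀ ε r : ℝ, 0 < ε → 2 * ε ≤ r → ∀ N : Finset (Pt d), IsNet ε P N →
    ∀ x : Pt d, (((N : Set (Pt d)) ∩ Metric.closedBall x r).ncard : ℝ) ≤ C * (r / ε) ^ s

/-- The fractal dimension of a family of finite point sets: the infimum of its (nonnegative) growth
exponents. -/
noncomputable def fractalDim {d : ℕ} (F : Set (Finset (Pt d))) : ℝ≥0∞ :=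
  ⨅ (s : ℝ) (_ : 0 ≤ s) (_ : IsGrowthExponent F s), ENNReal.ofReal s

/-! ### Euclidean travelling salesman tours -/

/-- The length of the closed tour that visits the points in the order
`p (σ 0), p (σ 1), …, p (σ (n - 1))` and returns to `p (σ 0)`. -/
noncomputable def tourLength {d n : ℕ} (p : Fin n ↪ Pt d) (σ : Equiv.Perm (Fin n)) : ℝ :=
  ∑ i : Fin n, dist (p (σ i)) (p (σ (finRotate n i)))

/-- `σ` is the visiting order of a shortest closed tour through all the points. -/
def IsOptimalTour {d n : ℕ} (p : Fin n ↪ Pt d) (σ : Equiv.Perm (Fin n)) : Prop :=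
  ∀ τ : Equiv.Perm (Fin n), tourLength p σ ≤ tourLength p τ

/-! ### The real RAM

The memory consists of two infinite arrays, `I` of natural numbers (counters and addresses) and `R`
of real numbers. Naturals can be added, subtracted (truncated at zero) and compared, and serve as
addresses into both arrays; reals can be added, subtracted, multiplied, divided and compared, and
square roots can be taken. There is no rounding and no other passage from reals to naturals than
through comparisons. A program is a finite text, with natural and rational constants only, built
from assignments, branching, loops and (possibly recursive) parameterless procedures. -/

/-- Memory contents. -/
structure Memory where
  I : ℕ → ℕ
  R : ℕ → ℝ

/-- Expressions with values in the natural numbers; `mem a` is `I[a]`. -/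
inductive NExp
  | lit (c : ℕ)
  | mem (a : NExp)
  | add (a b : NExp)
  | sub (a b : NExp)

/-- Expressions with values in the real numbers; `mem a` is `R[a]`. -/
inductive RExp
  | lit (c : ℚ)
  | mem (a : NExp)
  | add (a b : RExp)
  | sub (a b : RExp)
  | mul (a b : RExp)
  | div (a b : RExp)
  | sqrt (a : RExp)

/-- Comparisons `a ≤ b`. -/
inductive Test
  | nle (a b : NExp)
  | rle (a b : RExp)

/-- Commands: `nset a v` is `I[a] := v`, `rset a v` is `R[a] := v`, `call k` executes the `k`-th
procedure. -/
inductive Cmd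
  | skip
  | nset (a v : NExp)
  | rset (a : NExp) (v : RExp)
  | seq (c₁ c₂ : Cmd)
  | ite (b : Test) (c₁ c₂ : Cmd)
  | while (b : Test) (c : Cmd)
  | call (k : ℕ)

/-- A program: a main command and a finite list of procedures. -/
structure Program where
  main : Cmd
  procs : List Cmd

def NExp.eval (m : Memory) : NExp → ℕ
  | lit c => c
  | mem a => m.I (a.eval m)
  | add a b => a.eval m + b.eval m
  | sub a b => a.eval m - b.eval m

/-- The cost of evaluating an expression: one unit for each constant, memory access and
operation. -/
def NExp.cost : NExp → ℕ
  | lit _ => 1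
  | mem a => a.cost + 1
  | add a b => a.cost + b.cost + 1
  | sub a b => a.cost + b.cost + 1

noncomputable def RExp.eval (m : Memory) : RExp → ℝ
  | lit c => (c : ℝ)
  | mem a => m.R (a.eval m)
  | add a b => a.eval m + b.eval m
  | sub a b => a.eval m - b.eval m
  | mul a b => a.eval m * b.eval m
  | div a b => a.eval m / b.eval m
  | sqrt a => Real.sqrt (a.eval m)

def RExp.cost : RExp → ℕ
  | lit _ => 1
  | mem a => a.cost + 1
  | add a b => a.cost + b.cost + 1
  | sub a b => a.cost + b.cost + 1
  | mul a b => a.cost + b.cost + 1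
  | div a b => a.cost + b.cost + 1
  | sqrt a => a.cost + 1

def Test.holds (m : Memory) : Test → Prop
  | nle a b => a.eval m ≤ b.eval m
  | rle a b => a.eval m ≤ b.eval m

def Test.cost : Test → ℕ
  | nle a b => a.cost + b.cost + 1
  | rle a b => a.cost + b.cost + 1

/-- `Exec ps c m t m'`: with the procedures `ps`, the command `c` started in memory `m` halts after
`t` steps with memory `m'`. -/
inductive Exec (ps : List Cmd) : Cmd → Memory → ℕ → Memory → Prop
  | skip (m : Memory) : Exec ps .skip m 1 m
  | nset (a v : NExp) (m : Memory) :
      Exec ps (.nset a v) m (a.cost + v.cost + 1)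
        { m with I := Function.update m.I (a.eval m) (v.eval m) }
  | rset (a : NExp) (v : RExp) (m : Memory) :
      Exec ps (.rset a v) m (a.cost + v.cost + 1)
        { m with R := Function.update m.R (a.eval m) (v.eval m) }
  | seq {c₁ c₂ : Cmd} {m₁ m₂ m₃ : Memory} {t₁ t₂ : ℕ} :
      Exec ps c₁ m₁ t₁ m₂ → Exec ps c₂ m₂ t₂ m₃ → Exec ps (.seq c₁ c₂) m₁ (t₁ + t₂) m₃
  | iteTrue {b : Test} {c₁ c₂ : Cmd} {m m' : Memory} {t : ℕ} :
      b.holds m → Exec ps c₁ m t m' → Exec ps (.ite b c₁ c₂) m (b.cost + t) m'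
  | iteFalse {b : Test} {c₁ c₂ : Cmd} {m m' : Memory} {t : ℕ} :
      ¬ b.holds m → Exec ps c₂ m t m' → Exec ps (.ite b c₁ c₂) m (b.cost + t) m'
  | whileTrue {b : Test} {c : Cmd} {m₁ m₂ m₃ : Memory} {t₁ t₂ : ℕ} :
      b.holds m₁ → Exec ps c m₁ t₁ m₂ → Exec ps (.while b c) m₂ t₂ m₃ →
        Exec ps (.while b c) m₁ (b.cost + t₁ + t₂) m₃
  | whileFalse {b : Test} {c : Cmd} {m : Memory} :
      ¬ b.holds m → Exec ps (.while b c) m b.cost m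
  | call {k : ℕ} {c : Cmd} {m m' : Memory} {t : ℕ} :
      ps[k]? = some c → Exec ps c m t m' → Exec ps (.call k) m (t + 1) m'

/-- The program `A` started in memory `m` halts after `t` steps with memory `m'`. -/
def Program.Runs (A : Program) (m : Memory) (t : ℕ) (m' : Memory) : Prop :=
  Exec A.procs A.main m t m'

/-- The initial memory: `I[0] = n`, `R[0] = δ`, and `R[1 + (j + d * i)]` is the `j`-th coordinate of
the `i`-th point, for `i < n` and `j < d`; all other cells are zero. -/
noncomputable def input {d n : ℕ} (δ : ℝ) (p : Fin n ↪ Pt d) : Memory where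
  I := Function.update 0 0 n
  R
    | 0 => δ
    | k + 1 =>
      if h : k < n * d then
        p (finProdFinEquiv.symm ⟨k, h⟩).1 (finProdFinEquiv.symm ⟨k, h⟩).2
      else 0

end FractalTSP

/-! The edges of an optimal tour cannot be improved by reversing a stretch of the tour (`two_opt`).
If two edges of length at least `l`, oriented along the tour, start within `l / 16` of each other,
this forces the cosine of their angle to be at most `-3/4`. Three vectors cannot be pairwise so
obtuse, hence at most two such edges start near one place. With the growth condition on nets, the
number of edges of length at least `l` that start in a ball of radius `2 r` is therefore at most a
constant times `(r / l) ^ s` (`card_long_edges_le`).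

This yields small separators. Take the smallest ball, of radius `r`, around a point of `Q` that
contains the fraction `1 / (k + 1)` of `Q`; the growth condition and minimality limit the ball of
radius `2 r` to the fraction `k / (k + 1)`. For a random radius in `[r, 2 r]` an edge is cut with
probability at most its length over `r`. Summing over dyadic lengths gives a cut of order `m ^ (1 -
1 / δ)`, `log m` or `1` in the three regimes (`exists_separator`). Recursion, first inside the ball
and then outside, orders the points so that every initial segment is described by `O(log n)`
accepting or rejecting balls. The cuts add up only along one branch of the recursion, to `O(growth δ
n)` (`exists_arrangement`).

Now let the points enter an empty tour in this order, each at its final position. For the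
continuation only the set of visited points and the contents of the boundary positions matter. Both
fit into a code of `5 M` digits in base `n + 1` with `M = O(growth δ n)`, and partial tours with
equal codes are interchangeable (`IsCodeOf.transfer`). The program knows neither the tour nor the
ordering. In each of `n` rounds it extends the tour stored for every code by every point at every
position, offers the result to every code, and keeps the shorter tour. Stored tours always match
their codes, and the code `0` stands for complete tours, so the output is a tour. The hidden
sequence of codes of an optimal tour (`exists_code_sequence`) shows that it is optimal.

All loops make at most `Z = n ^ O(growth δ n)` iterations, and the running time is polynomial in
`Z`. -/

namespace FractalTSP

/-! ### Total correctness with a time bound -/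

/-- An upper bound for the running time of a command all of whose loops make at most `Z`
iterations. -/
def Cmd.bound (Z : ℕ) : Cmd → ℕ
  | .skip => 1
  | .nset a v => a.cost + v.cost + 1
  | .rset a v => a.cost + v.cost + 1
  | .seq c₁ c₂ => c₁.bound Z + c₂.bound Z
  | .ite b c₁ c₂ => b.cost + (c₁.bound Z + c₂.bound Z)
  | .while b c => Z * (b.cost + c.bound Z) + b.cost
  | .call _ => 0

/-- Each level of loop nesting contributes a factor `Z` and everything else contributes constants,
so coefficient and degree depend on the program text alone. Polynomial dependence on `Z` is enough,
because `Z` will be `n` to a multiple of the order of growth. -/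
theorem Cmd.exists_bound_le (c : Cmd) : ∃ K k : ℕ, ∀ Z, 1 ≤ Z → c.bound Z ≤ K * Z ^ k := by
  have hadd : ∀ (a b K₁ k₁ K₂ k₂ Z : ℕ), 1 ≤ Z → a ≤ K₁ * Z ^ k₁ → b ≤ K₂ * Z ^ k₂ →
      a + b ≤ (K₁ + K₂) * Z ^ (k₁ + k₂) := by
    intro a b K₁ k₁ K₂ k₂ Z hZ ha hb
    have h1 : Z ^ k₁ ≤ Z ^ (k₁ + k₂) := Nat.pow_le_pow_right hZ (by omega)
    have h2 : Z ^ k₂ ≤ Z ^ (k₁ + k₂) := Nat.pow_le_pow_right hZ (by omega)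
    have h3 := Nat.mul_le_mul_left K₁ h1
    have h4 := Nat.mul_le_mul_left K₂ h2
    rw [add_mul]; omega
  induction c
  · exact ⟨1, 0, fun Z _ => by simp [Cmd.bound]⟩
  · rename_i a v
    exact ⟨a.cost + v.cost + 1, 0, fun Z _ => by simp [Cmd.bound]⟩
  · rename_i a v
    exact ⟨a.cost + v.cost + 1, 0, fun Z _ => by simp [Cmd.bound]⟩
  · rename_i c₁ c₂ h₁ h₂
    obtain ⟨K₁, k₁, h₁⟩ := h₁
    obtain ⟨K₂, k₂, h₂⟩ := h₂
    exact ⟨K₁ + K₂, k₁ + k₂, fun Z hZ => hadd _ _ _ _ _ _ Z hZ (h₁ Z hZ) (h₂ Z hZ)⟩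
  · rename_i b c₁ c₂ h₁ h₂
    obtain ⟨K₁, k₁, h₁⟩ := h₁
    obtain ⟨K₂, k₂, h₂⟩ := h₂
    exact ⟨b.cost + (K₁ + K₂), 0 + (k₁ + k₂), fun Z hZ => hadd _ _ _ _ _ _ Z hZ (by simp)
      (hadd _ _ _ _ _ _ Z hZ (h₁ Z hZ) (h₂ Z hZ))⟩
  · rename_i b c h
    obtain ⟨K₁, k₁, h₁⟩ := h
    refine ⟨(b.cost + K₁) + b.cost, (0 + k₁ + 1) + 0, fun Z hZ => hadd _ _ _ _ _ _ Z hZ ?_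
      (by simp)⟩
    have := hadd b.cost (c.bound Z) b.cost 0 K₁ k₁ Z hZ (by simp) (h₁ Z hZ)
    calc Z * (b.cost + c.bound Z) ≤ Z * ((b.cost + K₁) * Z ^ (0 + k₁)) :=
          Nat.mul_le_mul_left _ this
      _ = _ := by ring
  · exact ⟨0, 0, fun Z _ => by simp [Cmd.bound]⟩

/-- Started in `m`, the command `c` halts within `c.bound Z` steps in a memory satisfying `Q`. -/
def wp (Z : ℕ) (c : Cmd) (Q : Memory → Prop) (m : Memory) : Prop :=
  ∃ t m', Exec [] c m t m' ∧ t ≤ c.bound Z ∧ Q m'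

theorem wp_mono {Z : ℕ} {c : Cmd} {Q Q' : Memory → Prop} {m : Memory} (h : wp Z c Q m)
    (hQ : ∀ m', Q m' → Q' m') : wp Z c Q' m := by
  obtain ⟨t, m', h1, h2, h3⟩ := h
  exact ⟨t, m', h1, h2, hQ _ h3⟩

theorem wp_skip {Z : ℕ} {Q : Memory → Prop} {m : Memory} (h : Q m) : wp Z .skip Q m :=
  ⟨1, m, .skip m, le_rfl, h⟩

theorem wp_seq {Z : ℕ} {c₁ c₂ : Cmd} {Q : Memory → Prop} {m : Memory}
    (h : wp Z c₁ (wp Z c₂ Q) m) : wp Z (.seq c₁ c₂) Q m := by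
  obtain ⟨t, m', h1, h2, t', m'', h3, h4, h5⟩ := h
  exact ⟨t + t', m'', .seq h1 h3, Nat.add_le_add h2 h4, h5⟩

theorem wp_ite {Z : ℕ} {b : Test} {c₁ c₂ : Cmd} {Q : Memory → Prop} {m : Memory}
    (h₁ : b.holds m → wp Z c₁ Q m) (h₂ : ¬ b.holds m → wp Z c₂ Q m) :
    wp Z (.ite b c₁ c₂) Q m := by
  by_cases hb : b.holds m
  · obtain ⟨t, m', h1, h2, h3⟩ := h₁ hb
    exact ⟨_, m', .iteTrue hb h1, by simp only [Cmd.bound]; omega, h3⟩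
  · obtain ⟨t, m', h1, h2, h3⟩ := h₂ hb
    exact ⟨_, m', .iteFalse hb h1, by simp only [Cmd.bound]; omega, h3⟩

theorem wp_rset {Z : ℕ} {a : NExp} {v : RExp} {Q : Memory → Prop} {m : Memory}
    (h : Q { m with R := Function.update m.R (a.eval m) (v.eval m) }) : wp Z (.rset a v) Q m :=
  ⟨_, _, .rset a v m, le_rfl, h⟩

theorem wp_nset {Z : ℕ} {a : NExp} {v : NExp} {Q : Memory → Prop} {m : Memory}
    (h : Q { m with I := Function.update m.I (a.eval m) (v.eval m) }) : wp Z (.nset a v) Q m :=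
  ⟨_, _, .nset a v m, le_rfl, h⟩

/-- A loop with an invariant indexed by the number of iterations. -/
theorem wp_while {Z : ℕ} {b : Test} {c : Cmd} {N : ℕ} (J : ℕ → Memory → Prop) {m : Memory}
    (hN : N ≤ Z) (h0 : J 0 m) (ht : ∀ k m, k < N → J k m → b.holds m)
    (hf : ∀ m, J N m → ¬ b.holds m) (hs : ∀ k m, k < N → J k m → wp Z c (J (k + 1)) m) :
    wp Z (.while b c) (J N) m := by
  have key : ∀ r k m, k + r = N → J k m →
      ∃ t m', Exec [] (.while b c) m t m' ∧ t ≤ r * (b.cost + c.bound Z) + b.cost ∧ J N m' := by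
    intro r
    induction r with
    | zero =>
      intro k m hk hJ
      obtain rfl : k = N := by omega
      exact ⟨_, m, .whileFalse (hf m hJ), by simp, hJ⟩
    | succ r ih =>
      intro k m hk hJ
      obtain ⟨t, m', h1, h2, h3⟩ := hs k m (by omega) hJ
      obtain ⟨t', m'', h4, h5, h6⟩ := ih (k + 1) m' (by omega) h3
      exact ⟨_, m'', .whileTrue (ht k m (by omega) hJ) h1 h4, by rw [add_mul]; omega, h6⟩
  obtain ⟨t, m', h1, h2, h3⟩ := key N 0 m (by omega) h0
  refine ⟨t, m', h1, h2.trans ?_, h3⟩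
  simp only [Cmd.bound]
  have := Nat.mul_le_mul_right (b.cost + c.bound Z) hN
  omega

/-! ### Interleaved arrays -/

/-- The memory of natural numbers as 32 interleaved arrays. -/
def Memory.arr (m : Memory) (j i : ℕ) : ℕ := m.I (32 * i + j)

def Memory.put (m : Memory) (j i v : ℕ) : Memory :=
  { m with I := Function.update m.I (32 * i + j) v }

@[simp] theorem Memory.put_R (m : Memory) (j i v : ℕ) : (m.put j i v).R = m.R := rfl

theorem Memory.arr_put (m : Memory) {j i v j' i' : ℕ} (hj : j < 32) (hj' : j' < 32) :
    (m.put j i v).arr j' i' = if j' = j ∧ i' = i then v else m.arr j' i' := by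
  unfold Memory.put Memory.arr
  by_cases h : j' = j ∧ i' = i
  · simp [h]
  · rw [if_neg h]
    exact Function.update_of_ne (by omega) _ _

def NExp.dbl (e : NExp) : NExp := .add e e

/-- The address of entry `e` of array `j`. -/
def addr (j : ℕ) (e : NExp) : NExp := .add e.dbl.dbl.dbl.dbl.dbl (.lit j)

/-- The scalar variable `j`. -/
def var (j : ℕ) : NExp := .mem (.lit j)

/-- Entry `e` of array `j`. -/
def ent (j : ℕ) (e : NExp) : NExp := .mem (addr j e)

def setVar (j : ℕ) (e : NExp) : Cmd := .nset (.lit j) e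

def setEnt (j : ℕ) (i e : NExp) : Cmd := .nset (addr j i) e

def Test.eq (a b : NExp) : Test := .nle (.add (.sub a b) (.sub b a)) (.lit 0)

/-- `for x < e do c`. -/
def forC (x : ℕ) (e : NExp) (c : Cmd) : Cmd :=
  .seq (setVar x (.lit 0))
    (.while (.nle (.add (var x) (.lit 1)) e) (.seq c (setVar x (.add (var x) (.lit 1)))))

theorem eval_addr (m : Memory) (j : ℕ) (e : NExp) :
    (addr j e).eval m = 32 * e.eval m + j := by
  simp only [addr, NExp.dbl, NExp.eval]; omega

@[simp] theorem eval_var (m : Memory) (j : ℕ) : (var j).eval m = m.arr j 0 := by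
  simp [var, NExp.eval, Memory.arr]

@[simp] theorem eval_ent (m : Memory) (j : ℕ) (e : NExp) :
    (ent j e).eval m = m.arr j (e.eval m) := by
  simp [ent, NExp.eval, Memory.arr, eval_addr]

@[simp] theorem eval_lit (m : Memory) (c : ℕ) : (NExp.lit c).eval m = c := rfl

@[simp] theorem eval_add (m : Memory) (a b : NExp) :
    (NExp.add a b).eval m = a.eval m + b.eval m := rfl

@[simp] theorem eval_sub (m : Memory) (a b : NExp) :
    (NExp.sub a b).eval m = a.eval m - b.eval m := rfl

@[simp] theorem holds_nle (m : Memory) (a b : NExp) :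
    (Test.nle a b).holds m ↔ a.eval m ≤ b.eval m := Iff.rfl

@[simp] theorem holds_rle (m : Memory) (a b : RExp) :
    (Test.rle a b).holds m ↔ a.eval m ≤ b.eval m := Iff.rfl

@[simp] theorem holds_eq (m : Memory) (a b : NExp) :
    (Test.eq a b).holds m ↔ a.eval m = b.eval m := by
  simp only [Test.eq, holds_nle, eval_add, eval_sub, eval_lit]; omega

theorem wp_setVar {Z j : ℕ} {e : NExp} {Q : Memory → Prop} {m : Memory}
    (h : Q (m.put j 0 (e.eval m))) : wp Z (setVar j e) Q m := by
  refine wp_nset ?_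
  simpa [Memory.put] using h

theorem wp_setEnt {Z j : ℕ} {i e : NExp} {Q : Memory → Prop} {m : Memory}
    (h : Q (m.put j (i.eval m) (e.eval m))) : wp Z (setEnt j i e) Q m := by
  refine wp_nset ?_
  simpa [Memory.put, eval_addr] using h

/-! ### Frames -/

/-- Only the arrays in `s` and the real cell `0` may differ. -/
structure Fr (s : List ℕ) (m m' : Memory) : Prop where
  arr : ∀ j, j < 32 → j ∉ s → ∀ i, m'.arr j i = m.arr j i
  real : ∀ k, m'.R (k + 1) = m.R (k + 1)

theorem Fr.refl (s : List ℕ) (m : Memory) : Fr s m m := ⟨fun _ _ _ _ => rfl, fun _ => rfl⟩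

theorem Fr.trans {s : List ℕ} {m₁ m₂ m₃ : Memory} (h₁ : Fr s m₁ m₂) (h₂ : Fr s m₂ m₃) :
    Fr s m₁ m₃ :=
  ⟨fun j hj hs i => (h₂.arr j hj hs i).trans (h₁.arr j hj hs i),
    fun k => (h₂.real k).trans (h₁.real k)⟩

theorem Fr.mono {s s' : List ℕ} {m₁ m₂ : Memory} (h : Fr s m₁ m₂) (hs : s ⊆ s') :
    Fr s' m₁ m₂ :=
  ⟨fun j hj h' i => h.arr j hj (fun hh => h' (hs hh)) i, h.real⟩

theorem Fr.put {s : List ℕ} {m₁ m₂ : Memory} (h : Fr s m₁ m₂) {j i v : ℕ} (hj : j < 32)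
    (hs : j ∈ s) : Fr s m₁ (m₂.put j i v) :=
  ⟨fun j' hj' hs' i' => by
    rw [Memory.arr_put _ hj hj', if_neg (by rintro ⟨rfl, -⟩; exact hs' hs)]
    exact h.arr j' hj' hs' i', h.real⟩

theorem Fr.setR {s : List ℕ} {m₁ m₂ : Memory} (h : Fr s m₁ m₂) (v : ℝ) :
    Fr s m₁ { m₂ with R := Function.update m₂.R 0 v } :=
  ⟨h.arr, fun k => by simpa using h.real k⟩

/-- The body writes only to the arrays in `s`; the counter lies outside of `s` and hence survives
it. The invariant has to tolerate a change of the counter, which is increased after each iteration.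
-/
theorem wp_for {Z x N : ℕ} {e : NExp} {c : Cmd} {s : List ℕ} {m₀ : Memory}
    (J : ℕ → Memory → Prop) (hN : N ≤ Z) (hx32 : x < 32) (hx : x ∉ s)
    (he : ∀ m, Fr (x :: s) m₀ m → e.eval m = N)
    (hJ : ∀ k m v, J k m → J k (m.put x 0 v)) (h0 : J 0 m₀)
    (hs : ∀ k m, k < N → Fr (x :: s) m₀ m → m.arr x 0 = k → J k m →
      wp Z c (fun m' => Fr s m m' ∧ J (k + 1) m') m) :
    wp Z (forC x e c) (fun m' => Fr (x :: s) m₀ m' ∧ J N m') m₀ := by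
  refine wp_seq (wp_setVar ?_)
  refine wp_mono (wp_while (N := N)
    (fun k m => Fr (x :: s) m₀ m ∧ m.arr x 0 = k ∧ J k m) hN ?_ ?_ ?_ ?_) ?_
  · exact ⟨(Fr.refl _ _).put hx32 (by simp), by simp [Memory.arr_put _ hx32 hx32], hJ _ _ _ h0⟩
  · rintro k m hk ⟨h1, h2, -⟩
    simp only [holds_nle, eval_add, eval_var, eval_lit, he m h1]; omega
  · rintro m ⟨h1, h2, -⟩
    simp only [holds_nle, eval_add, eval_var, eval_lit, he m h1]; omega
  · rintro k m hk ⟨h1, h2, h3⟩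
    refine wp_seq (wp_mono (hs k m hk h1 h2 h3) ?_)
    rintro m' ⟨h4, h5⟩
    refine wp_setVar ⟨(h1.trans (h4.mono (by simp))).put hx32 (by simp), ?_, hJ _ _ _ h5⟩
    simp [Memory.arr_put _ hx32 hx32, h4.arr x hx32 hx, h2]
  · rintro m' ⟨h1, -, h2⟩
    exact ⟨h1, h2⟩

/-! ### Distances -/

def NExp.smul (e : NExp) : ℕ → NExp
  | 0 => .lit 0
  | k + 1 => .add (e.smul k) e

def coordExp (d : ℕ) (e : NExp) (k : ℕ) : RExp := .mem (.add (e.smul d) (.lit (k + 1)))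

def sqSumExp (d : ℕ) (a b : NExp) : ℕ → RExp
  | 0 => .lit 0
  | k + 1 => .add (sqSumExp d a b k)
      (.mul (.sub (coordExp d a k) (coordExp d b k)) (.sub (coordExp d a k) (coordExp d b k)))

def distExp (d : ℕ) (a b : NExp) : RExp := .sqrt (sqSumExp d a b d)

/-- The distance of the points number `i` and `j` that are stored in `R`. -/
noncomputable def storedDist (d : ℕ) (R : ℕ → ℝ) (i j : ℕ) : ℝ :=
  Real.sqrt (∑ k ∈ Finset.range d, (R (d * i + (k + 1)) - R (d * j + (k + 1))) ^ 2)

@[simp] theorem eval_smul (m : Memory) (e : NExp) (k : ℕ) :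
    (e.smul k).eval m = k * e.eval m := by
  induction k with
  | zero => simp [NExp.smul]
  | succ k ih => simp only [NExp.smul, eval_add, ih]; ring

theorem eval_distExp (d : ℕ) (m : Memory) (a b : NExp) :
    (distExp d a b).eval m = storedDist d m.R (a.eval m) (b.eval m) := by
  have : ∀ k, (sqSumExp d a b k).eval m = ∑ k ∈ Finset.range k,
      (m.R (d * a.eval m + (k + 1)) - m.R (d * b.eval m + (k + 1))) ^ 2 := by
    intro k
    induction k with
    | zero => simp [sqSumExp, RExp.eval]
    | succ k ih =>
      rw [Finset.sum_range_succ, ← ih]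
      simp [sqSumExp, RExp.eval, coordExp, pow_two]
  simp [distExp, RExp.eval, this, storedDist]

theorem Fr.storedDist {s : List ℕ} {m m' : Memory} (h : Fr s m m') (d : ℕ) :
    storedDist d m'.R = storedDist d m.R := by
  funext i j
  simp only [FractalTSP.storedDist, ← add_assoc, h.real]

/-! ### Partial tours and their codes -/

/-- The effect of one rule: kind 1 accepts the points of the ball around `x` through `y`, kind 2
rejects the points outside of it. -/
noncomputable def ruleStep (D : ℕ → ℕ → ℝ) (fl x y p r : ℕ) : ℕ :=
  open Classical in
  if fl = 1 then (if D x p ≤ D x y then 1 else r)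
  else if fl = 2 then (if D x p ≤ D x y then r else 0) else r

/-- Membership of `p` in the set described by the first `k` rules. -/
noncomputable def accepts (D : ℕ → ℕ → ℝ) (fl x y : ℕ → ℕ) (p r : ℕ) : ℕ → ℕ
  | 0 => r
  | k + 1 => ruleStep D (fl k) (x k) (y k) p (accepts D fl x y p r k)

/-- Digit number `5 k + j` of `w` in base `n + 1`. -/
def codeDigit (n j w k : ℕ) : ℕ := w / (n + 1) ^ (5 * k + j) % (n + 1)

/-- The number of positions in which `T` visits the point `p`. -/
def visits (T : ℕ → ℕ) (p : ℕ) : ℕ → ℕ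
  | 0 => 0
  | i + 1 => visits T p i + if T i = p + 1 then 1 else 0

def BoundaryAt (n M : ℕ) (T qq u : ℕ → ℕ) (q : ℕ) : Prop :=
  (∀ k < M, qq k = q + 1 → T q = u k) ∧
    ((∃ k < M, qq k = q + 1) ∨
      (0 < q ∧ q + 1 < n ∧ (T (q - 1) = 0 ↔ T q = 0) ∧ (T q = 0 ↔ T (q + 1) = 0)))

/-- The partial tour `T` (visiting `T i - 1` in position `i`, and nothing if `T i = 0`) has the
point set and the boundary described by `w`. -/
def Matches (D : ℕ → ℕ → ℝ) (n M : ℕ) (T : ℕ → ℕ) (w : ℕ) : Prop :=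
  (∀ p < n, visits T p n =
      accepts D (codeDigit n 0 w) (codeDigit n 1 w) (codeDigit n 2 w) p (1 - w) M) ∧
    (w = 0 ∨ ∀ q < n, BoundaryAt n M T (codeDigit n 3 w) (codeDigit n 4 w) q)

def nextPos (n i : ℕ) : ℕ := if i + 1 < n then i + 1 else 0

noncomputable def edgeCost (D : ℕ → ℕ → ℝ) (n : ℕ) (T : ℕ → ℕ) (i : ℕ) : ℝ :=
  if T i = 0 ∨ T (nextPos n i) = 0 then 0 else D (T i - 1) (T (nextPos n i) - 1)

/-- The length of a partial tour. -/
noncomputable def partialCost (D : ℕ → ℕ → ℝ) (n : ℕ) (T : ℕ → ℕ) : ℝ :=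
  ∑ i ∈ Finset.range n, edgeCost D n T i

/-! ### The program -/

notation "cN" => 0
notation "cWidth" => 1
notation "cCodes" => 2
notation "cRound" => 3
notation "cFrom" => 4
notation "cPoint" => 5
notation "cPos" => 6
notation "cTo" => 7
notation "cOuter" => 8
notation "cRule" => 9
notation "cInner" => 10
notation "cOk" => 11
notation "cRes" => 12
notation "cCount" => 13
notation "cListed" => 14
notation "cQuot" => 15
notation "cRem" => 16
notation "cNewQuot" => 17
notation "cPtr" => 18
notation "cNext" => 19
notation "cTour" => 20
notation "cTable" => 21
notation "cSet" => 22
notation "cKind" => 23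
notation "cCentre" => 24
notation "cThrough" => 25
notation "cListPos" => 26
notation "cListVal" => 27
notation "cOut" => 28
notation "cTmp" => 29
notation "cPtrTo" => 30
notation "cAux" => 31

def incr (x : ℕ) : Cmd := setVar x (.add (var x) (.lit 1))

def mulC (z : ℕ) (a b : NExp) (x : ℕ) : Cmd :=
  .seq (setVar z (.lit 0)) (forC x a (setVar z (.add (var z) b)))

/-- Splits off the last digit in base `n + 1` of the variable `cQuot`. -/
def digitC (a : ℕ) : Cmd :=
  .seq (setVar cRem (var cQuot)) (.seq (setVar cNewQuot (.lit 0))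
    (.seq (forC cAux (var cQuot) (.ite (.nle (.add (var cN) (.lit 1)) (var cRem))
        (.seq (setVar cRem (.sub (var cRem) (.add (var cN) (.lit 1)))) (incr cNewQuot)) .skip))
      (.seq (setEnt a (var cRule) (var cRem)) (setVar cQuot (var cNewQuot)))))

def decodeC : Cmd :=
  .seq (setVar cQuot (var cTo)) (forC cRule (var cWidth)
    (.seq (digitC cKind) (.seq (digitC cCentre) (.seq (digitC cThrough)
      (.seq (digitC cListPos) (digitC cListVal))))))

def acceptsC (d : ℕ) : Cmd :=
  .seq (setVar cRes (.sub (.lit 1) (var cTo)))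
    (forC cRule (var cWidth)
      (.ite (.eq (ent cKind (var cRule)) (.lit 1))
        (.ite (.rle (distExp d (ent cCentre (var cRule)) (var cOuter))
            (distExp d (ent cCentre (var cRule)) (ent cThrough (var cRule))))
          (setVar cRes (.lit 1)) .skip)
        (.ite (.eq (ent cKind (var cRule)) (.lit 2))
          (.ite (.rle (distExp d (ent cCentre (var cRule)) (var cOuter))
              (distExp d (ent cCentre (var cRule)) (ent cThrough (var cRule))))
            .skip (setVar cRes (.lit 0)))
          .skip)))

def visitsC : Cmd :=
  .seq (setVar cCount (.lit 0)) (forC cInner (var cN)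
    (.ite (.eq (ent cTour (var cInner)) (.add (var cOuter) (.lit 1))) (incr cCount) .skip))

def setCheckC (d : ℕ) : Cmd :=
  forC cOuter (var cN) (.seq (acceptsC d) (.seq visitsC
    (.ite (.eq (var cCount) (var cRes)) .skip (setVar cOk (.lit 0)))))

/-- Truncated subtraction turns the status of a position into a number, `1` for empty and `0` for
occupied, so that one equality test compares the status of two positions. -/
def isEmptyExp (e : NExp) : NExp := .sub (.lit 1) (ent cTour e)

def boundaryCheckC : Cmd :=
  forC cOuter (var cN) (.seq (setVar cListed (.lit 0)) (.seq
    (forC cRule (var cWidth) (.ite (.eq (ent cListPos (var cRule)) (.add (var cOuter) (.lit 1)))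
      (.seq (setVar cListed (.lit 1))
        (.ite (.eq (ent cTour (var cOuter)) (ent cListVal (var cRule))) .skip
          (setVar cOk (.lit 0)))) .skip))
    (.ite (.nle (.lit 1) (var cListed)) .skip
      (.ite (.nle (.lit 1) (var cOuter))
        (.ite (.nle (.add (var cOuter) (.lit 2)) (var cN))
          (.ite (.eq (isEmptyExp (.sub (var cOuter) (.lit 1))) (isEmptyExp (var cOuter)))
            (.ite (.eq (isEmptyExp (var cOuter)) (isEmptyExp (.add (var cOuter) (.lit 1))))
              .skip (setVar cOk (.lit 0)))
            (setVar cOk (.lit 0)))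
          (setVar cOk (.lit 0)))
        (setVar cOk (.lit 0))))))

def matchC (d : ℕ) : Cmd :=
  .seq decodeC (.seq (setVar cOk (.lit 1)) (.seq (setCheckC d)
    (.ite (.nle (.lit 1) (var cOk)) (.ite (.nle (var cTo) (.lit 0)) .skip boundaryCheckC) .skip)))

/-! ### Specifications of the parts -/

theorem mulC_spec {Z z x N y : ℕ} {a b : NExp} {m : Memory} (hz : z < 32) (hx : x < 32)
    (hzx : x ≠ z) (hN : N ≤ Z) (ha : ∀ m', Fr [x, z] m m' → a.eval m' = N)
    (hb : ∀ m', Fr [x, z] m m' → b.eval m' = y) :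
    wp Z (mulC z a b x) (fun m' => Fr [x, z] m m' ∧ m'.arr z 0 = N * y) m := by
  refine wp_seq (wp_setVar ?_)
  have hF : Fr [x, z] m (m.put z 0 0) := (Fr.refl _ _).put hz (by simp)
  refine wp_mono (wp_for (s := [z]) (fun k m' => m'.arr z 0 = k * y) hN hx (by simpa using hzx)
    ?_ ?_ ?_ ?_) ?_
  · exact fun m' h => ha m' (hF.trans h)
  · intro k m v h
    rw [Memory.arr_put _ hx hz, if_neg (by tauto), h]
  · simp [Memory.arr_put _ hz hz]
  · intro k m' hk h1 h2 h3
    refine wp_setVar ⟨(Fr.refl _ _).put hz (by simp), ?_⟩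
    simp [Memory.arr_put _ hz hz, h3, hb m' (hF.trans h1)]; ring
  · rintro m' ⟨h1, h2⟩
    exact ⟨hF.trans h1, h2⟩

/-- Natural numbers cannot be divided by the machine, so the quotient is found by repeated
subtraction. There are as many rounds as the dividend; those after the quotient is reached are idle,
whence the `min` in the invariant. The bounds on `a` keep the target array apart from the scratch
variables. -/
theorem digitC_spec {Z a : ℕ} {m : Memory} (ha : a < 32) (ha' : 23 ≤ a) (ha'' : a < 31)
    (hZ : m.arr cQuot 0 ≤ Z) :
    wp Z (digitC a) (fun m' => Fr [cQuot, cRem, cNewQuot, cAux, a] m m' ∧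
      m'.arr cQuot 0 = m.arr cQuot 0 / (m.arr cN 0 + 1) ∧
      (∀ i, m'.arr a i = if i = m.arr cRule 0 then m.arr cQuot 0 % (m.arr cN 0 + 1)
        else m.arr a i)) m := by
  set c := m.arr cQuot 0 with hc
  set n := m.arr cN 0 with hn
  refine wp_seq (wp_setVar (wp_seq (wp_setVar (wp_seq ?_))))
  set m₁ := (m.put cRem 0 ((var cQuot).eval m)).put cNewQuot 0 _ with hm₁
  have e₁ : m₁.arr cRem 0 = c ∧ m₁.arr cNewQuot 0 = 0 ∧ m₁.arr cQuot 0 = c ∧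
      m₁.arr cN 0 = n := by
    simp [hm₁, Memory.arr_put, hc, hn]
  have hF : Fr [cQuot, cRem, cNewQuot, cAux, a] m m₁ :=
    ((Fr.refl _ _).put (by norm_num) (by simp)).put (by norm_num) (by simp)
  refine wp_mono (wp_for (s := [cRem, cNewQuot])
    (fun k m' => m'.arr cNewQuot 0 = min k (c / (n + 1)) ∧
      m'.arr cRem 0 + (n + 1) * m'.arr cNewQuot 0 = c) hZ (by norm_num) (by simp)
    (fun m' h => ?_) ?_ ?_ ?_) ?_
  · simp [h.arr, e₁]
  · intro k m v h
    simpa [Memory.arr_put] using h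
  · simp [e₁]
  · rintro k m' hk h1 h2 ⟨h3, h4⟩
    have hn' : m'.arr cN 0 = n := by simp [h1.arr, e₁]
    have hmul := Nat.div_add_mod c (n + 1)
    have hlt : c % (n + 1) < n + 1 := Nat.mod_lt c (Nat.succ_pos n)
    refine wp_ite (fun hb => ?_) (fun hb => ?_)
    · simp [hn'] at hb
      refine wp_seq (wp_setVar (wp_setVar ?_))
      refine ⟨((Fr.refl _ _).put (by norm_num) (by simp)).put (by norm_num) (by simp), ?_, ?_⟩
      · simp [Memory.arr_put, h3]
        have : k < c / (n + 1) := by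
          by_contra hcon
          rw [min_eq_right (by omega)] at h3
          rw [h3] at h4
          omega
        omega
      · simp [Memory.arr_put, hn', mul_add]
        omega
    · simp [hn'] at hb
      refine wp_skip ⟨Fr.refl _ _, ?_, h4⟩
      rw [h3]
      have : c / (n + 1) ≤ k := by
        by_contra hcon
        rw [min_eq_left (by omega)] at h3
        rw [h3] at h4
        have : (n + 1) * (k + 1) ≤ (n + 1) * (c / (n + 1)) := Nat.mul_le_mul_left _ (by omega)
        rw [mul_add] at this
        omega
      omega
  · rintro m' ⟨h1, h2, h3⟩
    have hdiv : m'.arr cNewQuot 0 = c / (n + 1) := by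
      rw [h2]; exact min_eq_right (Nat.div_le_self _ _)
    have hrem : m'.arr cRem 0 = c % (n + 1) := by
      have hmul := Nat.div_add_mod c (n + 1)
      rw [hdiv] at h3; omega
    refine wp_seq (wp_setEnt (wp_setVar ⟨?_, ?_, ?_⟩))
    · refine Fr.put (Fr.put ?_ ha (by simp)) (by norm_num) (by simp)
      exact hF.trans (h1.mono (by simp))
    · simp [Memory.arr_put, ha]
      rw [if_neg (by omega), hdiv]
    · intro i
      have hk : m'.arr cRule 0 = m.arr cRule 0 := by
        simp [h1.arr, hm₁, Memory.arr_put]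
      have hai : m'.arr a i = m.arr a i := by
        rw [h1.arr a ha (by simp; omega), hm₁, Memory.arr_put _ (by norm_num) ha,
          Memory.arr_put _ (by norm_num) ha, if_neg (by omega), if_neg (by omega)]
      simp [Memory.arr_put, ha, hk, hai, hrem]
      intro h; omega

theorem decodeC_spec {Z n M w : ℕ} {m : Memory} (hn : m.arr cN 0 = n) (hM : m.arr cWidth 0 = M)
    (hw : m.arr cTo 0 = w) (hMZ : M ≤ Z) (hwZ : w ≤ Z) :
    wp Z decodeC (fun m' => Fr [9, 15, 16, 17, 31, 23, 24, 25, 26, 27] m m' ∧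
      ∀ k < M, ∀ j < 5, m'.arr (23 + j) k = codeDigit n j w k) m := by
  refine wp_seq (wp_setVar ?_)
  refine wp_mono (wp_for (s := [15, 16, 17, 31, 23, 24, 25, 26, 27])
    (fun k m' => m'.arr cQuot 0 = w / (n + 1) ^ (5 * k) ∧
      ∀ k' < k, ∀ j < 5, m'.arr (23 + j) k' = codeDigit n j w k') hMZ (by norm_num) (by simp)
    (fun m' h => ?_) ?_ ?_ ?_) ?_
  · simp [h.arr, Memory.arr_put, hM]
  · rintro k m v ⟨h1, h2⟩
    refine ⟨by simpa [Memory.arr_put] using h1, fun k' hk' j hj => ?_⟩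
    rw [Memory.arr_put _ (by norm_num) (by omega), if_neg (by omega), h2 k' hk' j hj]
  · simp [Memory.arr_put, hw]
  · rintro k m' hk h1 h2 ⟨h3, h4⟩
    have hn' : m'.arr cN 0 = n := by simp [h1.arr, Memory.arr_put, hn]
    have le : ∀ e, w / (n + 1) ^ e ≤ Z := fun e => (Nat.div_le_self _ _).trans hwZ
    have step : ∀ e, w / (n + 1) ^ e / (n + 1) = w / (n + 1) ^ (e + 1) := fun e => by
      rw [Nat.div_div_eq_div_mul, pow_succ]
    refine wp_seq (wp_mono (digitC_spec (by norm_num) (by norm_num) (by norm_num)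
      (by rw [h3]; exact le _)) ?_)
    rintro m1 ⟨f1, q1, d1⟩
    have r1 : m1.arr cRule 0 = k := by simp [f1.arr, h2]
    have n1 : m1.arr cN 0 = n := by simp [f1.arr, hn']
    rw [h3, hn', step] at q1
    rw [h3, hn', h2] at d1
    refine wp_seq (wp_mono (digitC_spec (by norm_num) (by norm_num) (by norm_num)
      (by rw [q1]; exact le _)) ?_)
    rintro m2 ⟨f2, q2, d2⟩
    have r2 : m2.arr cRule 0 = k := by simp [f2.arr, r1]
    have n2 : m2.arr cN 0 = n := by simp [f2.arr, n1]
    rw [q1, n1, step] at q2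
    rw [q1, n1, r1] at d2
    refine wp_seq (wp_mono (digitC_spec (by norm_num) (by norm_num) (by norm_num)
      (by rw [q2]; exact le _)) ?_)
    rintro m3 ⟨f3, q3, d3⟩
    have r3 : m3.arr cRule 0 = k := by simp [f3.arr, r2]
    have n3 : m3.arr cN 0 = n := by simp [f3.arr, n2]
    rw [q2, n2, step] at q3
    rw [q2, n2, r2] at d3
    refine wp_seq (wp_mono (digitC_spec (by norm_num) (by norm_num) (by norm_num)
      (by rw [q3]; exact le _)) ?_)
    rintro m4 ⟨f4, q4, d4⟩
    have r4 : m4.arr cRule 0 = k := by simp [f4.arr, r3]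
    have n4 : m4.arr cN 0 = n := by simp [f4.arr, n3]
    rw [q3, n3, step] at q4
    rw [q3, n3, r3] at d4
    refine wp_mono (digitC_spec (by norm_num) (by norm_num) (by norm_num)
      (by rw [q4]; exact le _)) ?_
    rintro m5 ⟨f5, q5, d5⟩
    rw [q4, n4, step] at q5
    rw [q4, n4, r4] at d5
    refine ⟨?_, q5.trans (by ring_nf), ?_⟩
    · exact ((((f1.mono (by simp)).trans (f2.mono (by simp))).trans (f3.mono (by simp))).trans
        (f4.mono (by simp))).trans (f5.mono (by simp))
    · have key : ∀ k', m5.arr 23 k' = m1.arr 23 k' ∧ m5.arr 24 k' = m2.arr 24 k' ∧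
          m5.arr 25 k' = m3.arr 25 k' ∧ m5.arr 26 k' = m4.arr 26 k' := by
        intro k'
        simp [f5.arr, f4.arr, f3.arr, f2.arr]
      have key' : ∀ k', m1.arr 24 k' = m'.arr 24 k' ∧ m2.arr 25 k' = m'.arr 25 k' ∧
          m3.arr 26 k' = m'.arr 26 k' ∧ m4.arr 27 k' = m'.arr 27 k' := by
        intro k'
        simp [f4.arr, f3.arr, f2.arr, f1.arr]
      intro k' hk' j hj
      obtain ⟨a1, a2, a3, a4⟩ := key k'
      obtain ⟨b1, b2, b3, b4⟩ := key' k'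
      by_cases hkk : k' = k
      · subst hkk
        interval_cases j
        · simp [a1, d1, codeDigit]
        · simp [a2, d2, codeDigit]
        · simp [a3, d3, codeDigit]
        · simp [a4, d4, codeDigit]
        · simp [d5, codeDigit]
      · rw [← h4 k' (by omega) j hj]
        interval_cases j
        · simp [a1, d1, hkk]
        · simp [a2, d2, hkk, b1]
        · simp [a3, d3, hkk, b2]
        · simp [a4, d4, hkk, b3]
        · simp [d5, hkk, b4]
  · rintro m' ⟨h1, h2, h3⟩
    exact ⟨(((Fr.refl _ _).put (by norm_num) (by simp)).trans (h1.mono (by simp))), h3⟩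

theorem acceptsC_spec {Z d M w p : ℕ} {m : Memory} {D : ℕ → ℕ → ℝ} {fl x y : ℕ → ℕ}
    (hD : storedDist d m.R = D) (hM : m.arr cWidth 0 = M) (hw : m.arr cTo 0 = w)
    (hp : m.arr cOuter 0 = p) (hMZ : M ≤ Z) (hfl : ∀ k < M, m.arr cKind k = fl k)
    (hx : ∀ k < M, m.arr cCentre k = x k) (hy : ∀ k < M, m.arr cThrough k = y k) :
    wp Z (acceptsC d) (fun m' => Fr [cRule, cRes] m m' ∧
      m'.arr cRes 0 = accepts D fl x y p (1 - w) M) m := by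
  refine wp_seq (wp_setVar ?_)
  have hF : Fr [cRule, cRes] m (m.put cRes 0 ((NExp.sub (.lit 1) (var cTo)).eval m)) :=
    (Fr.refl _ _).put (by norm_num) (by simp)
  refine wp_mono (wp_for (s := [cRes])
    (fun k m' => m'.arr cRes 0 = accepts D fl x y p (1 - w) k) hMZ (by norm_num) (by simp)
    (fun m' h => ?_) ?_ ?_ ?_) ?_
  · simp [h.arr, Memory.arr_put, hM]
  · intro k m v h
    simpa [Memory.arr_put] using h
  · simp [Memory.arr_put, hw, accepts]
  · intro k m' hk h1 h2 h3
    have h1' := hF.trans h1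
    have e1 : m'.arr cKind k = fl k := by simp [h1'.arr, hfl k hk]
    have e2 : m'.arr cCentre k = x k := by simp [h1'.arr, hx k hk]
    have e3 : m'.arr cThrough k = y k := by simp [h1'.arr, hy k hk]
    have e4 : m'.arr cOuter 0 = p := by simp [h1'.arr, hp]
    have e5 : storedDist d m'.R = D := by rw [h1'.storedDist, hD]
    have set : ∀ v, Fr [cRes] m' (m'.put cRes 0 v) := fun v =>
      (Fr.refl _ _).put (by norm_num) (by simp)
    refine wp_ite (fun hb => ?_) (fun hb => ?_)
    · simp [h2, e1] at hb
      refine wp_ite (fun hc => ?_) (fun hc => ?_)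
      · simp [eval_distExp, h2, e2, e3, e4, e5] at hc
        exact wp_setVar ⟨set _, by simp [Memory.arr_put, accepts, ruleStep, hb, hc]⟩
      · simp [eval_distExp, h2, e2, e3, e4, e5] at hc
        exact wp_skip ⟨Fr.refl _ _, by simp [accepts, ruleStep, hb, hc.not_ge, h3]⟩
    · simp [h2, e1] at hb
      refine wp_ite (fun hb' => ?_) (fun hb' => ?_)
      · simp [h2, e1] at hb'
        refine wp_ite (fun hc => ?_) (fun hc => ?_)
        · simp [eval_distExp, h2, e2, e3, e4, e5] at hc
          exact wp_skip ⟨Fr.refl _ _, by simp [accepts, ruleStep, hb', hc, h3]⟩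
        · simp [eval_distExp, h2, e2, e3, e4, e5] at hc
          exact wp_setVar ⟨set _, by simp [Memory.arr_put, accepts, ruleStep, hb', hc.not_ge]⟩
      · simp [h2, e1] at hb'
        exact wp_skip ⟨Fr.refl _ _, by simp [accepts, ruleStep, hb, hb', h3]⟩
  · rintro m' ⟨h1, h2⟩
    exact ⟨hF.trans h1, h2⟩

theorem visitsC_spec {Z n p : ℕ} {m : Memory} (hn : m.arr cN 0 = n) (hp : m.arr cOuter 0 = p)
    (hnZ : n ≤ Z) :
    wp Z visitsC (fun m' => Fr [cInner, cCount] m m' ∧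
      m'.arr cCount 0 = visits (m.arr cTour) p n) m := by
  refine wp_seq (wp_setVar ?_)
  have hF : Fr [cInner, cCount] m (m.put cCount 0 ((NExp.lit 0).eval m)) :=
    (Fr.refl _ _).put (by norm_num) (by simp)
  refine wp_mono (wp_for (s := [cCount])
    (fun k m' => m'.arr cCount 0 = visits (m.arr cTour) p k) hnZ (by norm_num) (by simp)
    (fun m' h => ?_) ?_ ?_ ?_) ?_
  · simp [h.arr, Memory.arr_put, hn]
  · intro k m v h
    simpa [Memory.arr_put] using h
  · simp [Memory.arr_put, visits]
  · intro k m' hk h1 h2 h3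
    have h1' := hF.trans h1
    refine wp_ite (fun hb => ?_) (fun hb => ?_)
    · simp [h2, h1'.arr, hp] at hb
      exact wp_setVar ⟨(Fr.refl _ _).put (by norm_num) (by simp),
        by simp [Memory.arr_put, visits, h3, hb]⟩
    · simp [h2, h1'.arr, hp] at hb
      exact wp_skip ⟨Fr.refl _ _, by simp [visits, h3, hb]⟩
  · rintro m' ⟨h1, h2⟩
    exact ⟨hF.trans h1, h2⟩

/-- A loop that clears the flag `cOk` as soon as the property `P` of its counter fails. -/
theorem wp_for_check {Z x N : ℕ} {e : NExp} {c : Cmd} {s : List ℕ} {m₀ : Memory} (P : ℕ → Prop)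
    (hN : N ≤ Z) (hx32 : x < 32) (hx : x ∉ s) (hxo : x ≠ cOk)
    (he : ∀ m, Fr (x :: s) m₀ m → e.eval m = N) (h0 : m₀.arr cOk 0 = 1)
    (hs : ∀ k m, k < N → Fr (x :: s) m₀ m → m.arr x 0 = k →
      wp Z c (fun m' => Fr s m m' ∧ (P k → m'.arr cOk 0 = m.arr cOk 0) ∧
        (¬ P k → m'.arr cOk 0 = 0)) m) :
    wp Z (forC x e c) (fun m' => Fr (x :: s) m₀ m' ∧ ((∀ k < N, P k) → m'.arr cOk 0 = 1) ∧
      (¬ (∀ k < N, P k) → m'.arr cOk 0 = 0)) m₀ := by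
  refine wp_for (fun k m' => ((∀ i < k, P i) → m'.arr cOk 0 = 1) ∧
      (¬ (∀ i < k, P i) → m'.arr cOk 0 = 0)) hN hx32 hx he ?_ ?_ ?_
  · intro k m v h
    rw [Memory.arr_put _ hx32 (by norm_num), if_neg (by simp; omega)]
    exact h
  · simp [h0]
  · rintro k m hk h1 h2 ⟨h3, h4⟩
    refine wp_mono (hs k m hk h1 h2) ?_
    rintro m' ⟨h5, h6, h7⟩
    refine ⟨h5, fun h => ?_, fun h => ?_⟩
    · rw [h6 (h k (by omega)), h3 fun i hi => h i (by omega)]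
    · by_cases hP : P k
      · rw [h6 hP]
        refine h4 fun h' => h fun i hi => ?_
        rcases Nat.lt_succ_iff_lt_or_eq.1 hi with hi | rfl
        · exact h' i hi
        · exact hP
      · exact h7 hP

theorem setCheckC_spec {Z d n M w : ℕ} {m : Memory} {D : ℕ → ℕ → ℝ} {fl x y : ℕ → ℕ}
    (hD : storedDist d m.R = D) (hn : m.arr cN 0 = n) (hM : m.arr cWidth 0 = M)
    (hw : m.arr cTo 0 = w) (hnZ : n ≤ Z) (hMZ : M ≤ Z) (hfl : ∀ k < M, m.arr cKind k = fl k)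
    (hx : ∀ k < M, m.arr cCentre k = x k) (hy : ∀ k < M, m.arr cThrough k = y k)
    (hok : m.arr cOk 0 = 1) :
    wp Z (setCheckC d) (fun m' => Fr [8, 9, 10, 11, 12, 13] m m' ∧
      ((∀ p < n, visits (m.arr cTour) p n = accepts D fl x y p (1 - w) M) → m'.arr cOk 0 = 1) ∧
      (¬ (∀ p < n, visits (m.arr cTour) p n = accepts D fl x y p (1 - w) M) →
        m'.arr cOk 0 = 0)) m := by
  refine wp_for_check (s := [9, 10, 11, 12, 13])
    (fun p => visits (m.arr cTour) p n = accepts D fl x y p (1 - w) M) hnZ (by norm_num)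
    (by simp) (by norm_num) (fun m' h => by simp [h.arr, hn]) hok ?_
  intro p m₀ hp h1 h2
  have hT : m₀.arr cTour = m.arr cTour := by funext i; simp [h1.arr]
  refine wp_seq (wp_mono (acceptsC_spec (p := p) (w := w) (D := D) (fl := fl) (x := x) (y := y)
    (by rw [h1.storedDist, hD])
    (by simp [h1.arr, hM]) (by simp [h1.arr, hw]) h2 hMZ (fun k hk => by simp [h1.arr, hfl k hk])
    (fun k hk => by simp [h1.arr, hx k hk]) (fun k hk => by simp [h1.arr, hy k hk])) ?_)
  rintro m1 ⟨f1, r1⟩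
  refine wp_seq (wp_mono (visitsC_spec (p := p) (n := n) (by simp [f1.arr, h1.arr, hn])
    (by simp [f1.arr, h2]) hnZ) ?_)
  rintro m2 ⟨f2, r2⟩
  have hT1 : m1.arr cTour = m.arr cTour := by rw [← hT]; funext i; simp [f1.arr]
  have f12 : Fr [9, 10, 11, 12, 13] m₀ m2 := (f1.mono (by simp)).trans (f2.mono (by simp))
  have r1' : m2.arr cRes 0 = accepts D fl x y p (1 - w) M := by simp [f2.arr, r1]
  have ok2 : m2.arr cOk 0 = m₀.arr cOk 0 := by simp [f2.arr, f1.arr]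
  rw [hT1] at r2
  refine wp_ite (fun hb => ?_) (fun hb => ?_)
  · simp [r1', r2] at hb
    exact wp_skip ⟨f12, by simp [hb, ok2]⟩
  · simp [r1', r2] at hb
    exact wp_setVar ⟨f12.put (by norm_num) (by simp), by simp [hb, Memory.arr_put]⟩

theorem boundaryCheckC_spec {Z n M : ℕ} {m : Memory} {qq u : ℕ → ℕ}
    (hn : m.arr cN 0 = n) (hM : m.arr cWidth 0 = M) (hnZ : n ≤ Z) (hMZ : M ≤ Z)
    (hqq : ∀ k < M, m.arr cListPos k = qq k) (hu : ∀ k < M, m.arr cListVal k = u k)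
    (hok : m.arr cOk 0 = 1) :
    wp Z boundaryCheckC (fun m' => Fr [8, 9, 11, 14] m m' ∧
      ((∀ q < n, BoundaryAt n M (m.arr cTour) qq u q) → m'.arr cOk 0 = 1) ∧
      (¬ (∀ q < n, BoundaryAt n M (m.arr cTour) qq u q) → m'.arr cOk 0 = 0)) m := by
  refine wp_for_check (s := [9, 11, 14])
    (fun q => BoundaryAt n M (m.arr cTour) qq u q) hnZ (by norm_num)
    (by simp) (by norm_num) (fun m' h => by simp [h.arr, hn]) hok ?_
  intro q m₀ hq h1 h2
  have hT : ∀ i, m₀.arr cTour i = m.arr cTour i := by intro i; simp [h1.arr]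
  refine wp_seq (wp_setVar ?_)
  have hF : Fr [9, 11, 14] m₀ (m₀.put cListed 0 ((NExp.lit 0).eval m₀)) :=
    (Fr.refl _ _).put (by norm_num) (by simp)
  refine wp_seq (wp_mono (wp_for (s := [11, 14])
    (fun k m' => ((∃ i < k, qq i = q + 1) → m'.arr cListed 0 = 1) ∧
      (¬ (∃ i < k, qq i = q + 1) → m'.arr cListed 0 = 0) ∧
      ((∀ i < k, qq i = q + 1 → m.arr cTour q = u i) → m'.arr cOk 0 = m₀.arr cOk 0) ∧
      (¬ (∀ i < k, qq i = q + 1 → m.arr cTour q = u i) → m'.arr cOk 0 = 0)) hMZ (by norm_num)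
      (by simp) (fun m' h => ?_) ?_ ?_ ?_) ?_)
  · simp [h.arr, Memory.arr_put, h1.arr, hM]
  · intro k m' v h
    simpa [Memory.arr_put] using h
  · simp [Memory.arr_put]
  · rintro k m' hk g1 g2 ⟨g3, g4, g5, g6⟩
    have g1' := hF.trans g1
    have e1 : m'.arr cListPos k = qq k := by simp [g1'.arr, h1.arr, hqq k hk]
    have e2 : m'.arr cListVal k = u k := by simp [g1'.arr, h1.arr, hu k hk]
    have e3 : m'.arr cTour q = m.arr cTour q := by simp [g1'.arr, h1.arr]
    have e4 : m'.arr cOuter 0 = q := by simp [g1'.arr, h2]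
    have ex : ∀ P : ℕ → Prop, (∃ i < k + 1, P i) ↔ (∃ i < k, P i) ∨ P k := fun P => by
      simp only [Nat.lt_succ_iff_lt_or_eq, or_and_right, exists_or, exists_eq_left]
    have al : ∀ P : ℕ → Prop, (∀ i < k + 1, P i) ↔ (∀ i < k, P i) ∧ P k := fun P => by
      simp only [Nat.lt_succ_iff_lt_or_eq, or_imp, forall_and, forall_eq]
    simp only [ex, al]
    refine wp_ite (fun hb => ?_) (fun hb => ?_)
    · simp [g2, e1, e4] at hb
      refine wp_seq (wp_setVar (wp_ite (fun hc => ?_) (fun hc => ?_)))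
      · simp [Memory.arr_put, g2, e2, e4, e3] at hc
        refine wp_skip ⟨(Fr.refl _ _).put (by norm_num) (by simp), ?_⟩
        have a1 : ∀ v, (m'.put cListed 0 v).arr cListed 0 = v := by simp [Memory.arr_put]
        have a2 : ∀ v, (m'.put cListed 0 v).arr cOk 0 = m'.arr cOk 0 := by simp [Memory.arr_put]
        rw [a1, a2]
        exact ⟨fun _ => rfl, fun h => absurd (Or.inr hb) h, fun h => g5 h.1,
          fun h => g6 fun h' => h ⟨h', fun _ => hc⟩⟩
      · simp [Memory.arr_put, g2, e2, e4, e3] at hc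
        refine wp_setVar ⟨((Fr.refl _ _).put (by norm_num) (by simp)).put (by norm_num) (by simp),
          ?_⟩
        simp [Memory.arr_put, hb, hc]
    · simp [g2, e1, e4] at hb
      refine wp_skip ⟨Fr.refl _ _, ?_⟩
      exact ⟨fun h => g3 (h.resolve_right hb), fun h => g4 fun h' => h (Or.inl h'), fun h => g5 h.1,
        fun h => g6 fun h' => h ⟨h', fun h'' => absurd h'' hb⟩⟩
  · rintro m' ⟨g1, g3, g4, g5, g6⟩
    have g1' : Fr [9, 11, 14] m₀ m' := hF.trans (g1.mono (by simp))
    have e3 : ∀ i, m'.arr cTour i = m.arr cTour i := by intro i; simp [g1'.arr, h1.arr]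
    have e4 : m'.arr cOuter 0 = q := by simp [g1'.arr, h2]
    have e5 : m'.arr cN 0 = n := by simp [g1'.arr, h1.arr, hn]
    have em : ∀ a : ℕ, 1 - a = 0 ↔ ¬ a = 0 := fun a => by omega
    have em2 : ∀ a b : ℕ, 1 - a = 1 - b ↔ (a = 0 ↔ b = 0) := fun a b => by omega
    have clear : ¬ BoundaryAt n M (m.arr cTour) qq u q →
        wp Z (setVar cOk (.lit 0)) (fun m' => Fr [9, 11, 14] m₀ m' ∧
          (BoundaryAt n M (m.arr cTour) qq u q → m'.arr cOk 0 = m₀.arr cOk 0) ∧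
          (¬ BoundaryAt n M (m.arr cTour) qq u q → m'.arr cOk 0 = 0)) m' := fun h =>
      wp_setVar ⟨g1'.put (by norm_num) (by simp), by simp [h, Memory.arr_put]⟩
    have keep : ((∀ i < M, qq i = q + 1 → m.arr cTour q = u i) →
        BoundaryAt n M (m.arr cTour) qq u q) →
        wp Z .skip (fun m' => Fr [9, 11, 14] m₀ m' ∧
          (BoundaryAt n M (m.arr cTour) qq u q → m'.arr cOk 0 = m₀.arr cOk 0) ∧
          (¬ BoundaryAt n M (m.arr cTour) qq u q → m'.arr cOk 0 = 0)) m' := fun h =>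
      wp_skip ⟨g1', fun hB => g5 hB.1, fun hB => g6 fun h' => hB (h h')⟩
    refine wp_ite (fun hb => ?_) (fun hb => ?_)
    · simp at hb
      have : ∃ i < M, qq i = q + 1 := by
        by_contra hcon
        have := g4 hcon
        omega
      exact keep fun h => ⟨h, Or.inl this⟩
    · simp at hb
      have : ¬ ∃ i < M, qq i = q + 1 := by
        intro hcon
        have := g3 hcon
        omega
      refine wp_ite (fun hc1 => ?_) (fun hc1 => clear ?_)
      · simp [e4] at hc1
        refine wp_ite (fun hc2 => ?_) (fun hc2 => clear ?_)
        · simp [e4, e5] at hc2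
          refine wp_ite (fun hc3 => ?_) (fun hc3 => clear ?_)
          · simp [isEmptyExp, e4, e3, em2] at hc3
            refine wp_ite (fun hc4 => ?_) (fun hc4 => clear ?_)
            · simp [isEmptyExp, e4, e3, em2] at hc4
              exact keep fun h => ⟨h, Or.inr ⟨by omega, by omega, hc3, hc4⟩⟩
            · simp only [isEmptyExp, holds_eq, eval_sub, eval_add, eval_lit, eval_ent, eval_var,
                e4, e3, em2] at hc4
              rintro ⟨-, hB | hB⟩
              · exact this hB
              · exact hc4 hB.2.2.2
          · simp only [isEmptyExp, holds_eq, eval_sub, eval_lit, eval_ent, eval_var,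
              e4, e3, em2] at hc3
            rintro ⟨-, hB | hB⟩
            · exact this hB
            · exact hc3 hB.2.2.1
        · simp [e4, e5] at hc2
          rintro ⟨-, hB | hB⟩
          · exact this hB
          · omega
      · simp [e4] at hc1
        rintro ⟨-, hB | hB⟩
        · exact this hB
        · omega

theorem matchC_spec {Z d n M w : ℕ} {m : Memory} {D : ℕ → ℕ → ℝ}
    (hD : storedDist d m.R = D) (hn : m.arr cN 0 = n) (hM : m.arr cWidth 0 = M)
    (hw : m.arr cTo 0 = w) (hnZ : n ≤ Z) (hMZ : M ≤ Z) (hwZ : w ≤ Z) :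
    wp Z (matchC d) (fun m' => Fr [8, 9, 10, 11, 12, 13, 14, 15, 16, 17, 31, 23, 24, 25, 26, 27]
        m m' ∧
      (Matches D n M (m.arr cTour) w → m'.arr cOk 0 = 1) ∧
      (¬ Matches D n M (m.arr cTour) w → m'.arr cOk 0 = 0)) m := by
  refine wp_seq (wp_mono (decodeC_spec hn hM hw hMZ hwZ) ?_)
  rintro m1 ⟨f1, d1⟩
  refine wp_seq (wp_setVar ?_)
  set m2 := m1.put cOk 0 ((NExp.lit 1).eval m1) with hm2
  have f2 : Fr [11, 9, 15, 16, 17, 31, 23, 24, 25, 26, 27] m m2 :=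
    (f1.mono (by simp)).put (by norm_num) (by simp)
  have dd : ∀ k < M, ∀ j < 5, m2.arr (23 + j) k = codeDigit n j w k := by
    intro k hk j hj
    rw [hm2, Memory.arr_put _ (by norm_num) (by omega), if_neg (by omega), d1 k hk j hj]
  have hT : m2.arr cTour = m.arr cTour := by funext i; simp [f2.arr]
  refine wp_seq (wp_mono (setCheckC_spec (n := n) (M := M) (w := w) (D := D)
    (by rw [f2.storedDist, hD]) (by simp [f2.arr, hn]) (by simp [f2.arr, hM])
    (by simp [f2.arr, hw]) hnZ hMZ (fun k hk => dd k hk 0 (by norm_num))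
    (fun k hk => dd k hk 1 (by norm_num)) (fun k hk => dd k hk 2 (by norm_num))
    (by simp [hm2, Memory.arr_put])) ?_)
  rintro m3 ⟨f3, t3, e3⟩
  rw [hT] at t3 e3
  have f23 : Fr [8, 9, 10, 11, 12, 13, 14, 15, 16, 17, 31, 23, 24, 25, 26, 27] m m3 :=
    (f2.mono (by simp)).trans (f3.mono (by simp))
  have hT3 : m3.arr cTour = m.arr cTour := by funext i; simp [f23.arr]
  by_cases hA : ∀ p < n, visits (m.arr cTour) p n =
      accepts D (codeDigit n 0 w) (codeDigit n 1 w) (codeDigit n 2 w) p (1 - w) M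
  · refine wp_ite (fun _ => wp_ite (fun hb => ?_) (fun hb => ?_)) (fun ho => ?_)
    · simp [f23.arr, hw] at hb
      exact wp_skip ⟨f23, fun h => t3 h.1, fun h => absurd ⟨hA, Or.inl hb⟩ h⟩
    · simp [f23.arr, hw] at hb
      refine wp_mono (boundaryCheckC_spec (n := n) (M := M) (qq := codeDigit n 3 w)
        (u := codeDigit n 4 w) (by simp [f23.arr, hn]) (by simp [f23.arr, hM]) hnZ hMZ
        (fun k hk => ?_) (fun k hk => ?_) (t3 hA)) ?_
      · rw [f3.arr _ (by norm_num) (by simp)]; exact dd k hk 3 (by norm_num)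
      · rw [f3.arr _ (by norm_num) (by simp)]; exact dd k hk 4 (by norm_num)
      · rintro m4 ⟨f4, t4, e4⟩
        rw [hT3] at t4 e4
        exact ⟨f23.trans (f4.mono (by simp)), fun h => t4 (h.2.resolve_left hb), fun h =>
          e4 fun h' => h ⟨hA, Or.inr h'⟩⟩
    · simp [t3 hA] at ho
  · refine wp_ite (fun ho => ?_) (fun _ => ?_)
    · simp [e3 hA] at ho
    · exact wp_skip ⟨f23, fun h => absurd h.1 hA, fun _ => e3 hA⟩

/-! ### The dynamic program -/

def nextC : Cmd :=
  .ite (.nle (.add (var cInner) (.lit 2)) (var cN)) (setVar cNext (.add (var cInner) (.lit 1)))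
    (setVar cNext (.lit 0))

def accReal : RExp := .mem (.lit 0)

/-- Adds to (or subtracts from) the real cell `0` the edge in position `cInner` of a partial
tour. -/
def edgeC (d : ℕ) (op : RExp → RExp → RExp) (f : NExp → NExp) : Cmd :=
  .ite (.nle (.lit 1) (f (var cInner))) (.ite (.nle (.lit 1) (f (var cNext)))
    (.rset (.lit 0) (op accReal
      (distExp d (.sub (f (var cInner)) (.lit 1)) (.sub (f (var cNext)) (.lit 1))))) .skip) .skip

def tableExp (e : NExp) : NExp := ent cTable (.add (var cPtrTo) e)

/-- The two lengths are not needed separately. Only the sign of their difference matters, and it is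
accumulated in the one real cell that frames allow to change. -/
def compareC (d : ℕ) : Cmd :=
  .seq (.rset (.lit 0) (.lit 0)) (forC cInner (var cN) (.seq nextC
    (.seq (edgeC d .add (ent cTour)) (edgeC d .sub tableExp))))

def storeC : Cmd :=
  .seq (forC cInner (var cN)
      (setEnt cTable (.add (var cPtrTo) (var cInner)) (ent cTour (var cInner))))
    (setEnt cSet (var cTo) (.lit 1))

def relaxC (d : ℕ) : Cmd :=
  .seq (mulC cPtrTo (var cTo) (var cN) cAux) (.seq (matchC d) (.ite (.nle (.lit 1) (var cOk))
    (.seq (compareC d) (.ite (.nle (.lit 1) (ent cSet (var cTo)))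
      (.ite (.rle accReal (.lit 0)) storeC .skip) storeC)) .skip))

def extendC (d : ℕ) : Cmd :=
  .seq (mulC cPtr (var cFrom) (var cN) cAux)
    (.seq (forC cInner (var cN)
        (setEnt cTour (var cInner) (ent cTable (.add (var cPtr) (var cInner)))))
      (.seq (setEnt cTour (var cPos) (.add (var cPoint) (.lit 1)))
        (forC cTo (var cCodes) (relaxC d))))

def roundsC (d : ℕ) : Cmd :=
  forC cRound (var cN) (forC cFrom (var cCodes) (forC cPoint (var cN) (forC cPos (var cN)
    (extendC d))))

/-- The partial tour stored for the code `w`. -/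
def tab (n : ℕ) (m : Memory) (w i : ℕ) : ℕ := m.arr cTable (w * n + i)

theorem visits_congr {T T' : ℕ → ℕ} {n : ℕ} (h : ∀ i < n, T i = T' i) (p : ℕ) :
    visits T p n = visits T' p n := by
  induction n with
  | zero => rfl
  | succ n ih => simp only [visits, ih fun i hi => h i (by omega), h n (by omega)]

theorem nextPos_lt {n i : ℕ} (h : i < n) : nextPos n i < n := by
  unfold nextPos; split_ifs <;> omega

theorem edgeCost_congr {D : ℕ → ℕ → ℝ} {T T' : ℕ → ℕ} {n i : ℕ} (h : ∀ i < n, T i = T' i)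
    (hi : i < n) : edgeCost D n T i = edgeCost D n T' i := by
  simp only [edgeCost, h i hi, h _ (nextPos_lt hi)]

theorem partialCost_congr {D : ℕ → ℕ → ℝ} {T T' : ℕ → ℕ} {n : ℕ} (h : ∀ i < n, T i = T' i) :
    partialCost D n T = partialCost D n T' :=
  Finset.sum_congr rfl fun _ hi => edgeCost_congr h (Finset.mem_range.1 hi)

theorem Matches.congr {D : ℕ → ℕ → ℝ} {T T' : ℕ → ℕ} {n M w : ℕ} (h : ∀ i < n, T i = T' i)
    (hT : Matches D n M T w) : Matches D n M T' w := by
  refine ⟨fun p hp => by rw [← visits_congr h, hT.1 p hp], hT.2.imp id fun hb q hq => ?_⟩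
  obtain ⟨h1, h2⟩ := hb q hq
  refine ⟨fun k hk hkq => by rw [← h q hq, h1 k hk hkq], h2.imp id ?_⟩
  rintro ⟨a, b, c, e⟩
  refine ⟨a, b, ?_, ?_⟩
  · rwa [← h q hq, ← h _ (by omega)]
  · rwa [← h q hq, ← h _ (by omega)]

/-- Every stored partial tour matches its code. -/
def Safe (D : ℕ → ℕ → ℝ) (n M : ℕ) (m : Memory) : Prop :=
  ∀ w, (m.arr cSet w ≠ 0 → Matches D n M (tab n m w) w) ∧
    (m.arr cSet w = 0 → ∀ i < n, tab n m w i = 0)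

/-- A partial tour of length at most `c` is stored for the code `w`. -/
def Reach (D : ℕ → ℕ → ℝ) (n : ℕ) (m : Memory) (w : ℕ) (c : ℝ) : Prop :=
  m.arr cSet w ≠ 0 ∧ partialCost D n (tab n m w) ≤ c

/-- The table is updated in place while it is being scanned. This relation makes that harmless: an
entry gives way only to one that is not longer, so what has been reached stays reached. -/
def Mono (D : ℕ → ℕ → ℝ) (n : ℕ) (m m' : Memory) : Prop :=
  ∀ w c, Reach D n m w c → Reach D n m' w c

theorem Safe.of_eq {D : ℕ → ℕ → ℝ} {n M : ℕ} {m m' : Memory} (h : Safe D n M m)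
    (h1 : m'.arr cTable = m.arr cTable) (h2 : m'.arr cSet = m.arr cSet) : Safe D n M m' := by
  unfold Safe tab at *
  rwa [h1, h2]

theorem Mono.of_eq {D : ℕ → ℕ → ℝ} {n : ℕ} {m m' : Memory}
    (h1 : m'.arr cTable = m.arr cTable) (h2 : m'.arr cSet = m.arr cSet) : Mono D n m m' := by
  intro w c
  unfold Reach tab
  rw [h1, h2]
  exact id

theorem Fr.arr_eq {s : List ℕ} {m m' : Memory} (h : Fr s m m') (j : ℕ) (hj : j < 32)
    (hs : j ∉ s) : m'.arr j = m.arr j :=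
  funext (h.arr j hj hs)

theorem eval_accReal (m : Memory) : accReal.eval m = m.R 0 := rfl

theorem edgeC_spec {Z d n i : ℕ} {m : Memory} {D : ℕ → ℕ → ℝ} {T : ℕ → ℕ}
    (op : RExp → RExp → RExp) (op' : ℝ → ℝ → ℝ) (f : NExp → NExp)
    (hop : ∀ a b m, (op a b).eval m = op' (a.eval m) (b.eval m)) (hop0 : ∀ a, op' a 0 = a)
    (hf : ∀ e, (f e).eval m = T (e.eval m))
    (hD : storedDist d m.R = D) (hi : m.arr cInner 0 = i) (hnx : m.arr cNext 0 = nextPos n i) :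
    wp Z (edgeC d op f) (fun m' => Fr [] m m' ∧ m'.I = m.I ∧
      m'.R 0 = op' (m.R 0) (edgeCost D n T i)) m := by
  refine wp_ite (fun h1 => wp_ite (fun h2 => wp_rset ?_) (fun h2 => wp_skip ?_))
    (fun h1 => wp_skip ?_)
  · simp [hf, hi, hnx] at h1 h2
    refine ⟨by simpa using (Fr.refl [] m).setR _, rfl, ?_⟩
    simp [hop, eval_accReal, eval_distExp, hf, hi, hnx, hD, edgeCost]
    rw [if_neg (by omega)]
  · simp [hf, hi, hnx] at h1 h2
    exact ⟨Fr.refl _ _, rfl, by simp [edgeCost, h2, hop0]⟩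
  · simp [hf, hi] at h1
    exact ⟨Fr.refl _ _, rfl, by simp [edgeCost, h1, hop0]⟩

theorem nextC_spec {Z n i : ℕ} {m : Memory} (hn : m.arr cN 0 = n) (hi : m.arr cInner 0 = i) :
    wp Z nextC (fun m' => Fr [cNext] m m' ∧ m'.arr cNext 0 = nextPos n i ∧ m'.R = m.R) m := by
  refine wp_ite (fun h => wp_setVar ?_) (fun h => wp_setVar ?_)
  · simp [hn, hi] at h
    refine ⟨(Fr.refl _ _).put (by norm_num) (by simp), ?_, rfl⟩
    simp [Memory.arr_put, hi, nextPos]; omega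
  · simp [hn, hi] at h
    refine ⟨(Fr.refl _ _).put (by norm_num) (by simp), ?_, rfl⟩
    simp [Memory.arr_put, nextPos]; omega

theorem compareC_spec {Z d n w : ℕ} {m : Memory} {D : ℕ → ℕ → ℝ}
    (hD : storedDist d m.R = D) (hn : m.arr cN 0 = n) (hp : m.arr cPtrTo 0 = w * n)
    (hnZ : n ≤ Z) :
    wp Z (compareC d) (fun m' => Fr [cInner, cNext] m m' ∧
      m'.R 0 = partialCost D n (m.arr cTour) - partialCost D n (tab n m w)) m := by
  refine wp_seq (wp_rset ?_)
  set m1 : Memory := { m with R := Function.update m.R ((NExp.lit 0).eval m) ((RExp.lit 0).eval m) }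
    with hm1
  have hF : Fr [cInner, cNext] m m1 := (Fr.refl _ _).setR _
  refine wp_mono (wp_for (s := [cNext])
    (fun k m' => m'.R 0 = ∑ i ∈ Finset.range k,
      (edgeCost D n (m.arr cTour) i - edgeCost D n (tab n m w) i)) hnZ (by norm_num) (by simp)
    (fun m' h => ?_) ?_ ?_ ?_) ?_
  · simp [h.arr, hF.arr, hn]
  · intro k m v h; exact h
  · simp [hm1, RExp.eval]
  · intro k m' hk h1 h2 h3
    have h1' := hF.trans h1
    refine wp_seq (wp_mono (nextC_spec (n := n) (by simp [h1'.arr, hn]) h2) ?_)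
    rintro m2 ⟨f2, n2, r2⟩
    have h12 := h1'.trans (f2.mono (by simp))
    refine wp_seq (wp_mono (edgeC_spec (n := n) (i := k) (D := D) (T := m.arr cTour) .add
      (· + ·) (ent cTour) (fun _ _ _ => rfl) (by simp) (fun e => by simp [h12.arr])
      (by rw [h12.storedDist, hD]) (by simp [f2.arr, h2]) n2) ?_)
    rintro m3 ⟨f3, i3, r3⟩
    have h13 := h12.trans (f3.mono (by simp))
    refine wp_mono (edgeC_spec (n := n) (i := k) (D := D) (T := tab n m w) .sub
      (· - ·) tableExp (fun _ _ _ => rfl) (by simp) (fun e => by simp [tableExp, h13.arr, hp, tab])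
      (by rw [h13.storedDist, hD]) (by simp [f3.arr, f2.arr, h2]) (by simp [f3.arr, n2])) ?_
    rintro m4 ⟨f4, i4, r4⟩
    refine ⟨(f2.trans (f3.mono (by simp))).trans (f4.mono (by simp)), ?_⟩
    rw [r4, r3, r2, h3, Finset.sum_range_succ]
    ring
  · rintro m' ⟨h1, h2⟩
    refine ⟨hF.trans h1, ?_⟩
    rw [h2, Finset.sum_sub_distrib]; rfl

theorem storeC_spec {Z n w : ℕ} {m : Memory} (hn : m.arr cN 0 = n) (hp : m.arr cPtrTo 0 = w * n)
    (hw : m.arr cTo 0 = w) (hnZ : n ≤ Z) :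
    wp Z storeC (fun m' => Fr [cInner, cTable, cSet] m m' ∧
      (∀ i < n, tab n m' w i = m.arr cTour i) ∧
      (∀ w' ≠ w, ∀ i < n, tab n m' w' i = tab n m w' i) ∧
      ∀ w', m'.arr cSet w' = if w' = w then 1 else m.arr cSet w') m := by
  refine wp_seq (wp_mono (wp_for (s := [cTable])
    (fun k m' => (∀ i < k, tab n m' w i = m.arr cTour i) ∧
      (∀ w' ≠ w, ∀ i < n, tab n m' w' i = tab n m w' i)) hnZ (by norm_num) (by simp)
      (fun m' h => by simp [h.arr, hn]) ?_ ?_ ?_) ?_)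
  · intro k m v h
    simpa [tab, Memory.arr_put] using h
  · simp
  · rintro k m' hk h1 h2 ⟨h3, h4⟩
    refine wp_setEnt ⟨(Fr.refl _ _).put (by norm_num) (by simp), fun i hi => ?_,
      fun w' hw' i hi => ?_⟩
    · simp [tab, Memory.arr_put, h1.arr, hp, h2]
      by_cases hik : i = k
      · simp [hik]
      · rw [if_neg hik]
        exact h3 i (by omega)
    · simp only [tab, Memory.arr_put _ (show 21 < 32 by norm_num) (show 21 < 32 by norm_num),
        eval_add, eval_var, h2, h1.arr cPtrTo (by norm_num) (by simp), hp]
      rw [if_neg]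
      · exact h4 w' hw' i hi
      rintro ⟨-, h⟩
      rcases lt_or_gt_of_ne hw' with hlt | hlt
      · have := Nat.mul_le_mul_right n hlt
        rw [Nat.succ_mul] at this
        omega
      · have := Nat.mul_le_mul_right n hlt
        rw [Nat.succ_mul] at this
        omega
  · rintro m' ⟨h1, h2, h3⟩
    refine wp_setEnt ⟨(h1.mono (by simp)).put (by norm_num) (by simp), ?_, ?_, ?_⟩
    · simpa [tab, Memory.arr_put] using h2
    · simpa [tab, Memory.arr_put] using h3
    · intro w'
      simp [Memory.arr_put, h1.arr, hw]

/-- The tour is stored if it matches `w` and there is either no entry yet or one that is not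
shorter; otherwise the old entry already witnesses the bound. A store happens only after a
successful match, which preserves safety. -/
theorem relaxC_spec {Z d n M w : ℕ} {m : Memory} {D : ℕ → ℕ → ℝ} {T : ℕ → ℕ}
    (hD : storedDist d m.R = D) (hn : m.arr cN 0 = n) (hM : m.arr cWidth 0 = M)
    (hw : m.arr cTo 0 = w) (hnZ : n ≤ Z) (hMZ : M ≤ Z) (hwZ : w ≤ Z) (hS : Safe D n M m)
    (hT : ∀ i < n, m.arr cTour i = T i) :
    wp Z (relaxC d) (fun m' => Fr [8, 9, 10, 11, 12, 13, 14, 15, 16, 17, 31, 23, 24, 25, 26, 27,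
        19, 30, 21, 22] m m' ∧ Safe D n M m' ∧ Mono D n m m' ∧
      ∀ c, Matches D n M T w → partialCost D n T ≤ c → Reach D n m' w c) m := by
  refine wp_seq (wp_mono (mulC_spec (N := w) (y := n) (by norm_num) (by norm_num) (by norm_num) hwZ
    (fun m' h => by simp [h.arr, hw]) (fun m' h => by simp [h.arr, hn])) ?_)
  rintro m1 ⟨f1, p1⟩
  refine wp_seq (wp_mono (matchC_spec (n := n) (M := M) (w := w) (D := D)
    (by rw [f1.storedDist, hD]) (by simp [f1.arr, hn]) (by simp [f1.arr, hM])
    (by simp [f1.arr, hw]) hnZ hMZ hwZ) ?_)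
  rintro m2 ⟨f2, ok2, bad2⟩
  have f12 : Fr [8, 9, 10, 11, 12, 13, 14, 15, 16, 17, 31, 23, 24, 25, 26, 27, 30] m m2 :=
    (f1.mono (by simp)).trans (f2.mono (by simp))
  have hTm : m1.arr cTour = m.arr cTour := f1.arr_eq _ (by norm_num) (by simp)
  rw [hTm] at ok2 bad2
  have keep : ∀ m', Fr [8, 9, 10, 11, 12, 13, 14, 15, 16, 17, 31, 23, 24, 25, 26, 27, 19, 30]
      m m' → Safe D n M m' ∧ Mono D n m m' := fun m' h =>
    ⟨hS.of_eq (h.arr_eq _ (by norm_num) (by simp)) (h.arr_eq _ (by norm_num) (by simp)),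
      Mono.of_eq (h.arr_eq _ (by norm_num) (by simp)) (h.arr_eq _ (by norm_num) (by simp))⟩
  refine wp_ite (fun ho => ?_) (fun ho => ?_)
  · have hMT : Matches D n M (m.arr cTour) w := by
      by_contra hcon
      simp [bad2 hcon] at ho
    refine wp_seq (wp_mono (compareC_spec (n := n) (w := w) (D := D) (by rw [f12.storedDist, hD])
      (by simp [f12.arr, hn]) (by simp [f2.arr, p1]) hnZ) ?_)
    rintro m3 ⟨f3, r3⟩
    have f13 : Fr [8, 9, 10, 11, 12, 13, 14, 15, 16, 17, 31, 23, 24, 25, 26, 27, 19, 30] m m3 :=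
      (f12.mono (by simp)).trans (f3.mono (by simp))
    have hT2 : m2.arr cTour = m.arr cTour := f12.arr_eq _ (by norm_num) (by simp)
    have hT3 : m3.arr cTour = m.arr cTour := f13.arr_eq _ (by norm_num) (by simp)
    have hset : m3.arr cSet = m.arr cSet := f13.arr_eq _ (by norm_num) (by simp)
    have htab : tab n m3 = tab n m := by
      funext a b; simp [tab, f13.arr]
    have htab2 : tab n m2 = tab n m := by
      funext a b; simp [tab, f12.arr]
    rw [hT2, htab2] at r3
    have store : (m.arr cSet w ≠ 0 → partialCost D n (m.arr cTour) ≤ partialCost D n (tab n m w)) →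
        wp Z storeC (fun m' => Fr [8, 9, 10, 11, 12, 13, 14, 15, 16, 17, 31, 23, 24, 25, 26, 27,
          19, 30, 21, 22] m m' ∧ Safe D n M m' ∧ Mono D n m m' ∧
          ∀ c, Matches D n M T w → partialCost D n T ≤ c → Reach D n m' w c) m3 := by
      intro hle
      refine wp_mono (storeC_spec (n := n) (w := w) (by simp [f13.arr, hn])
        (by simp [f3.arr, f2.arr, p1]) (by simp [f13.arr, hw]) hnZ) ?_
      rintro m4 ⟨f4, t4, o4, s4⟩
      rw [hT3] at t4
      rw [htab] at o4
      rw [hset] at s4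
      refine ⟨(f13.mono (by simp)).trans (f4.mono (by simp)), ?_, ?_, ?_⟩
      · intro w'
        by_cases hww : w' = w
        · subst hww
          exact ⟨fun _ => hMT.congr fun i hi => (t4 i hi).symm, fun h => by simp [s4] at h⟩
        · rw [s4 w', if_neg hww]
          exact ⟨fun h => ((hS w').1 h).congr fun i hi => (o4 w' hww i hi).symm,
            fun h i hi => (o4 w' hww i hi).trans ((hS w').2 h i hi)⟩
      · rintro w' c ⟨h1, h2⟩
        by_cases hww : w' = w
        · subst hww
          refine ⟨by simp [s4], ?_⟩
          rw [partialCost_congr t4]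
          exact (hle h1).trans h2
        · refine ⟨by rwa [s4 w', if_neg hww], ?_⟩
          rwa [partialCost_congr (o4 w' hww)]
      · intro c _ hc
        refine ⟨by simp [s4], ?_⟩
        rwa [partialCost_congr t4, partialCost_congr hT]
    refine wp_ite (fun h1 => wp_ite (fun h2 => store ?_) (fun h2 => wp_skip ?_))
      (fun h1 => store ?_)
    · simp [eval_accReal, r3, RExp.eval] at h2
      exact fun _ => h2
    · simp [eval_accReal, r3, RExp.eval] at h2
      simp [f13.arr, hw] at h1
      obtain ⟨k1, k2⟩ := keep m3 f13
      refine ⟨f13.mono (by simp), k1, k2, fun c _ hc => k2 _ _ ⟨by omega, h2.le.trans ?_⟩⟩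
      rwa [partialCost_congr hT]
    · simp [f13.arr, hw] at h1
      exact fun h => absurd h1 h
  · obtain ⟨k1, k2⟩ := keep m2 (f12.mono (by simp))
    refine wp_skip ⟨f12.mono (by simp), k1, k2, fun c hMT => ?_⟩
    simp [ok2 (hMT.congr fun i hi => (hT i hi).symm)] at ho

/-- A loop that serves to reach the property `G` in one particular iteration. -/
theorem wp_for_hit {Z x N n M : ℕ} {D : ℕ → ℕ → ℝ} {e : NExp} {c : Cmd} {s : List ℕ}
    {m₀ : Memory} (Pre G : Memory → Prop) (k₀ : ℕ) (hN : N ≤ Z) (hx32 : x < 32) (hx : x ∉ s)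
    (hxt : x ≠ cTable ∧ x ≠ cSet) (he : ∀ m, Fr (x :: s) m₀ m → e.eval m = N)
    (hPre : ∀ m m', Mono D n m m' → Pre m → Pre m')
    (hG : ∀ m m', Mono D n m m' → G m → G m') (hS : Safe D n M m₀) (hk₀ : k₀ < N)
    (hs : ∀ k m, k < N → Fr (x :: s) m₀ m → m.arr x 0 = k → Safe D n M m →
      wp Z c (fun m' => Fr s m m' ∧ Safe D n M m' ∧ Mono D n m m' ∧
        (k = k₀ → Pre m → G m')) m) :
    wp Z (forC x e c) (fun m' => Fr (x :: s) m₀ m' ∧ Safe D n M m' ∧ Mono D n m₀ m' ∧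
      (Pre m₀ → G m')) m₀ := by
  refine wp_mono (wp_for (fun k m => Safe D n M m ∧ Mono D n m₀ m ∧ (k₀ < k → Pre m₀ → G m))
    hN hx32 hx he ?_ ?_ ?_) ?_
  · rintro k m v ⟨h1, h2, h3⟩
    have e1 : (m.put x 0 v).arr cTable = m.arr cTable := by
      funext i; rw [Memory.arr_put _ hx32 (by norm_num), if_neg (by tauto)]
    have e2 : (m.put x 0 v).arr cSet = m.arr cSet := by
      funext i; rw [Memory.arr_put _ hx32 (by norm_num), if_neg (by tauto)]
    have hM : Mono D n m (m.put x 0 v) := Mono.of_eq e1 e2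
    exact ⟨h1.of_eq e1 e2, fun w c h => hM w c (h2 w c h), fun h h' => hG _ _ hM (h3 h h')⟩
  · exact ⟨hS, fun _ _ h => h, by simp⟩
  · rintro k m hk h1 h2 ⟨h3, h4, h5⟩
    refine wp_mono (hs k m hk h1 h2 h3) ?_
    rintro m' ⟨g1, g2, g3, g4⟩
    refine ⟨g1, g2, fun w c h => g3 w c (h4 w c h), fun h h' => ?_⟩
    by_cases hkk : k = k₀
    · exact g4 hkk (hPre _ _ h4 h')
    · exact hG _ _ g3 (h5 (by omega) h')
  · rintro m' ⟨h1, h2, h3, h4⟩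
    exact ⟨h1, h2, h3, h4 hk₀⟩

/-- The partial tours that match `w` and have length at most `c` include the empty one. -/
def Start (D : ℕ → ℕ → ℝ) (n M w : ℕ) (c : ℝ) : Prop :=
  ∀ T, (Matches D n M T w ∨ ∀ i < n, T i = 0) → Matches D n M T w ∧ partialCost D n T ≤ c

/-- Visiting `p` in position `q` leads from partial tours matching `w` to ones matching `w'`. -/
def Transfer (D : ℕ → ℕ → ℝ) (n M w : ℕ) (c : ℝ) (p q w' : ℕ) (c' : ℝ) : Prop :=
  ∀ T, Matches D n M T w → partialCost D n T ≤ c →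
    Matches D n M (Function.update T q (p + 1)) w' ∧
      partialCost D n (Function.update T q (p + 1)) ≤ c'

/-- A cleared entry reads as the empty partial tour, so the table needs no initialisation. `Start`
says that whatever is found for the first code, a matching tour or zeros, serves as well as the
empty tour. -/
def Available (D : ℕ → ℕ → ℝ) (n M : ℕ) (m : Memory) (w : ℕ) (c : ℝ) : Prop :=
  Start D n M w c ∨ Reach D n m w c

theorem Available.mono {D : ℕ → ℕ → ℝ} {n M w : ℕ} {m m' : Memory} {c : ℝ} (h : Mono D n m m')
    (hA : Available D n M m w c) : Available D n M m' w c :=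
  hA.imp id (h w c)

theorem Available.matches {D : ℕ → ℕ → ℝ} {n M w : ℕ} {m : Memory} {c : ℝ}
    (hA : Available D n M m w c) (hS : Safe D n M m) :
    Matches D n M (tab n m w) w ∧ partialCost D n (tab n m w) ≤ c := by
  rcases hA with h | h
  · refine h _ ?_
    by_cases h0 : m.arr cSet w = 0
    · exact Or.inr ((hS w).2 h0)
    · exact Or.inl ((hS w).1 h0)
  · exact ⟨(hS w).1 h.1, h.2⟩

/-- The table may hold any partial tour that matches the code, not the one that the analysis has in
mind; this is why `Transfer` speaks of all matching tours within the cost bound. The loop over all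
target codes meets `w'` once, and later stores cannot undo what was gained there. -/
theorem extendC_spec {Z d n M N w p q w' : ℕ} {c c' : ℝ} {m : Memory} {D : ℕ → ℕ → ℝ}
    (hD : storedDist d m.R = D) (hn : m.arr cN 0 = n) (hM : m.arr cWidth 0 = M)
    (hN : m.arr cCodes 0 = N) (hnZ : n ≤ Z) (hMZ : M ≤ Z) (hNZ : N ≤ Z)
    (hwN : m.arr cFrom 0 < N) (hw'N : w' < N) (hS : Safe D n M m)
    (htr : Transfer D n M w c p q w' c') :
    wp Z (extendC d) (fun m' => Fr [7, 18, 20, 8, 9, 10, 11, 12, 13, 14, 15, 16, 17, 31, 23, 24,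
        25, 26, 27, 19, 30, 21, 22] m m' ∧ Safe D n M m' ∧ Mono D n m m' ∧
      (m.arr cFrom 0 = w → m.arr cPoint 0 = p → m.arr cPos 0 = q → Available D n M m w c →
        Reach D n m' w' c')) m := by
  refine wp_seq (wp_mono (mulC_spec (N := m.arr cFrom 0) (y := n) (by norm_num) (by norm_num)
    (by norm_num) (by omega) (fun m' h => by simp [h.arr]) (fun m' h => by simp [h.arr, hn])) ?_)
  rintro m1 ⟨f1, p1⟩
  refine wp_seq (wp_mono (wp_for (s := [cTour])
    (fun k m' => ∀ i < k, m'.arr cTour i = tab n m (m.arr cFrom 0) i) hnZ (by norm_num) (by simp)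
    (fun m' h => by simp [h.arr, f1.arr, hn]) ?_ (by simp) ?_) ?_)
  · intro k m v h
    simpa [Memory.arr_put] using h
  · intro k m' hk h1 h2 h3
    refine wp_setEnt ⟨(Fr.refl _ _).put (by norm_num) (by simp), fun i hi => ?_⟩
    simp [Memory.arr_put, h2, h1.arr, p1, tab, f1.arr]
    by_cases hik : i = k
    · simp [hik]
    · rw [if_neg hik]
      exact h3 i (by omega)
  rintro m2 ⟨f2, t2⟩
  refine wp_seq (wp_setEnt ?_)
  set m3 := m2.put cTour ((var cPos).eval m2) ((NExp.add (var cPoint) (.lit 1)).eval m2) with hm3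
  have f3 : Fr [10, 18, 20, 31] m m3 :=
    ((f1.mono (by simp)).trans (f2.mono (by simp))).put (by norm_num) (by simp)
  have t3 : ∀ i < n, m3.arr cTour i = Function.update (tab n m (m.arr cFrom 0)) (m.arr cPos 0)
      (m.arr cPoint 0 + 1) i := by
    intro i hi
    have e1 : m2.arr cPos 0 = m.arr cPos 0 := by simp [f2.arr, f1.arr]
    have e2 : m2.arr cPoint 0 = m.arr cPoint 0 := by simp [f2.arr, f1.arr]
    simp [hm3, Memory.arr_put, Function.update_apply, e1, e2, t2 i hi]
  have hS3 : Safe D n M m3 :=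
    hS.of_eq (f3.arr_eq _ (by norm_num) (by simp)) (f3.arr_eq _ (by norm_num) (by simp))
  have hM3 : Mono D n m m3 :=
    Mono.of_eq (f3.arr_eq _ (by norm_num) (by simp)) (f3.arr_eq _ (by norm_num) (by simp))
  refine wp_mono (wp_for_hit (D := D) (n := n) (M := M) (N := N)
    (s := [8, 9, 10, 11, 12, 13, 14, 15, 16, 17, 31, 23, 24, 25, 26, 27, 19, 30, 21, 22])
    (fun _ => m.arr cFrom 0 = w ∧ m.arr cPoint 0 = p ∧ m.arr cPos 0 = q ∧ Available D n M m w c)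
    (fun m' => Reach D n m' w' c') w' hNZ (by norm_num) (by simp) (by simp)
    (fun m' h => by simp [h.arr, f3.arr, hN]) (fun _ _ _ h => h) (fun _ _ h => h _ _) hS3 hw'N ?_)
    ?_
  · intro k m4 hk f4 k4 hS4
    have f34 : Fr [7, 18, 20, 8, 9, 10, 11, 12, 13, 14, 15, 16, 17, 31, 23, 24,
        25, 26, 27, 19, 30, 21, 22] m m4 := (f3.mono (by simp)).trans (f4.mono (by simp))
    refine wp_mono (relaxC_spec (n := n) (M := M) (w := k) (D := D) (by rw [f34.storedDist, hD])
      (by simp [f34.arr, hn]) (by simp [f34.arr, hM]) k4 hnZ hMZ (by omega) hS4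
      (fun i hi => by rw [f4.arr _ (by norm_num) (by simp), t3 i hi])) ?_
    rintro m5 ⟨f5, hS5, hM5, r5⟩
    refine ⟨f5, hS5, hM5, ?_⟩
    rintro rfl ⟨h1, h2, h3, h4⟩
    obtain ⟨a1, a2⟩ := h4.matches hS
    obtain ⟨b1, b2⟩ := htr _ a1 a2
    rw [h1, h2, h3] at r5
    exact r5 _ b1 b2
  · rintro m4 ⟨f4, hS4, hM4, r4⟩
    exact ⟨(f3.mono (by simp)).trans (f4.mono (by simp)), hS4, fun w c h => hM4 w c (hM3 w c h),
      fun h1 h2 h3 h4 => r4 ⟨h1, h2, h3, h4⟩⟩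

/-- The sequences `w`, `p`, `q` exist in the analysis only; the program tries every code, point and
position. Round `r` meets the triple `(w r, p r, q r)`. By monotonicity the entry for `w r` is still
good at that moment, and the entry gained for `w (r + 1)` survives the rest of the round. -/
theorem roundsC_spec {Z d n M N : ℕ} {m : Memory} {D : ℕ → ℕ → ℝ} (w p q : ℕ → ℕ) (c : ℕ → ℝ)
    (hD : storedDist d m.R = D) (hn : m.arr cN 0 = n) (hM : m.arr cWidth 0 = M)
    (hN : m.arr cCodes 0 = N) (hnZ : n ≤ Z) (hMZ : M ≤ Z) (hNZ : N ≤ Z) (hn0 : 0 < n)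
    (hS : Safe D n M m) (hwN : ∀ i ≤ n, w i < N) (hp : ∀ i < n, p i < n) (hq : ∀ i < n, q i < n)
    (hstart : Start D n M (w 0) (c 0))
    (htr : ∀ i < n, Transfer D n M (w i) (c i) (p i) (q i) (w (i + 1)) (c (i + 1))) :
    wp Z (roundsC d) (fun m' => Fr [3, 4, 5, 6, 7, 18, 20, 8, 9, 10, 11, 12, 13, 14, 15, 16, 17, 31,
        23, 24, 25, 26, 27, 19, 30, 21, 22] m m' ∧ Safe D n M m' ∧
      Reach D n m' (w n) (c n)) m := by
  refine wp_mono (wp_for (s := [4, 5, 6, 7, 18, 20, 8, 9, 10, 11, 12, 13, 14, 15, 16, 17, 31,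
        23, 24, 25, 26, 27, 19, 30, 21, 22])
    (fun r m' => Safe D n M m' ∧ (0 < r → Reach D n m' (w r) (c r))) hnZ (by norm_num) (by simp)
    (fun m' h => by simp [h.arr, hn]) ?_ ?_ ?_) ?_
  · rintro k m v ⟨h1, h2⟩
    have e1 : (m.put cRound 0 v).arr cTable = m.arr cTable := by
      funext i; simp [Memory.arr_put]
    have e2 : (m.put cRound 0 v).arr cSet = m.arr cSet := by
      funext i; simp [Memory.arr_put]
    exact ⟨h1.of_eq e1 e2, fun h => Mono.of_eq e1 e2 _ _ (h2 h)⟩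
  · exact ⟨hS, by simp⟩
  · rintro r m1 hr f1 - ⟨hS1, hr1⟩
    have hA : Available D n M m1 (w r) (c r) := by
      rcases Nat.eq_zero_or_pos r with rfl | h
      · exact Or.inl hstart
      · exact Or.inr (hr1 h)
    have stat : ∀ (P : Prop) (m m' : Memory), Mono D n m m' →
        (P ∧ Available D n M m (w r) (c r)) → P ∧ Available D n M m' (w r) (c r) :=
      fun P m m' h h' => ⟨h'.1, h'.2.mono h⟩
    refine wp_mono (wp_for_hit (D := D) (n := n) (M := M) (N := N)
      (s := [5, 6, 7, 18, 20, 8, 9, 10, 11, 12, 13, 14, 15, 16, 17, 31, 23, 24,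
        25, 26, 27, 19, 30, 21, 22]) (fun m => True ∧ Available D n M m (w r) (c r))
      (fun m' => Reach D n m' (w (r + 1)) (c (r + 1))) (w r) hNZ (by norm_num) (by simp) (by simp)
      (fun m' h => by simp [h.arr, f1.arr, hN]) (stat _) (fun _ _ h => h _ _) hS1
      (hwN r hr.le) ?_) ?_
    · intro a m2 ha f2 a2 hS2
      refine wp_mono (wp_for_hit (D := D) (n := n) (M := M) (N := n)
        (s := [6, 7, 18, 20, 8, 9, 10, 11, 12, 13, 14, 15, 16, 17, 31, 23, 24,
          25, 26, 27, 19, 30, 21, 22]) (fun m => a = w r ∧ Available D n M m (w r) (c r))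
        (fun m' => Reach D n m' (w (r + 1)) (c (r + 1))) (p r) hnZ (by norm_num) (by simp)
        (by simp) (fun m' h => by simp [h.arr, f2.arr, f1.arr, hn]) (stat _)
        (fun _ _ h => h _ _) hS2 (hp r hr) ?_) ?_
      · intro b m3 hb f3 b3 hS3
        refine wp_mono (wp_for_hit (D := D) (n := n) (M := M) (N := n)
          (s := [7, 18, 20, 8, 9, 10, 11, 12, 13, 14, 15, 16, 17, 31, 23, 24,
            25, 26, 27, 19, 30, 21, 22])
          (fun m => (a = w r ∧ b = p r) ∧ Available D n M m (w r) (c r))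
          (fun m' => Reach D n m' (w (r + 1)) (c (r + 1))) (q r) hnZ (by norm_num) (by simp)
          (by simp) (fun m' h => by simp [h.arr, f3.arr, f2.arr, f1.arr, hn]) (stat _)
          (fun _ _ h => h _ _) hS3 (hq r hr) ?_) ?_
        · intro e m4 he f4 e4 hS4
          refine wp_mono (extendC_spec (n := n) (M := M) (N := N) (D := D) (w := w r) (c := c r)
            (p := p r) (q := q r) (w' := w (r + 1)) (c' := c (r + 1))
            (by rw [f4.storedDist, f3.storedDist, f2.storedDist, f1.storedDist, hD])
            (by simp [f4.arr, f3.arr, f2.arr, f1.arr, hn])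
            (by simp [f4.arr, f3.arr, f2.arr, f1.arr, hM])
            (by simp [f4.arr, f3.arr, f2.arr, f1.arr, hN]) hnZ hMZ hNZ
            (by simp [f4.arr, f3.arr, a2, ha]) (hwN _ hr) hS4 (htr r hr)) ?_
          rintro m5 ⟨f5, hS5, hM5, r5⟩
          refine ⟨f5, hS5, hM5, ?_⟩
          rintro rfl ⟨⟨h1, h2⟩, h3⟩
          exact r5 (by simp [f4.arr, f3.arr, a2, h1]) (by simp [f4.arr, b3, h2]) e4 h3
        · rintro m4 ⟨f4, hS4, hM4, r4⟩
          exact ⟨f4, hS4, hM4, fun h1 h2 => r4 ⟨⟨h2.1, h1⟩, h2.2⟩⟩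
      · rintro m3 ⟨f3, hS3, hM3, r3⟩
        exact ⟨f3, hS3, hM3, fun h1 h2 => r3 ⟨h1, h2.2⟩⟩
    · rintro m2 ⟨f2, hS2, hM2, r2⟩
      exact ⟨f2, hS2, fun _ => r2 ⟨trivial, hA⟩⟩
  · rintro m' ⟨h1, h2, h3⟩
    exact ⟨h1, h2, h3 hn0⟩

/-- Computes the number `(n + 1) ^ (5 M)` of codes. -/
def countCodesC : Cmd :=
  .seq (setVar cCodes (.lit 1)) (forC cRule (var cWidth) (forC cInner (.lit 5)
    (.seq (mulC cTmp (var cCodes) (.add (var cN) (.lit 1)) cAux) (setVar cCodes (var cTmp)))))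

/-- Writes the tour stored for the code `0` to the first `n` cells. -/
def outputC : Cmd :=
  .seq (forC cInner (var cN) (setEnt cOut (var cInner) (ent cTable (var cInner))))
    (.seq (setEnt cOut (.add (var cN) (.lit 1)) (ent cTable (.lit 0)))
      (.seq (setVar cN (.lit 1))
        (.seq (.while (.nle (.lit 1) (ent cOut (var cN)))
            (.seq (.nset (var cN) (.sub (ent cOut (var cN)) (.lit 1))) (incr cN)))
          (.nset (.lit 0) (.sub (ent cOut (.add (var cN) (.lit 1))) (.lit 1))))))

def searchC (d : ℕ) : Cmd := .seq countCodesC (.seq (roundsC d) outputC)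

theorem countCodesC_spec {Z n M : ℕ} {m : Memory} (hn : m.arr cN 0 = n) (hM : m.arr cWidth 0 = M)
    (hMZ : M ≤ Z) (hZ : (n + 1) ^ (5 * M) ≤ Z) (h5 : 5 ≤ Z) :
    wp Z countCodesC (fun m' => Fr [cRule, cInner, cTmp, cAux, cCodes] m m' ∧
      m'.arr cCodes 0 = (n + 1) ^ (5 * M)) m := by
  have le : ∀ e ≤ 5 * M, (n + 1) ^ e ≤ Z := fun e he =>
    (Nat.pow_le_pow_right (by omega) he).trans hZ
  refine wp_seq (wp_setVar ?_)
  have hF : Fr [cRule, cInner, cTmp, cAux, cCodes] m (m.put cCodes 0 ((NExp.lit 1).eval m)) :=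
    (Fr.refl _ _).put (by norm_num) (by simp)
  refine wp_mono (wp_for (s := [cInner, cTmp, cAux, cCodes])
    (fun k m' => m'.arr cCodes 0 = (n + 1) ^ (5 * k)) hMZ (by norm_num) (by simp)
    (fun m' h => by simp [h.arr, Memory.arr_put, hM]) ?_ (by simp [Memory.arr_put]) ?_)
    (fun m' h => ⟨hF.trans h.1, h.2⟩)
  · intro k m v h
    simpa [Memory.arr_put] using h
  intro k m1 hk f1 _ h1
  refine wp_mono (wp_for (s := [cTmp, cAux, cCodes])
    (fun j m' => m'.arr cCodes 0 = (n + 1) ^ (5 * k + j)) h5 (by norm_num) (by simp)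
    (fun m' h => by simp) ?_ (by simpa using h1) ?_) (fun m' h => ⟨h.1, by rw [h.2]; ring⟩)
  · intro k m v h
    simpa [Memory.arr_put] using h
  intro j m2 hj f2 _ h2
  refine wp_seq (wp_mono (mulC_spec (N := (n + 1) ^ (5 * k + j)) (y := n + 1) (by norm_num)
    (by norm_num) (by norm_num) (le _ (by omega)) (fun m' h => by simp [h.arr, h2])
    (fun m' h => by simp [h.arr, f2.arr, f1.arr, Memory.arr_put, hn])) ?_)
  rintro m3 ⟨f3, h3⟩
  refine wp_setVar ⟨(f3.mono (by simp)).put (by norm_num) (by simp), ?_⟩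
  simp [Memory.arr_put, h3]; ring

/-- The output occupies the cells below `n`, which overlap the variables of the program. The tour is
therefore copied to `cOut` first, whose entry `i` lies in cell `32 i + 28`. Afterwards the only live
variable is cell `0`, a counter that starts at `1`, and writing cell `i` never touches entries of
`cOut` that are still to be read. Entry `n` is `0` and stops the loop; entry `n + 1` keeps the first
point of the tour for cell `0`, which is written last. -/
theorem outputC_spec {Z n : ℕ} {m : Memory} {T : ℕ → ℕ} (hn : m.arr cN 0 = n) (hnZ : n ≤ Z)
    (hn1 : 1 ≤ n) (hT : ∀ i < n, m.arr cTable i = T i) (hT1 : ∀ i < n, 1 ≤ T i)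
    (hout : ∀ i, m.arr cOut i = 0) :
    wp Z outputC (fun m' => ∀ i < n, m'.I i = T i - 1) m := by
  refine wp_seq (wp_mono (wp_for (s := [cOut])
    (fun k m' => ∀ i, m'.arr cOut i = if i < k then T i else 0) hnZ (by norm_num) (by simp)
    (fun m' h => by simp [h.arr, hn]) ?_ (by simp [hout]) ?_) ?_)
  · intro k m v h
    simpa [Memory.arr_put] using h
  · intro k m' hk h1 h2 h3
    refine wp_setEnt ⟨(Fr.refl _ _).put (by norm_num) (by simp), fun i => ?_⟩
    simp [Memory.arr_put, h2, h1.arr, hT k hk, h3]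
    split_ifs <;> first | omega | simp_all
  rintro m1 ⟨f1, o1⟩
  refine wp_seq (wp_setEnt (wp_seq (wp_setVar (wp_seq ?_))))
  set m2 := (m1.put cOut ((NExp.add (var cN) (.lit 1)).eval m1)
    ((ent cTable (.lit 0)).eval m1)).put cN 0 _ with hm2
  have o2 : ∀ i, m2.arr cOut i = if i < n then T i else if i = n + 1 then T 0 else 0 := by
    intro i
    simp [hm2, Memory.arr_put, o1, f1.arr, hn, hT 0 (by omega)]
    split_ifs <;> omega
  have i2 : m2.I 0 = 1 := by simp [hm2, Memory.put]
  refine wp_mono (wp_while (N := n - 1) (fun k m' => m'.I 0 = k + 1 ∧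
    (∀ i, 1 ≤ i → i < k + 1 → m'.I i = T i - 1) ∧
    ∀ i, k + 1 ≤ i → m'.arr cOut i = m2.arr cOut i) (by omega) ⟨i2, by omega, fun _ _ => rfl⟩
    ?_ ?_ ?_) ?_
  · rintro k m' hk ⟨h1, h2, h3⟩
    simp [Memory.arr, h1]
    have := h3 (k + 1) le_rfl
    rw [o2, if_pos (by omega)] at this
    have h4 := hT1 (k + 1) (by omega)
    simp only [Memory.arr] at this
    omega
  · rintro m' ⟨h1, h2, h3⟩
    simp [Memory.arr, h1]
    have := h3 (n - 1 + 1) le_rfl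
    rw [o2, if_neg (by omega), if_neg (by omega)] at this
    simpa only [Memory.arr] using this
  · rintro k m' hk ⟨h1, h2, h3⟩
    have h0 : m'.arr cN 0 = k + 1 := by simpa [Memory.arr] using h1
    refine wp_seq (wp_nset (wp_setVar ⟨?_, fun i hi hi' => ?_, fun i hi => ?_⟩))
    · simp [Memory.put, Memory.arr, h1]
    · have hi0 : i ≠ 0 := by omega
      simp only [Memory.put, eval_var, h0, eval_sub, eval_ent, eval_lit]
      rw [Function.update_of_ne (by omega)]
      by_cases hik : i = k + 1
      · subst hik
        rw [Function.update_self, h3 _ le_rfl, o2, if_pos (by omega)]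
      · rw [Function.update_of_ne hik]
        exact h2 i hi (by omega)
    · have := h3 i (by omega)
      simp only [Memory.put, Memory.arr, eval_var, eval_sub, eval_ent, eval_lit] at this ⊢
      rw [Function.update_of_ne (by omega), Function.update_of_ne, this]
      simp only [mul_zero, add_zero, h1]
      omega
  · rintro m' ⟨h1, h2, h3⟩
    refine wp_nset fun i hi => ?_
    have h0 : m'.arr cN 0 = n := by simp [Memory.arr]; omega
    simp only [eval_lit, eval_sub, eval_ent, eval_add, eval_var, h0]
    rcases Nat.eq_zero_or_pos i with rfl | hi0
    · rw [Function.update_self, h3 _ (by omega), o2, if_neg (by omega), if_pos rfl]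
    · rw [Function.update_of_ne (by omega)]
      exact h2 i hi0 (by omega)

/-! ### Complete tours from the code 0. -/

theorem exists_perm_of_visits {n : ℕ} {T : ℕ → ℕ} (h : ∀ p < n, visits T p n = 1) :
    ∃ σ : Equiv.Perm (Fin n), ∀ i : Fin n, T i = σ i + 1 := by
  have ex : ∀ p k, visits T p k ≠ 0 → ∃ i < k, T i = p + 1 := by
    intro p k
    induction k with
    | zero => simp [visits]
    | succ k ih =>
      intro hk
      by_cases hT : T k = p + 1
      · exact ⟨k, by omega, hT⟩
      · simp only [visits, hT, if_false, add_zero] at hk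
        obtain ⟨i, hi, hi'⟩ := ih hk
        exact ⟨i, by omega, hi'⟩
  have : ∀ p : Fin n, ∃ i : Fin n, T i = p + 1 := by
    intro p
    obtain ⟨i, hi, hi'⟩ := ex p n (by rw [h p p.2]; simp)
    exact ⟨⟨i, hi⟩, hi'⟩
  choose f hf using this
  have hinj : Function.Injective f := by
    intro p p' hpp
    have h1 := hf p
    rw [hpp, hf p'] at h1
    exact Fin.ext (by omega)
  refine ⟨(Equiv.ofBijective f (Finite.injective_iff_bijective.1 hinj)).symm, fun i => ?_⟩
  have := hf ((Equiv.ofBijective f (Finite.injective_iff_bijective.1 hinj)).symm i)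
  rwa [← Equiv.ofBijective_apply f (Finite.injective_iff_bijective.1 hinj),
    Equiv.apply_symm_apply] at this

/-- All digits of `0` are `0`, so no rule accepts or rejects anything and the initial value stands.
In `Matches` this value is `1 - 0 = 1`, so the code `0` describes the set of all points. -/
theorem accepts_zero (D : ℕ → ℕ → ℝ) (n p r k : ℕ) :
    accepts D (codeDigit n 0 0) (codeDigit n 1 0) (codeDigit n 2 0) p r k = r := by
  induction k with
  | zero => rfl
  | succ k ih => simp [accepts, ih, ruleStep, codeDigit]

theorem searchC_spec {Z d n M : ℕ} {m : Memory} {D : ℕ → ℕ → ℝ} (w p q : ℕ → ℕ) (c : ℕ → ℝ)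
    (hD : storedDist d m.R = D) (hn : m.arr cN 0 = n) (hM : m.arr cWidth 0 = M)
    (h0 : ∀ j ∈ [cTable, cSet, cOut], ∀ i, m.arr j i = 0) (hnZ : n ≤ Z) (hMZ : M ≤ Z) (h5 : 5 ≤ Z)
    (hZ : (n + 1) ^ (5 * M) ≤ Z) (hn0 : 0 < n)
    (hwN : ∀ i ≤ n, w i < (n + 1) ^ (5 * M)) (hp : ∀ i < n, p i < n) (hq : ∀ i < n, q i < n)
    (hstart : Start D n M (w 0) (c 0))
    (htr : ∀ i < n, Transfer D n M (w i) (c i) (p i) (q i) (w (i + 1)) (c (i + 1)))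
    (hw : w n = 0) :
    wp Z (searchC d) (fun m' => ∃ (T : ℕ → ℕ) (σ : Equiv.Perm (Fin n)),
      (∀ i : Fin n, T i = σ i + 1) ∧ partialCost D n T ≤ c n ∧ ∀ i : Fin n, m'.I i = σ i) m := by
  refine wp_seq (wp_mono (countCodesC_spec hn hM hMZ hZ h5) ?_)
  rintro m1 ⟨f1, N1⟩
  have hS : Safe D n M m1 := fun w =>
    ⟨fun h => absurd (by rw [f1.arr _ (by norm_num) (by simp), h0 _ (by simp)]) h,
      fun _ i _ => by simp only [tab]; rw [f1.arr _ (by norm_num) (by simp), h0 _ (by simp)]⟩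
  refine wp_seq (wp_mono (roundsC_spec (n := n) (M := M) (D := D) w p q c
    (by rw [f1.storedDist, hD]) (by simp [f1.arr, hn]) (by simp [f1.arr, hM]) N1 hnZ hMZ hZ hn0 hS
    hwN hp hq hstart htr) ?_)
  rintro m2 ⟨f2, hS2, h2, h3⟩
  have hmat := (hS2 _).1 h2
  rw [hw] at hmat h3
  obtain ⟨σ, hσ⟩ := exists_perm_of_visits (n := n) (T := tab n m2 0) fun p hp => by
    rw [hmat.1 p hp, accepts_zero]
  refine wp_mono (outputC_spec (n := n) (T := tab n m2 0) (by simp [f2.arr, f1.arr, hn]) hnZ hn0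
    (fun i _ => by simp [tab]) (fun i hi => by rw [hσ ⟨i, hi⟩]; omega)
    (fun i => by rw [f2.arr _ (by norm_num) (by simp), f1.arr _ (by norm_num) (by simp),
      h0 _ (by simp)])) ?_
  intro m3 h4
  exact ⟨tab n m2 0, σ, hσ, h3, fun i => by rw [h4 i i.2, hσ i]; omega⟩

/-! ### Computing the width -/

/-- The arrays outside of `s` and the first `b` coordinates are unchanged. -/
structure Keeps (s : List ℕ) (b : ℕ) (m m' : Memory) : Prop where
  arr : ∀ j, j < 32 → j ∉ s → ∀ i, m'.arr j i = m.arr j i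
  real : ∀ k < b, m'.R (k + 1) = m.R (k + 1)

theorem Keeps.refl (s : List ℕ) (b : ℕ) (m : Memory) : Keeps s b m m :=
  ⟨fun _ _ _ _ => rfl, fun _ _ => rfl⟩

theorem Keeps.put {s : List ℕ} {b : ℕ} {m₁ m₂ : Memory} (h : Keeps s b m₁ m₂) {j i v : ℕ}
    (hj : j < 32) (hs : j ∈ s) : Keeps s b m₁ (m₂.put j i v) :=
  ⟨fun j' hj' hs' i' => by
    rw [Memory.arr_put _ hj hj', if_neg (by rintro ⟨rfl, -⟩; exact hs' hs)]
    exact h.arr j' hj' hs' i', h.real⟩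

theorem Fr.keeps {s : List ℕ} {m₁ m₂ : Memory} (h : Fr s m₁ m₂) (b : ℕ) : Keeps s b m₁ m₂ :=
  ⟨h.arr, fun k _ => h.real k⟩

theorem Keeps.trans {s : List ℕ} {b : ℕ} {m₁ m₂ m₃ : Memory} (h₁ : Keeps s b m₁ m₂)
    (h₂ : Keeps s b m₂ m₃) : Keeps s b m₁ m₃ :=
  ⟨fun j hj hs i => (h₂.arr j hj hs i).trans (h₁.arr j hj hs i),
    fun k hk => (h₂.real k hk).trans (h₁.real k hk)⟩

theorem Keeps.mono {s s' : List ℕ} {b : ℕ} {m₁ m₂ : Memory} (h : Keeps s b m₁ m₂) (hs : s ⊆ s') :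
    Keeps s' b m₁ m₂ :=
  ⟨fun j hj h' i => h.arr j hj (fun hh => h' (hs hh)) i, h.real⟩

def Memory.putR (m : Memory) (a : ℕ) (v : ℝ) : Memory := { m with R := Function.update m.R a v }

@[simp] theorem Memory.arr_putR (m : Memory) (a : ℕ) (v : ℝ) (j i : ℕ) :
    (m.putR a v).arr j i = m.arr j i := rfl

theorem Memory.R_putR (m : Memory) (a : ℕ) (v : ℝ) (k : ℕ) :
    (m.putR a v).R k = if k = a then v else m.R k := Function.update_apply ..

theorem Keeps.putR {s : List ℕ} {b : ℕ} {m₁ m₂ : Memory} (h : Keeps s b m₁ m₂) {a : ℕ} (v : ℝ)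
    (ha : b < a) : Keeps s b m₁ (m₂.putR a v) :=
  ⟨h.arr, fun k hk => by
    rw [Memory.R_putR, if_neg (by omega)]; exact h.real k hk⟩

theorem wp_for_inv {Z x N : ℕ} {e : NExp} {c : Cmd} {m₀ : Memory} (J : ℕ → Memory → Prop)
    (hN : N ≤ Z) (hx : x < 32) (hJ : ∀ k m v, J k m → J k (m.put x 0 v))
    (he : ∀ k m, J k m → e.eval m = N) (h0 : J 0 m₀)
    (hs : ∀ k m, k < N → m.arr x 0 = k → J k m →
      wp Z c (fun m' => m'.arr x 0 = k ∧ J (k + 1) m') m) :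
    wp Z (forC x e c) (J N) m₀ := by
  refine wp_seq (wp_setVar ?_)
  refine wp_mono (wp_while (N := N) (fun k m => m.arr x 0 = k ∧ J k m) hN ?_ ?_ ?_ ?_)
    (fun _ h => h.2)
  · exact ⟨by simp [Memory.arr_put _ hx hx], hJ _ _ _ h0⟩
  · rintro k m hk ⟨h1, h2⟩
    simp only [holds_nle, eval_add, eval_var, eval_lit, he k m h2]; omega
  · rintro m ⟨h1, h2⟩
    simp only [holds_nle, eval_add, eval_var, eval_lit, he N m h2]; omega
  · rintro k m hk ⟨h1, h2⟩
    refine wp_seq (wp_mono (hs k m hk h1 h2) ?_)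
    rintro m' ⟨h3, h4⟩
    exact wp_setVar ⟨by simp [Memory.arr_put _ hx hx, h3], hJ _ _ _ h4⟩

/-- Real scratch cell number `k`. -/
def cellAddr (k : ℕ) : NExp := .add (var cPtr) (.lit k)

def cell (k : ℕ) : RExp := .mem (cellAddr k)

def setCell (k : ℕ) (e : RExp) : Cmd := .rset (cellAddr k) e

/-- Computes in `cTmp` a number between `n ^ (1 - 1 / δ)` and three times this power: the binary
expansion of the exponent yields the power up to a factor of two, as a product of iterated square
roots of `n`. -/
def powerC (d : ℕ) : Cmd :=
  .seq (setVar cPtr (.add ((var cN).smul d) (.lit 1))) (.seq (setCell 0 (.lit 0))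
  (.seq (forC cInner (var cN) (setCell 0 (.add (cell 0) (.lit 1))))
  (.seq (setCell 1 (.lit 1)) (.seq (setCell 2 (.sub (.lit 1) (.div (.lit 1) accReal)))
  (.seq (setCell 3 (.lit 1))
  (.seq (forC cInner (.add (var cN) (var cN)) (.ite (.rle (cell 0) (.lit 2)) .skip
    (.seq (setCell 0 (.sqrt (cell 0))) (.seq (setCell 3 (.div (cell 3) (.lit 2)))
      (.ite (.rle (cell 3) (cell 2)) (.seq (setCell 1 (.mul (cell 1) (cell 0)))
        (setCell 2 (.sub (cell 2) (cell 3)))) .skip)))))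
  (.seq (setCell 0 (.lit 0)) (.seq (setVar cTmp (.lit 0))
  (forC cInner (.add (.add (var cN) (var cN)) (.lit 1))
    (.ite (.rle (.mul (.lit 2) (cell 1)) (cell 0)) .skip
      (.seq (setCell 0 (.add (cell 0) (.lit 1))) (incr cTmp))))))))))))

/-- Computes in `cTmp` the least `L` with `n ≤ 2 ^ L`. -/
def logC : Cmd :=
  .seq (setVar cTmp (.lit 0)) (.seq (setVar cPtr (.lit 1)) (forC cInner (var cN)
    (.ite (.nle (var cN) (var cPtr)) .skip
      (.seq (setVar cPtr (.add (var cPtr) (var cPtr))) (incr cTmp)))))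

theorem logC_spec {Z n : ℕ} {m : Memory} (hn : m.arr cN 0 = n) (hn1 : 1 ≤ n) (hnZ : n ≤ Z) :
    wp Z logC (fun m' => Fr [cInner, cPtr, cTmp] m m' ∧ n ≤ 2 ^ m'.arr cTmp 0 ∧
      2 ^ m'.arr cTmp 0 < 2 * n ∧ m'.arr cTmp 0 ≤ n) m := by
  refine wp_seq (wp_setVar (wp_seq (wp_setVar ?_)))
  set m1 := (m.put cTmp 0 ((NExp.lit 0).eval m)).put cPtr 0 _ with hm1
  have hF : Fr [cInner, cPtr, cTmp] m m1 :=
    ((Fr.refl _ _).put (by norm_num) (by simp)).put (by norm_num) (by simp)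
  refine wp_mono (wp_for (s := [cPtr, cTmp]) (fun k m' => m'.arr cPtr 0 = 2 ^ m'.arr cTmp 0 ∧
    m'.arr cTmp 0 ≤ k ∧ (m'.arr cTmp 0 = k ∨ n ≤ m'.arr cPtr 0) ∧ m'.arr cPtr 0 < 2 * n)
    hnZ (by norm_num) (by simp) (fun m' h => by simp [h.arr, hF.arr, hn]) ?_ ?_ ?_) ?_
  · intro k m v h
    simpa [Memory.arr_put] using h
  · simp [hm1, Memory.arr_put]; omega
  · rintro k m' hk h1 h2 ⟨h3, h4, h5, h6⟩
    have hn' : m'.arr cN 0 = n := by simp [h1.arr, hF.arr, hn]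
    refine wp_ite (fun hb => ?_) (fun hb => ?_)
    · simp [hn'] at hb
      exact wp_skip ⟨Fr.refl _ _, h3, by omega, Or.inr hb, h6⟩
    · simp [hn'] at hb
      refine wp_seq (wp_setVar (wp_setVar ⟨?_, ?_⟩))
      · exact ((Fr.refl _ _).put (by norm_num) (by simp)).put (by norm_num) (by simp)
      · simp [Memory.arr_put, pow_succ]
        omega
  · rintro m' ⟨h1, h2, h3, h4, h5⟩
    refine ⟨hF.trans h1, ?_, h2 ▸ h5, h3⟩
    rcases h4 with h4 | h4
    · rw [h4]; exact Nat.lt_two_pow_self.le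
    · exact h2 ▸ h4

theorem log_bounds {n L : ℕ} (hn : 2 ≤ n) (h1 : n ≤ 2 ^ L) (h2 : 2 ^ L < 2 * n) :
    Real.log n ≤ L ∧ (L : ℝ) ≤ 3 * Real.log n := by
  have l1 := Real.log_two_gt_d9
  have l2 := Real.log_two_lt_d9
  have hn0 : (0 : ℝ) < n := by positivity
  have hnR : (2 : ℝ) ≤ n := by exact_mod_cast hn
  have h1' : (n : ℝ) ≤ 2 ^ L := by exact_mod_cast h1
  have h2' : (2 : ℝ) ^ L ≤ 2 * n := by exact_mod_cast h2.le
  have a1 := Real.log_le_log hn0 h1'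
  have a2 := Real.log_le_log (by positivity) h2'
  have a3 := Real.log_le_log (by norm_num) hnR
  rw [Real.log_pow] at a1 a2
  rw [Real.log_mul (by norm_num) hn0.ne'] at a2
  have hL : (0 : ℝ) ≤ L := by positivity
  constructor <;> nlinarith

theorem powerC_spec {Z d n : ℕ} {δ : ℝ} {m : Memory} (hn : m.arr cN 0 = n) (hn1 : 1 ≤ n)
    (hδ : 1 ≤ δ) (hR : m.R 0 = δ) (hnZ : 2 * n + 1 ≤ Z) :
    wp Z (powerC d) (fun m' => Keeps [cInner, cPtr, cTmp] (d * n) m m' ∧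
      (n : ℝ) ^ (1 - 1 / δ) ≤ m'.arr cTmp 0 ∧
      (m'.arr cTmp 0 : ℝ) ≤ 3 * (n : ℝ) ^ (1 - 1 / δ)) m := by
  set α := 1 - 1 / δ with hα
  have hα0 : 0 ≤ α := by
    have : 1 / δ ≤ 1 := by rw [div_le_one (by linarith)]; exact hδ
    linarith
  have hα1 : α < 1 := by
    have : 0 < 1 / δ := by positivity
    linarith
  have hnR : (1 : ℝ) ≤ n := by exact_mod_cast hn1
  have hn0 : (0 : ℝ) < n := by linarith
  set b := d * n + 1 with hb
  let Core : Memory → Prop := fun m' => Keeps [cInner, cPtr, cTmp] (d * n) m m' ∧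
    m'.arr cPtr 0 = b
  have core_put : ∀ m' v, Core m' → Core (m'.put cInner 0 v) := fun m' v h =>
    ⟨h.1.put (by norm_num) (by simp), by simpa [Memory.arr_put] using h.2⟩
  have core_tmp : ∀ m' v, Core m' → Core (m'.put cTmp 0 v) := fun m' v h =>
    ⟨h.1.put (by norm_num) (by simp), by simpa [Memory.arr_put] using h.2⟩
  have core_putR : ∀ m' k v, Core m' → Core (m'.putR (b + k) v) := fun m' k v h =>
    ⟨h.1.putR _ (by omega), h.2⟩
  have core_n : ∀ m', Core m' → m'.arr cN 0 = n := fun m' h => by simp [h.1.arr, hn]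
  have eval_cell : ∀ m' k, Core m' → (cell k).eval m' = m'.R (b + k) := fun m' k h => by
    simp [cell, cellAddr, RExp.eval, h.2]
  have wp_cell : ∀ k e Q m', Core m' → Q (m'.putR (b + k) (e.eval m')) →
      wp Z (setCell k e) Q m' := fun k e Q m' h hQ => by
    refine wp_rset ?_
    have : (cellAddr k).eval m' = b + k := by simp [cellAddr, h.2]
    rw [this]; exact hQ
  refine wp_seq (wp_setVar ?_)
  have C0 : Core (m.put cPtr 0 ((NExp.add ((var cN).smul d) (.lit 1)).eval m)) :=
    ⟨(Keeps.refl _ _ _).put (by norm_num) (by simp), by simp [Memory.arr_put, hn, hb]⟩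
  have C0R : (m.put cPtr 0 ((NExp.add ((var cN).smul d) (.lit 1)).eval m)).R 0 = δ := hR
  generalize (m.put cPtr 0 ((NExp.add ((var cN).smul d) (.lit 1)).eval m)) = m0 at C0 C0R
  refine wp_seq (wp_cell _ _ _ _ C0 (wp_seq (wp_mono (wp_for_inv (N := n)
    (fun k m' => Core m' ∧ m'.R (b + 0) = k ∧ m'.R 0 = δ) (by omega) (by norm_num)
    (fun k m' v h => ⟨core_put _ _ h.1, h.2⟩) (fun k m' h => by simp [core_n _ h.1])
    ⟨core_putR _ _ _ C0, by simp [Memory.R_putR, RExp.eval],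
      by simp [Memory.R_putR, C0R]⟩ ?_) ?_)))
  · rintro k m' hk hx ⟨h1, h2, h3⟩
    refine wp_cell _ _ _ _ h1 ⟨hx, core_putR _ _ _ h1, ?_, ?_⟩
    · simp [Memory.R_putR, RExp.eval, eval_cell _ _ h1]
      simpa using h2
    · rw [Memory.R_putR, if_neg (by omega), h3]
  rintro m1 ⟨C1, X1, R1⟩
  refine wp_seq (wp_cell _ _ _ _ C1 (wp_seq (wp_cell _ _ _ _ (core_putR _ _ _ C1) (wp_seq
    (wp_cell _ _ _ _ (core_putR _ _ _ (core_putR _ _ _ C1)) ?_)))))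
  set m2 := ((m1.putR (b + 1) _).putR (b + 2) _).putR (b + 3) _ with hm2
  have C2 : Core m2 := core_putR _ _ _ (core_putR _ _ _ (core_putR _ _ _ C1))
  have X2 : m2.R (b + 0) = n ∧ m2.R (b + 1) = 1 ∧ m2.R (b + 2) = α ∧ m2.R (b + 3) = 1 := by
    refine ⟨?_, ?_, ?_, ?_⟩
    · simp [hm2, Memory.R_putR, ← X1]
    · simp [hm2, Memory.R_putR, RExp.eval]
    · simp [hm2, Memory.R_putR, RExp.eval, eval_accReal, R1, hα]
    · simp [hm2, Memory.R_putR, RExp.eval]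
  generalize m2 = m2 at C2 X2
  -- Invariant: `P` is the product so far and `a` the exponent still missing, with `a < h` for the
  -- current power `n ^ h`. Once `n ^ h ≤ 2`, the missing factor `n ^ a` lies between `1` and `2`.
  refine wp_seq (wp_mono (wp_for_inv (N := n + n)
    (fun k m' => Core m' ∧ ∃ P a h : ℝ, m'.R (b + 0) = (n : ℝ) ^ h ∧ m'.R (b + 1) = P ∧
      m'.R (b + 2) = a ∧ m'.R (b + 3) = h ∧ 0 ≤ a ∧ a < h ∧ P * (n : ℝ) ^ a = (n : ℝ) ^ α ∧
      ((n : ℝ) ^ h ≤ 2 ∨ (n : ℝ) ^ h ≤ n - k / 2)) (by omega) (by norm_num)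
    (fun k m' v h => ⟨core_put _ _ h.1, h.2⟩) (fun k m' h => by simp [core_n _ h.1])
    ⟨C2, 1, α, 1, by simpa using X2.1, X2.2.1, X2.2.2.1, X2.2.2.2, hα0, hα1, by simp,
      by simp⟩ ?_) ?_)
  · rintro k m' hk hx ⟨h1, P, a, h, eX, eP, ea, eh, ha0, hah, hPa, hX⟩
    refine wp_ite (fun hb' => ?_) (fun hb' => ?_)
    · simp only [holds_rle, eval_cell _ _ h1, RExp.eval, eX] at hb'
      exact wp_skip ⟨hx, h1, P, a, h, eX, eP, ea, eh, ha0, hah, hPa, Or.inl (by simpa using hb')⟩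
    · simp only [holds_rle, eval_cell _ _ h1, RExp.eval, eX] at hb'
      have hX2 : 2 < (n : ℝ) ^ h := by simpa using hb'
      refine wp_seq (wp_cell _ _ _ _ h1 (wp_seq (wp_cell _ _ _ _ (core_putR _ _ _ h1) ?_)))
      set m3 := (m'.putR (b + 0) _).putR (b + 3) _ with hm3
      have C3 : Core m3 := core_putR _ _ _ (core_putR _ _ _ h1)
      have hsq : Real.sqrt ((n : ℝ) ^ h) = (n : ℝ) ^ (h / 2) := by
        rw [Real.sqrt_eq_rpow, ← Real.rpow_mul hn0.le]; congr 1; ring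
      have e0 : m3.R (b + 0) = (n : ℝ) ^ (h / 2) := by
        rw [← hsq, ← eX, ← eval_cell _ _ h1]
        simp [hm3, Memory.R_putR, RExp.eval]
      have e1 : m3.R (b + 1) = P := by simp [hm3, Memory.R_putR, eP]
      have e2 : m3.R (b + 2) = a := by simp [hm3, Memory.R_putR, ea]
      have e3 : m3.R (b + 3) = h / 2 := by
        have : (cell 3).eval (m'.putR (b + 0) ((cell 0).sqrt.eval m')) = h := by
          rw [eval_cell _ _ (core_putR _ _ _ h1), Memory.R_putR, if_neg (by omega), eh]
        rw [hm3, Memory.R_putR, if_pos rfl]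
        simp only [RExp.eval] at this ⊢
        rw [this]; norm_num
      have hx3 : m3.arr cInner 0 = k := by simpa [hm3] using hx
      have hnew : (n : ℝ) ^ (h / 2) ≤ 2 ∨ (n : ℝ) ^ (h / 2) ≤ n - ((k + 1 : ℕ) : ℝ) / 2 := by
        right
        rcases hX with hX | hX
        · linarith
        · rw [← hsq]
          set y := Real.sqrt ((n : ℝ) ^ h)
          have hy : y * y = (n : ℝ) ^ h := Real.mul_self_sqrt (by positivity)
          have hy0 : 0 ≤ y := Real.sqrt_nonneg _
          -- From `y * y > 2` follows `y * y - y ≥ 1 / 2`: every square root lowers the power by at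
          -- least `1 / 2`, so `2 n` rounds suffice.
          have : 1.4 ≤ y := by nlinarith
          push_cast
          nlinarith
      clear_value m3
      refine wp_ite (fun hc => ?_) (fun hc => ?_)
      · simp only [holds_rle, eval_cell _ _ C3, e2, e3] at hc
        refine wp_seq (wp_cell _ _ _ _ C3 (wp_cell _ _ _ _ (core_putR _ _ _ C3) ⟨by simpa using hx3,
          core_putR _ _ _ (core_putR _ _ _ C3), P * (n : ℝ) ^ (h / 2), a - h / 2, h / 2,
          ?_, ?_, ?_, ?_, by linarith, by linarith, ?_, hnew⟩))
        · simpa [Memory.R_putR] using e0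
        · simp [Memory.R_putR, RExp.eval, eval_cell _ _ C3, e1]
          left; simpa using e0
        · simp [Memory.R_putR, RExp.eval, eval_cell _ _ (core_putR _ _ _ C3), e2, e3]
        · simp [Memory.R_putR, e3]
        · rw [mul_assoc, ← Real.rpow_add hn0, ← hPa]; congr 2; ring
      · simp only [holds_rle, eval_cell _ _ C3, e2, e3] at hc
        exact wp_skip ⟨hx3, C3, P, a, h / 2, e0, e1, e2, e3, ha0, by linarith, hPa, hnew⟩
  rintro m3 ⟨C3, P, a, h, eX, eP, ea, eh, ha0, hah, hPa, hX⟩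
  have hX2 : (n : ℝ) ^ h ≤ 2 := by
    rcases hX with hX | hX
    · exact hX
    · push_cast at hX; linarith
  have h1a : 1 ≤ (n : ℝ) ^ a := Real.one_le_rpow hnR ha0
  have ha2 : (n : ℝ) ^ a ≤ 2 := (Real.rpow_le_rpow_of_exponent_le hnR hah.le).trans hX2
  have hα1' : 1 ≤ (n : ℝ) ^ α := Real.one_le_rpow hnR hα0
  have hαn : (n : ℝ) ^ α ≤ n := by
    simpa using Real.rpow_le_rpow_of_exponent_le hnR hα1.le
  have hP0 : 0 ≤ P := by
    by_contra hcon
    nlinarith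
  have hP1 : P ≤ (n : ℝ) ^ α := by nlinarith
  have hP2 : (n : ℝ) ^ α ≤ 2 * P := by nlinarith
  refine wp_seq (wp_cell _ _ _ _ C3 (wp_seq (wp_setVar ?_)))
  -- A counter compared with `2 P` turns the real `P` into a natural number. It stops below `2 P + 1
  -- ≤ 3 n ^ α`, and since `P ≤ n` there are enough rounds.
  refine wp_mono (wp_for_inv (N := n + n + 1)
    (fun k m' => Core m' ∧ m'.R (b + 0) = m'.arr cTmp 0 ∧ m'.R (b + 1) = P ∧
      (m'.arr cTmp 0 : ℝ) < 2 * P + 1 ∧ (m'.arr cTmp 0 = k ∨ 2 * P ≤ m'.arr cTmp 0)) (by omega)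
    (by norm_num) (fun k m' v h => ⟨core_put _ _ h.1, by simpa [Memory.arr_put] using h.2⟩)
    (fun k m' h => by simp [core_n _ h.1]) ?_ ?_) ?_
  · refine ⟨core_tmp _ _ (core_putR _ _ _ C3), ?_⟩
    simp [Memory.arr_put, Memory.R_putR, RExp.eval, eP]
    linarith
  · rintro k m' hk hx ⟨h1, h2, h3, h4, h5⟩
    refine wp_ite (fun hc => ?_) (fun hc => ?_)
    · simp only [holds_rle, eval_cell _ _ h1, RExp.eval, h2, h3] at hc
      exact wp_skip ⟨hx, h1, h2, h3, h4, Or.inr (by simpa using hc)⟩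
    · simp only [holds_rle, eval_cell _ _ h1, RExp.eval, h2, h3] at hc
      have hc' : (m'.arr cTmp 0 : ℝ) < 2 * P := by simpa using hc
      refine wp_seq (wp_cell _ _ _ _ h1 (wp_setVar ⟨by simpa [Memory.arr_put] using hx,
        core_tmp _ _ (core_putR _ _ _ h1), ?_, ?_, ?_, ?_⟩))
      · simp [Memory.arr_put, Memory.R_putR, RExp.eval, eval_cell _ _ h1]
        simpa using h2
      · simp [Memory.R_putR, h3]
      · simp [Memory.arr_put]; linarith
      · left
        simp [Memory.arr_put]
        exact h5.resolve_right (by linarith)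
  · rintro m' ⟨h1, h2, h3, h4, h5⟩
    refine ⟨h1.1, ?_, by linarith⟩
    rcases h5 with h5 | h5
    · rw [h5] at h4 ⊢
      push_cast at h4
      linarith
    · linarith

/-- The order of growth of the exponent in the running time. -/
noncomputable def growth (δ : ℝ) (n : ℕ) : ℝ :=
  open Classical in
  if 1 < δ then (n : ℝ) ^ (1 - 1 / δ) else if δ = 1 then Real.log n ^ 2 else Real.log n

/-- Which of three commands is used depends on `δ` alone and is decided outside of the program. The
stored value of `δ` is read only if `δ > 1`. The factor `9` arises for `δ = 1`, where a logarithm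
known up to the factor `3` is squared. -/
theorem exists_widthC (d : ℕ) (δ : ℝ) (K : ℕ) : ∃ c : Cmd, ∀ (Z n : ℕ) (m : Memory), 2 ≤ n →
    m.arr cN 0 = n → m.R 0 = δ → 2 * n + 1 ≤ Z →
    wp Z c (fun m' => Keeps [cWidth, cInner, cPtr, cTmp, cRes, cAux] (d * n) m m' ∧
      ∃ k : ℕ, growth δ n ≤ k ∧ (k : ℝ) ≤ 9 * growth δ n ∧ m'.arr cWidth 0 = K * k) m := by
  rcases lt_trichotomy 1 δ with hδ | hδ | hδ
  · refine ⟨.seq (powerC d) (setVar cWidth ((var cTmp).smul K)), fun Z n m hn hN hR hZ =>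
      wp_seq (wp_mono (powerC_spec hN (by omega) hδ.le hR hZ) ?_)⟩
    rintro m' ⟨h1, h2, h3⟩
    refine wp_setVar ⟨(h1.mono (by simp)).put (by norm_num) (by simp), m'.arr cTmp 0, ?_, ?_,
      by simp [Memory.arr_put]⟩
    · rwa [growth, if_pos hδ]
    · rw [growth, if_pos hδ]
      have : 0 ≤ (n : ℝ) ^ (1 - 1 / δ) := by positivity
      linarith
  · refine ⟨.seq logC (.seq (mulC cRes (var cTmp) (var cTmp) cAux)
      (setVar cWidth ((var cRes).smul K))), fun Z n m hn hN hR hZ =>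
      wp_seq (wp_mono (logC_spec (n := n) hN (by omega) (by omega)) ?_)⟩
    rintro m1 ⟨h1, h2, h3, h4⟩
    refine wp_seq (wp_mono (mulC_spec (N := m1.arr cTmp 0) (y := m1.arr cTmp 0) (by norm_num)
      (by norm_num) (by norm_num) (by omega) (fun m' h => by simp [h.arr])
      (fun m' h => by simp [h.arr])) ?_)
    rintro m2 ⟨h5, h6⟩
    obtain ⟨l1, l2⟩ := log_bounds hn h2 h3
    have l0 : 0 ≤ Real.log n := Real.log_natCast_nonneg n
    refine wp_setVar ⟨(((h1.keeps _).mono (by simp)).trans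
      ((h5.keeps _).mono (by simp))).put (by norm_num) (by simp),
      m1.arr cTmp 0 * m1.arr cTmp 0, ?_, ?_, by simp [Memory.arr_put, h6]⟩
    · rw [growth, if_neg (by linarith), if_pos hδ.symm]
      push_cast
      nlinarith
    · rw [growth, if_neg (by linarith), if_pos hδ.symm]
      push_cast
      nlinarith
  · refine ⟨.seq logC (setVar cWidth ((var cTmp).smul K)), fun Z n m hn hN hR hZ =>
      wp_seq (wp_mono (logC_spec (n := n) hN (by omega) (by omega)) ?_)⟩
    rintro m1 ⟨h1, h2, h3, h4⟩
    obtain ⟨l1, l2⟩ := log_bounds hn h2 h3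
    have l0 : 0 ≤ Real.log n := Real.log_natCast_nonneg n
    refine wp_setVar ⟨((h1.keeps _).mono (by simp)).put (by norm_num) (by simp),
      m1.arr cTmp 0, ?_, ?_, by simp [Memory.arr_put]⟩
    · rwa [growth, if_neg (by linarith), if_neg hδ.ne]
    · rw [growth, if_neg (by linarith), if_neg hδ.ne]
      linarith

/-! ### Codes of partial tours -/

/-- The end positions, and the positions adjacent to a change between visited and not visited. -/
noncomputable def bdry (n : ℕ) (T : ℕ → ℕ) : Finset ℕ :=
  open Classical in
  {q ∈ Finset.range n | q = 0 ∨ q + 1 = n ∨ ¬ (T (q - 1) = 0 ↔ T q = 0) ∨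
    ¬ (T q = 0 ↔ T (q + 1) = 0)}

/-- `w` is a code of `T` that lists no more positions than necessary. -/
structure IsCodeOf (D : ℕ → ℕ → ℝ) (n M : ℕ) (T : ℕ → ℕ) (w : ℕ) : Prop where
  matches' : Matches D n M T w
  ne_zero : w ≠ 0
  listed : ∀ q < n, (∃ k < M, codeDigit n 3 w k = q + 1) → q ∈ bdry n T

theorem IsCodeOf.boundaryAt {D : ℕ → ℕ → ℝ} {n M w : ℕ} {T : ℕ → ℕ} (h : IsCodeOf D n M T w)
    {q : ℕ} (hq : q < n) : BoundaryAt n M T (codeDigit n 3 w) (codeDigit n 4 w) q :=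
  h.matches'.2.resolve_left h.ne_zero q hq

theorem BoundaryAt.listed_of_mem {n M q : ℕ} {T qq u : ℕ → ℕ} (h : BoundaryAt n M T qq u q)
    (hq : q ∈ bdry n T) : ∃ k < M, qq k = q + 1 := by
  rcases h.2 with h | ⟨h1, h2, h3, h4⟩
  · exact h
  · simp only [bdry, Finset.mem_filter, h3, h4, not_true, or_false] at hq
    omega

/-- Read the positions from left to right: a listed position has a prescribed content, and an
unlisted one has the status of its predecessor. Position `0` cannot be unlisted, which starts the
induction. -/
theorem same_status {n M : ℕ} {T T' qq u : ℕ → ℕ} (h : ∀ q < n, BoundaryAt n M T qq u q)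
    (h' : ∀ q < n, BoundaryAt n M T' qq u q) : ∀ q < n, (T q = 0 ↔ T' q = 0) := by
  have key : ∀ q < n, (∃ k < M, qq k = q + 1) → T q = T' q := by
    rintro q hq ⟨k, hk, hkq⟩
    rw [(h q hq).1 k hk hkq, (h' q hq).1 k hk hkq]
  intro q
  induction q with
  | zero =>
    intro hq
    rcases (h 0 hq).2 with h1 | h1
    · rw [key 0 hq h1]
    · omega
  | succ q ih =>
    intro hq
    rcases (h _ hq).2 with h1 | ⟨-, -, h1, -⟩
    · rw [key _ hq h1]
    · rcases (h' _ hq).2 with h2 | ⟨-, -, h2, -⟩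
      · rw [key _ hq h2]
      · rw [← h1, ← h2]; exact ih (by omega)

theorem IsCodeOf.eq_of_mem_bdry {D : ℕ → ℕ → ℝ} {n M w q : ℕ} {T T' : ℕ → ℕ}
    (h : IsCodeOf D n M T w) (h' : Matches D n M T' w) (hq : q ∈ bdry n T) : T' q = T q := by
  have hqn : q < n := by
    simp only [bdry, Finset.mem_filter, Finset.mem_range] at hq; exact hq.1
  obtain ⟨k, hk, hkq⟩ := (h.boundaryAt hqn).listed_of_mem hq
  rw [(h.boundaryAt hqn).1 k hk hkq, (h'.2.resolve_left h.ne_zero q hqn).1 k hk hkq]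

theorem IsCodeOf.status {D : ℕ → ℕ → ℝ} {n M w : ℕ} {T T' : ℕ → ℕ}
    (h : IsCodeOf D n M T w) (h' : Matches D n M T' w) : ∀ q < n, (T' q = 0 ↔ T q = 0) :=
  same_status (h'.2.resolve_left h.ne_zero) fun _ hq => h.boundaryAt hq

/-! ### Partial tours with the same code are interchangeable. -/

theorem visits_update {T : ℕ → ℕ} {n q p v : ℕ} (hq : q < n) (hT : T q = 0) :
    visits (Function.update T q (p + 1)) v n = visits T v n + if v = p then 1 else 0 := by
  have key : ∀ k, visits (Function.update T q (p + 1)) v k =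
      visits T v k + if q < k ∧ v = p then 1 else 0 := by
    intro k
    induction k with
    | zero => simp [visits]
    | succ k ih =>
      simp only [visits, ih, Function.update_apply]
      by_cases hkq : k = q
      · subst hkq
        by_cases hv : v = p
        · simp [hT, hv]
        · have : p ≠ v := fun h => hv h.symm
          simp [hT, hv, this]
      · simp only [hkq, if_false]
        split_ifs <;> omega
  rw [key]
  simp [hq]

theorem IsCodeOf.start {D : ℕ → ℕ → ℝ} {n M w : ℕ} (h : IsCodeOf D n M (fun _ => 0) w) :
    Start D n M w (partialCost D n fun _ => 0) := by
  intro T hT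
  have h0 : ∀ i < n, T i = 0 := by
    rcases hT with hT | hT
    · exact fun i hi => (h.status hT i hi).2 rfl
    · exact hT
  exact ⟨h.matches'.congr fun i hi => (h0 i hi).symm, (partialCost_congr h0).le⟩

/-- The tour `S` shares with `T` the visited points, the status of every position and the contents
of the boundary positions of `T`. A position other than `q` that the new code lists is either empty
or already on the boundary of `T`, so both updates match that code. The edges gained join `q` to
boundary positions of `T`, so both tours become longer by the same amount. -/
theorem IsCodeOf.transfer {D : ℕ → ℕ → ℝ} {n M w p q w' : ℕ} {T : ℕ → ℕ}
    (h : IsCodeOf D n M T w) (hq : q < n) (hTq : T q = 0)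
    (h' : (w' = 0 ∧ Matches D n M (Function.update T q (p + 1)) w') ∨
      IsCodeOf D n M (Function.update T q (p + 1)) w') :
    Transfer D n M w (partialCost D n T) p q w'
      (partialCost D n (Function.update T q (p + 1))) := by
  intro S hS hcost
  have hst := h.status hS
  have hSq : S q = 0 := (hst q hq).2 hTq
  set T' := Function.update T q (p + 1) with hT'
  set S' := Function.update S q (p + 1) with hS'
  have eqq : S' q = T' q := by simp [hS', hT']
  have T'_ne : ∀ a ≠ q, T' a = T a := fun a ha => by simp [hT', ha]
  have S'_ne : ∀ a ≠ q, S' a = S a := fun a ha => by simp [hS', ha]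
  have hst' : ∀ a < n, (S' a = 0 ↔ T' a = 0) := by
    intro a ha
    by_cases haq : a = q
    · rw [haq, eqq]
    · rw [T'_ne a haq, S'_ne a haq]; exact hst a ha
  have hT'q : T' q ≠ 0 := by simp [hT']
  have hvis : ∀ v < n, visits S' v n = visits T' v n := by
    intro v hv
    rw [visits_update hq hSq, visits_update hq hTq, hS.1 v hv, h.matches'.1 v hv]
  have hM : Matches D n M T' w' := h'.elim (fun h => h.2) fun h => h.matches'
  refine ⟨⟨fun v hv => by rw [hvis v hv, hM.1 v hv], ?_⟩, ?_⟩
  · rcases h' with h' | h'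
    · exact Or.inl h'.1
    · refine Or.inr fun a ha => ⟨fun k hk hka => ?_, ?_⟩
      · rw [← (h'.boundaryAt ha).1 k hk hka]
        by_cases haq : a = q
        · rw [haq, eqq]
        rw [T'_ne a haq, S'_ne a haq]
        by_cases hTa : T a = 0
        · rw [hTa, (hst a ha).2 hTa]
        -- Here it matters that codes list nothing but boundary positions, since the contents of
        -- interior positions may differ between `S` and `T`. The change of status that puts `a` on
        -- the boundary of `T'` does not involve `q`, because both `a` and `q` are occupied in `T'`.
        have hb := h'.listed a ha ⟨k, hk, hka⟩
        refine h.eq_of_mem_bdry hS ?_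
        simp only [bdry, Finset.mem_filter, Finset.mem_range, T'_ne a haq, hTa, iff_false] at hb ⊢
        refine ⟨ha, ?_⟩
        rcases hb.2 with hb | hb | hb | hb
        · exact Or.inl hb
        · exact Or.inr (Or.inl hb)
        · have : a - 1 ≠ q := by rintro rfl; exact hb hT'q
          rw [T'_ne _ this] at hb
          exact Or.inr (Or.inr (Or.inl hb))
        · have : a + 1 ≠ q := by rintro rfl; simp [hT'q] at hb
          rw [T'_ne _ this] at hb
          exact Or.inr (Or.inr (Or.inr hb))
      · refine (h'.boundaryAt ha).2.imp id ?_
        rintro ⟨h1, h2, h3, h4⟩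
        refine ⟨h1, h2, ?_, ?_⟩
        · rw [hst' _ ha, hst' _ (by omega)]; exact h3
        · rw [hst' _ ha, hst' _ h2]; exact h4
  -- An occupied neighbour of the empty position `q` is on the boundary. For the closing edge,
  -- between the positions `n - 1` and `0`, this holds because the end positions always count as
  -- boundary.
  · have adj : ∀ a < n, T a ≠ 0 → (a = nextPos n q ∨ q = nextPos n a) → S a = T a := by
      intro a ha hTa had
      refine h.eq_of_mem_bdry hS ?_
      simp only [bdry, Finset.mem_filter, Finset.mem_range, hTa, iff_false]
      refine ⟨ha, ?_⟩
      unfold nextPos at had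
      split_ifs at had
      · rcases had with rfl | had
        · right; right; left; simpa using hTq
        · right; right; right; rw [← had]; simpa using hTq
      · rcases had with rfl | had
        · right; right; left; simpa using hTq
        · omega
      · rcases had with rfl | had
        · exact Or.inl rfl
        · right; right; right; rw [← had]; simpa using hTq
      · omega
    have edge : ∀ e < n, edgeCost D n S' e - edgeCost D n S e =
        edgeCost D n T' e - edgeCost D n T e := by
      intro e he
      have hf := nextPos_lt he
      by_cases hinc : e = q ∨ nextPos n e = q
      · have z1 : edgeCost D n S e = 0 := by
          rw [edgeCost, if_pos]
          rcases hinc with hh | hh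
          · exact Or.inl (hh ▸ hSq)
          · exact Or.inr (hh ▸ hSq)
        have z2 : edgeCost D n T e = 0 := by
          rw [edgeCost, if_pos]
          rcases hinc with hh | hh
          · exact Or.inl (hh ▸ hTq)
          · exact Or.inr (hh ▸ hTq)
        have same : ∀ a < n, (a = q ∨ a = nextPos n q ∨ q = nextPos n a) → S' a = T' a := by
          intro a ha hh
          by_cases haq : a = q
          · rw [haq, eqq]
          rw [T'_ne a haq, S'_ne a haq]
          by_cases hTa : T a = 0
          · rw [hTa, (hst a ha).2 hTa]
          · exact adj a ha hTa (hh.resolve_left haq)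
        rw [z1, z2, edgeCost, edgeCost, same e he (hinc.imp id fun hh => Or.inr hh.symm),
          same _ hf (by
            rcases hinc with hh | hh
            · exact Or.inr (Or.inl (by rw [hh]))
            · exact Or.inl hh)]
      · push Not at hinc
        rw [edgeCost, edgeCost, edgeCost, edgeCost, T'_ne _ hinc.1, T'_ne _ hinc.2,
          S'_ne _ hinc.1, S'_ne _ hinc.2]
        ring
    have : partialCost D n S' - partialCost D n S = partialCost D n T' - partialCost D n T := by
      simp only [partialCost, ← Finset.sum_sub_distrib]
      exact Finset.sum_congr rfl fun e he => edge e (Finset.mem_range.1 he)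
    linarith

/-- A rule: its kind, the centre of its ball, and a point on the boundary. -/
abbrev Rule := ℕ × ℕ × ℕ

noncomputable def acceptsList (D : ℕ → ℕ → ℝ) (l : List Rule) (p : ℕ) : ℕ :=
  l.foldl (fun r ρ => ruleStep D ρ.1 ρ.2.1 ρ.2.2 p r) 0

/-- Unused digits are `0` and a rule of kind `0` has no effect, so a short list of rules may be
padded to the width `M`. -/
theorem accepts_eq_acceptsList (D : ℕ → ℕ → ℝ) (l : List Rule) (p M : ℕ) (hM : l.length ≤ M)
    (fl x y : ℕ → ℕ) (h : ∀ k < M, (fl k, x k, y k) = l.getD k (0, 0, 0)) :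
    accepts D fl x y p 0 M = acceptsList D l p := by
  have key : ∀ k ≤ M, accepts D fl x y p 0 k = acceptsList D (l.take k) p := by
    intro k
    induction k with
    | zero => simp [accepts, acceptsList]
    | succ k ih =>
      intro hk
      have hk' := h k (by omega)
      rw [accepts, ih (by omega)]
      by_cases hkl : k < l.length
      · rw [List.getD_eq_getElem _ _ hkl] at hk'
        rw [acceptsList, acceptsList, List.take_succ_eq_append_getElem hkl, List.foldl_append,
          ← hk']
        rfl
      · rw [List.getD_eq_default _ _ (by omega)] at hk'
        simp only [Prod.mk.injEq] at hk'
        rw [List.take_of_length_le (by omega : l.length ≤ k),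
          List.take_of_length_le (by omega : l.length ≤ k + 1), hk'.1]
        simp [ruleStep]
  rw [key M le_rfl, List.take_of_length_le hM]

theorem exists_digits (n M : ℕ) (f : ℕ → ℕ → ℕ) (hf : ∀ j < 5, ∀ k < M, f j k ≤ n) :
    ∃ w < (n + 1) ^ (5 * M), ∀ j < 5, ∀ k < M, codeDigit n j w k = f j k := by
  let g : Fin (5 * M) → Fin (n + 1) := fun i => ⟨f (i % 5) (i / 5), by
    have := i.2
    exact Nat.lt_succ_of_le (hf _ (Nat.mod_lt _ (by norm_num)) _ (by omega))⟩
  refine ⟨finFunctionFinEquiv g, (finFunctionFinEquiv g).2, fun j hj k hk => ?_⟩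
  have h1 : finFunctionFinEquiv.symm (finFunctionFinEquiv g) ⟨5 * k + j, by omega⟩ =
      g ⟨5 * k + j, by omega⟩ := by rw [Equiv.symm_apply_apply]
  have h2 := congrArg Fin.val h1
  rw [finFunctionFinEquiv_symm_apply_val] at h2
  simp only [g] at h2
  rw [codeDigit, h2]
  congr 1 <;> omega

theorem exists_isCodeOf {D : ℕ → ℕ → ℝ} {n M : ℕ} {T : ℕ → ℕ} (hn : 2 ≤ n)
    (hT : ∀ q < n, T q ≤ n) (hb : (bdry n T).card ≤ M) (l : List Rule) (hl : l.length ≤ M)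
    (hrule : ∀ ρ ∈ l, ρ.1 ≤ n ∧ ρ.2.1 ≤ n ∧ ρ.2.2 ≤ n)
    (hvis : ∀ p < n, visits T p n = acceptsList D l p) :
    ∃ w < (n + 1) ^ (5 * M), IsCodeOf D n M T w := by
  set b := (bdry n T).toList with hbl
  have hbm : ∀ q, q ∈ b ↔ q ∈ bdry n T := fun q => Finset.mem_toList
  have hblen : b.length ≤ M := by rw [hbl, Finset.length_toList]; exact hb
  have hbn : ∀ q ∈ b, q < n := fun q hq => by
    rw [hbm, bdry, Finset.mem_filter, Finset.mem_range] at hq; exact hq.1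
  let f : ℕ → ℕ → ℕ := fun j k =>
    if j = 0 then (l.getD k (0, 0, 0)).1 else if j = 1 then (l.getD k (0, 0, 0)).2.1
    else if j = 2 then (l.getD k (0, 0, 0)).2.2
    else if h : k < b.length then (if j = 3 then b[k] + 1 else T b[k]) else 0
  have hlk : ∀ k, (l.getD k (0, 0, 0)).1 ≤ n ∧ (l.getD k (0, 0, 0)).2.1 ≤ n ∧
      (l.getD k (0, 0, 0)).2.2 ≤ n := by
    intro k
    by_cases hk : k < l.length
    · rw [List.getD_eq_getElem _ _ hk]
      exact hrule _ (List.getElem_mem hk)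
    · rw [List.getD_eq_default _ _ (by omega)]; simp
  obtain ⟨w, hw, hdig⟩ := exists_digits n M f (by
    intro j hj k hk
    have := hlk k
    simp only [f]
    split_ifs with h1 h2 h3 h4 h5
    · exact this.1
    · exact this.2.1
    · exact this.2.2
    · exact hbn _ (List.getElem_mem h4)
    · exact hT _ (hbn _ (List.getElem_mem h4))
    · omega)
  have d3 : ∀ k < M, ∀ q, codeDigit n 3 w k = q + 1 → ∃ h : k < b.length, b[k] = q := by
    intro k hk q hkq
    rw [hdig 3 (by norm_num) k hk] at hkq
    simp only [f] at hkq
    norm_num at hkq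
    split_ifs at hkq with h
    exact ⟨h, by omega⟩
  have lst : ∀ q ∈ b, ∃ k < M, codeDigit n 3 w k = q + 1 := by
    intro q hq
    obtain ⟨k, hk, rfl⟩ := List.mem_iff_getElem.1 hq
    refine ⟨k, by omega, ?_⟩
    rw [hdig 3 (by norm_num) k (by omega)]
    simp [f, hk]
  -- Position `0` is always on the boundary and is listed as the digit `1`, so no such code collides
  -- with the value `0`, which stands for complete tours.
  have hw0 : w ≠ 0 := by
    rintro rfl
    obtain ⟨k, -, hk⟩ := lst 0 ((hbm 0).2 (by simp [bdry]; omega))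
    simp [codeDigit] at hk
  refine ⟨w, hw, ⟨fun p hp => ?_, Or.inr fun q hq => ⟨fun k hk hkq => ?_, ?_⟩⟩, hw0, ?_⟩
  · rw [hvis p hp, show 1 - w = 0 by omega]
    refine (accepts_eq_acceptsList D l p M hl _ _ _ fun k hk => ?_).symm
    rw [hdig 0 (by norm_num) k hk, hdig 1 (by norm_num) k hk, hdig 2 (by norm_num) k hk]
    simp [f]
  · obtain ⟨h, rfl⟩ := d3 k hk q hkq
    rw [hdig 4 (by norm_num) k hk]
    simp [f, h]
  · by_cases hqb : q ∈ b
    · exact Or.inl (lst q hqb)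
    · rw [hbm, bdry, Finset.mem_filter, Finset.mem_range] at hqb
      right
      push Not at hqb
      obtain ⟨h1, h2, h3, h4⟩ := hqb hq
      exact ⟨by omega, by omega, h3, h4⟩
  · rintro q hq ⟨k, hk, hkq⟩
    obtain ⟨h, rfl⟩ := d3 k hk q hkq
    exact (hbm _).1 (List.getElem_mem h)

/-- The part of the tour `σ` that visits the points of `S`. -/
noncomputable def restrictTour {n : ℕ} (σ : Equiv.Perm (Fin n)) (S : List (Fin n)) (q : ℕ) : ℕ :=
  if h : q < n then (if σ ⟨q, h⟩ ∈ S then σ ⟨q, h⟩ + 1 else 0) else 0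

/-- The edges of the tour `σ` inside `Q` that have exactly one end in `S`. -/
def cutEdges {n : ℕ} (σ : Equiv.Perm (Fin n)) (Q S : Finset (Fin n)) : Finset (Fin n) :=
  {e | σ e ∈ Q ∧ σ (finRotate n e) ∈ Q ∧ ¬ (σ e ∈ S ↔ σ (finRotate n e) ∈ S)}

theorem restrictTour_visits {n : ℕ} (σ : Equiv.Perm (Fin n)) (S : List (Fin n)) (p : Fin n) :
    visits (restrictTour σ S) p n = if p ∈ S then 1 else 0 := by
  have key : ∀ k ≤ n, visits (restrictTour σ S) p k =
      if p ∈ S ∧ (σ.symm p : ℕ) < k then 1 else 0 := by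
    intro k
    induction k with
    | zero => simp [visits]
    | succ k ih =>
      intro hk
      have hkn : k < n := by omega
      have hiff : σ ⟨k, hkn⟩ = p ↔ k = (σ.symm p : ℕ) := by
        rw [← Equiv.eq_symm_apply, Fin.ext_iff]
      rw [visits, ih (by omega), restrictTour, dif_pos hkn]
      by_cases hp : σ ⟨k, hkn⟩ = p
      · have hk' := hiff.1 hp
        by_cases hpS : p ∈ S
        · simp [hp, hpS, ← hk']
        · simp [hp, hpS]
      · have hk' : k ≠ (σ.symm p : ℕ) := fun h => hp (hiff.2 h)
        have hne : ¬ (if σ ⟨k, hkn⟩ ∈ S then (σ ⟨k, hkn⟩ : ℕ) + 1 else 0) = p + 1 := by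
          intro h
          split_ifs at h
          exact hp (Fin.ext (by omega))
        by_cases hpS : p ∈ S
        · by_cases hlt : (σ.symm p : ℕ) < k
          · simp [hpS, hlt, Nat.lt_succ_of_lt hlt]
            exact hne
          · have : ¬ (σ.symm p : ℕ) < k + 1 := by omega
            simp [hpS, hlt, this]
            exact hne
        · simp [hpS]
          exact hne
  rw [key n le_rfl]
  simp [(σ.symm p).2]

/-- A change of status between consecutive positions is an edge of the tour with exactly one end in
`S`. It puts two positions on the boundary, and the two end positions are there in any case. -/
theorem card_bdry_le {n : ℕ} (hn : 2 ≤ n) (σ : Equiv.Perm (Fin n)) (S : List (Fin n)) :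
    (bdry n (restrictTour σ S)).card ≤
      2 * (cutEdges σ Finset.univ S.toFinset).card + 2 := by
  classical
  set C := (cutEdges σ Finset.univ S.toFinset).map Fin.valEmbedding with hC
  have mem_C : ∀ q, q + 1 < n → ¬ (restrictTour σ S q = 0 ↔ restrictTour σ S (q + 1) = 0) →
      q ∈ C := by
    intro q hq h
    rw [hC, Finset.mem_map]
    refine ⟨⟨q, by omega⟩, ?_, rfl⟩
    have hrot : finRotate n ⟨q, by omega⟩ = ⟨q + 1, hq⟩ := by
      obtain ⟨m, rfl⟩ : ∃ m, n = m + 1 := ⟨n - 1, by omega⟩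
      exact finRotate_of_lt (by omega)
    simp only [cutEdges, Finset.mem_filter, Finset.mem_univ, true_and, hrot, List.mem_toFinset]
    intro hh
    apply h
    simp only [restrictTour, dif_pos (show q < n by omega), dif_pos hq]
    by_cases h1 : σ ⟨q, by omega⟩ ∈ S
    · simp [h1, hh.1 h1]
    · simp [h1]
      exact fun h2 => h1 (hh.2 h2)
  have hsub : bdry n (restrictTour σ S) ⊆ (C ∪ C.image (· + 1)) ∪ {0, n - 1} := by
    intro q hq
    rw [bdry, Finset.mem_filter, Finset.mem_range] at hq
    simp only [Finset.mem_union, Finset.mem_image, Finset.mem_insert, Finset.mem_singleton]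
    obtain ⟨h0, h1 | h1 | h1 | h1⟩ := hq
    · exact Or.inr (Or.inl h1)
    · exact Or.inr (Or.inr (by omega))
    · by_cases hq0 : q = 0
      · exact Or.inr (Or.inl hq0)
      · refine Or.inl (Or.inr ⟨q - 1, mem_C _ (by omega) ?_, by omega⟩)
        rwa [show q - 1 + 1 = q by omega]
    · by_cases hq0 : q + 1 = n
      · exact Or.inr (Or.inr (by omega))
      · exact Or.inl (Or.inl (mem_C _ (by omega) h1))
  have hCc : C.card = (cutEdges σ Finset.univ S.toFinset).card := Finset.card_map _
  calc _ ≤ ((C ∪ C.image (· + 1)) ∪ {0, n - 1}).card := Finset.card_le_card hsub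
    _ ≤ (C ∪ C.image (· + 1)).card + ({0, n - 1} : Finset ℕ).card := Finset.card_union_le _ _
    _ ≤ (C.card + (C.image (· + 1)).card) + 2 :=
      Nat.add_le_add (Finset.card_union_le _ _) Finset.card_le_two
    _ ≤ (C.card + C.card) + 2 :=
      Nat.add_le_add_right (Nat.add_le_add_left Finset.card_image_le _) _
    _ = _ := by rw [hCc]; ring

/-- An ordering of the points all of whose initial parts have short descriptions and cut few edges
of the tour `σ` yields a sequence of codes that leads to a tour as short as `σ`. -/
theorem exists_code_sequence {D : ℕ → ℕ → ℝ} {n M : ℕ} (hn : 2 ≤ n) (σ : Equiv.Perm (Fin n))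
    (l : List (Fin n)) (hnd : l.Nodup) (hl : l.toFinset = Finset.univ)
    (hrules : ∀ i, ∃ R : List Rule, R.length ≤ M ∧ (∀ ρ ∈ R, ρ.1 ≤ n ∧ ρ.2.1 ≤ n ∧ ρ.2.2 ≤ n) ∧
      ∀ p : Fin n, acceptsList D R p = if p ∈ l.take i then 1 else 0)
    (hcut : ∀ i, 2 * (cutEdges σ Finset.univ (l.take i).toFinset).card + 2 ≤ M) :
    ∃ (w p q : ℕ → ℕ) (c : ℕ → ℝ), (∀ i ≤ n, w i < (n + 1) ^ (5 * M)) ∧ (∀ i < n, p i < n) ∧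
      (∀ i < n, q i < n) ∧ Start D n M (w 0) (c 0) ∧
      (∀ i < n, Transfer D n M (w i) (c i) (p i) (q i) (w (i + 1)) (c (i + 1))) ∧ w n = 0 ∧
      c n = partialCost D n fun q => if h : q < n then σ ⟨q, h⟩ + 1 else 0 := by
  classical
  have hlen : l.length = n := by
    rw [← List.toFinset_card_of_nodup hnd, hl, Finset.card_univ, Fintype.card_fin]
  have hmem : ∀ x, x ∈ l := fun x => by rw [← List.mem_toFinset, hl]; simp
  have hle : ∀ S : List (Fin n), ∀ q < n, restrictTour σ S q ≤ n := by
    intro S q hq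
    rw [restrictTour, dif_pos hq]
    split_ifs
    · exact (σ ⟨q, hq⟩).2
    · omega
  have code : ∀ i, ∃ w < (n + 1) ^ (5 * M), IsCodeOf D n M (restrictTour σ (l.take i)) w := by
    intro i
    obtain ⟨R, h1, h2, h3⟩ := hrules i
    refine exists_isCodeOf hn (hle _) ((card_bdry_le hn σ _).trans (hcut i)) R h1 h2 ?_
    intro p hp
    rw [show p = ((⟨p, hp⟩ : Fin n) : ℕ) from rfl, restrictTour_visits, h3]
  choose w hwlt hw using code
  have hfull : restrictTour σ (l.take n) =
      fun q => if h : q < n then (σ ⟨q, h⟩ : ℕ) + 1 else 0 := by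
    funext q
    simp only [restrictTour, List.take_of_length_le hlen.le, hmem, if_true]
  have step : ∀ i (hi : i < n), restrictTour σ (l.take (i + 1)) =
      Function.update (restrictTour σ (l.take i)) (σ.symm (l[i]'(by omega)))
        ((l[i]'(by omega) : Fin n) + 1) := by
    intro i hi
    funext q
    rw [Function.update_apply]
    have htake : l.take (i + 1) = l.take i ++ [l[i]'(by omega)] :=
      List.take_succ_eq_append_getElem (by omega)
    by_cases hq : q < n
    · by_cases hqi : q = (σ.symm (l[i]'(by omega)) : ℕ)
      · rw [if_pos hqi]
        have : σ ⟨q, hq⟩ = l[i]'(by omega) := by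
          rw [← Equiv.eq_symm_apply]; exact Fin.ext hqi
        rw [restrictTour, dif_pos hq, this, if_pos (by
          rw [htake]; exact List.mem_append_right _ (List.mem_singleton_self _))]
      · rw [if_neg hqi]
        have : σ ⟨q, hq⟩ ≠ l[i]'(by omega) := fun h => hqi (by rw [← h]; simp)
        simp only [restrictTour, dif_pos hq, htake, List.mem_append, List.mem_singleton, this,
          or_false]
    · rw [if_neg (fun h => hq (by rw [h]; exact (σ.symm _).2))]
      simp [restrictTour, hq]
  have hzero : ∀ i (hi : i < n),
      restrictTour σ (l.take i) (σ.symm (l[i]'(by omega))) = 0 := by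
    intro i hi
    rw [restrictTour, dif_pos (σ.symm _).2]
    have : σ ⟨(σ.symm (l[i]'(by omega)) : ℕ), (σ.symm _).2⟩ = l[i]'(by omega) := by simp
    rw [this, if_neg]
    intro hmem
    obtain ⟨j, hj, hji⟩ := List.mem_take_iff_getElem.1 hmem
    have := (hnd.getElem_inj_iff).1 hji
    omega
  -- Step `i` visits `l[i]` in the position that it has in `σ`. The last code may be `0`, because by
  -- then all points are visited.
  refine ⟨fun i => if i < n then w i else 0,
    fun i => if h : i < n then (l[i]'(by omega) : Fin n) else 0,
    fun i => if h : i < n then (σ.symm (l[i]'(by omega)) : Fin n) else 0,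
    fun i => partialCost D n (restrictTour σ (l.take i)), ?_, ?_, ?_, ?_, ?_, by simp,
    congrArg _ hfull⟩
  · intro i hi
    dsimp only
    split_ifs
    · exact hwlt i
    · positivity
  · intro i hi
    dsimp only
    rw [dif_pos hi]; exact (l[i]'(by omega)).2
  · intro i hi
    dsimp only
    rw [dif_pos hi]; exact (σ.symm _).2
  · have h0 : restrictTour σ (l.take 0) = fun _ => 0 := by funext q; simp [restrictTour]
    have := hw 0
    rw [h0] at this
    simp only [h0, if_pos (show 0 < n by omega)]
    exact this.start
  · intro i hi
    simp only [dif_pos hi, if_pos hi, step i hi]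
    refine (hw i).transfer (σ.symm _).2 (hzero i hi) ?_
    rw [← step i hi]
    by_cases hi1 : i + 1 < n
    · rw [if_pos hi1]; exact Or.inr (hw _)
    · rw [if_neg hi1]
      refine Or.inl ⟨rfl, fun p hp => ?_, Or.inl rfl⟩
      have hfin : l.take (i + 1) = l := List.take_of_length_le (by omega)
      rw [show p = ((⟨p, hp⟩ : Fin n) : ℕ) from rfl, restrictTour_visits, accepts_zero, hfin,
        if_pos (hmem _)]

/-! ### Optimal tours have no two crossing long edges -/

/-- Reversal of a segment replaces two edges by two others; the `L` edges inside are traversed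
backwards and the remaining ones are untouched. Lost and gained edges stand on opposite sides to
avoid subtraction. -/
theorem sum_reverse_segment {X : Type*} [PseudoMetricSpace X] (f : ℕ → X) (i L R : ℕ) (r : ℕ → ℕ)
    (hr : ∀ k, r k = if i < k ∧ k ≤ i + L + 1 then i + 1 + (i + L + 1) - k else k) :
    ∑ k ∈ Finset.range (i + 1 + L + 1 + R), dist (f (r k)) (f (r (k + 1))) +
        (dist (f i) (f (i + 1)) + dist (f (i + L + 1)) (f (i + L + 2))) =
      ∑ k ∈ Finset.range (i + 1 + L + 1 + R), dist (f k) (f (k + 1)) +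
        (dist (f i) (f (i + L + 1)) + dist (f (i + 1)) (f (i + L + 2))) := by
  simp only [Finset.sum_range_add, Finset.sum_range_one]
  have h1 : ∑ k ∈ Finset.range i, dist (f (r k)) (f (r (k + 1))) =
      ∑ k ∈ Finset.range i, dist (f k) (f (k + 1)) := by
    refine Finset.sum_congr rfl fun k hk => ?_
    have := Finset.mem_range.1 hk
    rw [hr, hr, if_neg (by omega), if_neg (by omega)]
  have h2 : ∑ x ∈ Finset.range L, dist (f (r (i + 1 + x))) (f (r (i + 1 + x + 1))) =
      ∑ x ∈ Finset.range L, dist (f (i + 1 + x)) (f (i + 1 + x + 1)) := by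
    rw [← Finset.sum_range_reflect (fun x => dist (f (i + 1 + x)) (f (i + 1 + x + 1)))]
    refine Finset.sum_congr rfl fun k hk => ?_
    have := Finset.mem_range.1 hk
    rw [hr, hr, if_pos (by omega), if_pos (by omega), dist_comm]
    congr 2 <;> omega
  have h3 : ∑ x ∈ Finset.range R, dist (f (r (i + 1 + L + 1 + x)))
        (f (r (i + 1 + L + 1 + x + 1))) =
      ∑ x ∈ Finset.range R, dist (f (i + 1 + L + 1 + x)) (f (i + 1 + L + 1 + x + 1)) := by
    refine Finset.sum_congr rfl fun k hk => ?_
    rw [hr, hr, if_neg (by omega), if_neg (by omega)]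
  have r1 : r (i + 0) = i := by rw [hr, if_neg (by omega)]; rfl
  have r2 : r (i + 0 + 1) = i + L + 1 := by rw [hr, if_pos (by omega)]; omega
  have r3 : r (i + 1 + L + 0) = i + 1 := by rw [hr, if_pos (by omega)]; omega
  have r4 : r (i + 1 + L + 0 + 1) = i + L + 2 := by rw [hr, if_neg (by omega)]; omega
  rw [h1, h2, h3, r1, r2, r3, r4]
  have e1 : i + 1 + L + 0 = i + L + 1 := by omega
  have e2 : i + 1 + L + 0 + 1 = i + L + 2 := by omega
  rw [e2, e1]
  simp only [add_zero]
  ring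

theorem two_opt_of_lt {d n : ℕ} (p : Fin n ↪ Pt d) (σ : Equiv.Perm (Fin n))
    (hσ : IsOptimalTour p σ) {i j : Fin n} (hij : i < j) :
    dist (p (σ i)) (p (σ (finRotate n i))) + dist (p (σ j)) (p (σ (finRotate n j))) ≤
      dist (p (σ i)) (p (σ j)) + dist (p (σ (finRotate n i))) (p (σ (finRotate n j))) := by
  have hn : 0 < n := i.pos
  obtain ⟨L, hL⟩ : ∃ L, (j : ℕ) = i + L + 1 := ⟨j - i - 1, by have : (i : ℕ) < j := hij; omega⟩
  obtain ⟨R, hR⟩ : ∃ R, n = i + 1 + L + 1 + R := ⟨n - (i + 1 + L + 1), by have := j.2; omega⟩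
  let r : ℕ → ℕ := fun k => if (i : ℕ) < k ∧ k ≤ i + L + 1 then i + 1 + (i + L + 1) - k else k
  have hr : ∀ k, r k = if (i : ℕ) < k ∧ k ≤ i + L + 1 then i + 1 + (i + L + 1) - k else k :=
    fun _ => rfl
  have rlt : ∀ k < n, r k < n := fun k hk => by rw [hr]; split_ifs <;> omega
  have rr : ∀ k, r (r k) = k := fun k => by
    rw [hr (r k), hr k]; split_ifs <;> omega
  let ρ : Equiv.Perm (Fin n) :=
    { toFun := fun k => ⟨r k, rlt k k.2⟩
      invFun := fun k => ⟨r k, rlt k k.2⟩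
      left_inv := fun k => Fin.ext (rr k)
      right_inv := fun k => Fin.ext (rr k) }
  -- The periodic extension makes the closing edge an ordinary one, so that the case of `j` being
  -- the last position needs no separate treatment.
  let f : ℕ → Pt d := fun k => p (σ ⟨k % n, Nat.mod_lt _ hn⟩)
  have fval : ∀ k : Fin n, f k = p (σ k) := fun k => by
    simp only [f]; congr 2; exact Fin.ext (Nat.mod_eq_of_lt k.2)
  have fval' : ∀ k : Fin n, f (k + 1) = p (σ (finRotate n k)) := fun k => by
    simp only [f]; congr 2
    obtain ⟨m, rfl⟩ : ∃ m, n = m + 1 := ⟨n - 1, by omega⟩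
    rw [finRotate_apply]
    ext
    rw [Fin.val_add]
    simp
  have len : tourLength p σ = ∑ k ∈ Finset.range n, dist (f k) (f (k + 1)) := by
    rw [← Fin.sum_univ_eq_sum_range (fun k => dist (f k) (f (k + 1)))]
    exact Finset.sum_congr rfl fun k _ => by rw [fval, fval']
  have len' : tourLength p (σ * ρ) = ∑ k ∈ Finset.range n, dist (f (r k)) (f (r (k + 1))) := by
    rw [← Fin.sum_univ_eq_sum_range (fun k => dist (f (r k)) (f (r (k + 1))))]
    refine Finset.sum_congr rfl fun k _ => ?_
    have h1 : f (r k) = p ((σ * ρ) k) := fval (ρ k)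
    have h2 : f (r (k + 1)) = p ((σ * ρ) (finRotate n k)) := by
      have h3 : ((finRotate n k : Fin n) : ℕ) =
          (if (k : ℕ) + 1 = n then 0 else (k : ℕ) + 1 : ℕ) := by
        obtain ⟨m, rfl⟩ : ∃ m, n = m + 1 := ⟨n - 1, by omega⟩
        rw [finRotate_apply, Fin.val_add_one]
        simp only [Fin.ext_iff, Fin.val_last]
        split_ifs <;> omega
      have h4 : p ((σ * ρ) (finRotate n k)) = f (r (finRotate n k : Fin n)) :=
        (fval (ρ (finRotate n k))).symm
      rw [h4, h3]
      split_ifs with hk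
      · rw [hk, hr n, hr 0, if_neg (by omega), if_neg (by omega)]
        simp [f]
      · rfl
    rw [h1, h2]
  have hopt := hσ (σ * ρ)
  rw [len, len', hR] at hopt
  have key := sum_reverse_segment f i L R r hr
  have e1 : f (i + L + 1) = p (σ j) := by rw [← hL, fval]
  have e2 : f (i + L + 2) = p (σ (finRotate n j)) := by
    rw [show (i : ℕ) + L + 2 = j + 1 by omega, fval']
  rw [e1, e2, fval, fval'] at key
  linarith

theorem two_opt {d n : ℕ} (p : Fin n ↪ Pt d) (σ : Equiv.Perm (Fin n))
    (hσ : IsOptimalTour p σ) {i j : Fin n} (hij : i ≠ j) :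
    dist (p (σ i)) (p (σ (finRotate n i))) + dist (p (σ j)) (p (σ (finRotate n j))) ≤
      dist (p (σ i)) (p (σ j)) + dist (p (σ (finRotate n i))) (p (σ (finRotate n j))) := by
  rcases lt_or_gt_of_ne hij with h | h
  · exact two_opt_of_lt p σ hσ h
  · have := two_opt_of_lt p σ hσ h
    rw [dist_comm (p (σ j)) (p (σ i)), dist_comm (p (σ (finRotate n j)))] at this
    linarith

/-- The condition satisfied by the edges of an optimal tour. -/
def Uncrossed {X ι : Type*} [PseudoMetricSpace X] (a b : ι → X) : Prop :=
  ∀ i j, i ≠ j → dist (a i) (b i) + dist (a j) (b j) ≤ dist (a i) (a j) + dist (b i) (b j)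

/-- With `v = b - a` and `v' = b' - a'` the hypothesis becomes `‖v - v'‖ ≥ ‖v‖ + ‖v'‖ - l / 8`: the
vectors are nearly opposite. After squaring, the error is at most `(l / 4) (‖v‖ + ‖v'‖) ≤ ‖v‖ ‖v'‖ /
2`, which leaves the constant `3 / 4`. -/
theorem inner_le_of_uncrossed {V : Type*} [NormedAddCommGroup V] [InnerProductSpace ℝ V]
    {a b a' b' : V} {l : ℝ} (hl : 0 < l) (h1 : l ≤ ‖b - a‖) (h2 : l ≤ ‖b' - a'‖)
    (h : dist a b + dist a' b' ≤ dist a a' + dist b b') (ha : dist a a' ≤ l / 16) :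
    inner ℝ (b - a) (b' - a') ≤ -(3 / 4) * (‖b - a‖ * ‖b' - a'‖) := by
  rw [dist_comm a b, dist_comm a' b', dist_eq_norm b a, dist_eq_norm b' a', dist_eq_norm b b'] at h
  have e : b - b' = ((b - a) - (b' - a')) + (a - a') := by abel
  have h3 : ‖b - b'‖ ≤ ‖(b - a) - (b' - a')‖ + dist a a' := by
    rw [e, dist_eq_norm]; exact norm_add_le _ _
  set v := b - a
  set v' := b' - a'
  have h4 : ‖v‖ + ‖v'‖ - l / 8 ≤ ‖v - v'‖ := by linarith
  have h5 := norm_sub_sq_real v v'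
  have h6 : (‖v‖ + ‖v'‖ - l / 8) ^ 2 ≤ ‖v - v'‖ ^ 2 :=
    pow_le_pow_left₀ (by linarith) h4 2
  nlinarith [mul_nonneg (sub_nonneg.2 h1) (sub_nonneg.2 h2),
    mul_nonneg (sub_nonneg.2 h1) (by linarith : (0 : ℝ) ≤ ‖v'‖),
    mul_nonneg (sub_nonneg.2 h2) (by linarith : (0 : ℝ) ≤ ‖v‖)]

/-- The sum of the three normalised vectors would have squared norm at most `3 - 6 * (3 / 4) < 0`.
-/
theorem not_three_obtuse {V : Type*} [NormedAddCommGroup V] [InnerProductSpace ℝ V] {x y z : V}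
    (hx : 0 < ‖x‖) (hy : 0 < ‖y‖) (hz : 0 < ‖z‖)
    (hxy : inner ℝ x y ≤ -(3 / 4) * (‖x‖ * ‖y‖)) (hxz : inner ℝ x z ≤ -(3 / 4) * (‖x‖ * ‖z‖))
    (hyz : inner ℝ y z ≤ -(3 / 4) * (‖y‖ * ‖z‖)) : False := by
  have unit : ∀ v : V, 0 < ‖v‖ → ‖‖v‖⁻¹ • v‖ = 1 := fun v hv => by
    rw [norm_smul, norm_inv, norm_norm, inv_mul_cancel₀ hv.ne']
  have prod : ∀ v w : V, 0 < ‖v‖ → 0 < ‖w‖ → inner ℝ v w ≤ -(3 / 4) * (‖v‖ * ‖w‖) →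
      inner ℝ (‖v‖⁻¹ • v) (‖w‖⁻¹ • w) ≤ -(3 / 4) := fun v w hv hw h => by
    rw [real_inner_smul_left, real_inner_smul_right]
    have := mul_le_mul_of_nonneg_left h (by positivity : 0 ≤ ‖v‖⁻¹ * ‖w‖⁻¹)
    calc _ = ‖v‖⁻¹ * ‖w‖⁻¹ * inner ℝ v w := by ring
      _ ≤ _ := this
      _ = _ := by field_simp
  have h1 := prod x y hx hy hxy
  have h2 := prod x z hx hz hxz
  have h3 := prod y z hy hz hyz
  have u1 := unit x hx
  have u2 := unit y hy
  have u3 := unit z hz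
  set u := ‖x‖⁻¹ • x
  set v := ‖y‖⁻¹ • y
  set w := ‖z‖⁻¹ • z
  have e1 := norm_add_sq_real (u + v) w
  have e2 := norm_add_sq_real u v
  rw [inner_add_left, e2, u1, u2, u3] at e1
  nlinarith [sq_nonneg ‖u + v + w‖]

theorem card_star_le {V ι : Type*} [NormedAddCommGroup V] [InnerProductSpace ℝ V] {a b : ι → V}
    (hab : Uncrossed a b) {l : ℝ} (hl : 0 < l) (E : Finset ι)
    (hE : ∀ e ∈ E, l ≤ dist (a e) (b e)) (ha : ∀ e ∈ E, ∀ e' ∈ E, dist (a e) (a e') ≤ l / 16) :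
    E.card ≤ 2 := by
  by_contra hcon
  obtain ⟨i, hi, j, hj, k, hk, hij, hik, hjk⟩ := Finset.two_lt_card.1 (not_le.1 hcon)
  have len : ∀ e ∈ E, l ≤ ‖b e - a e‖ := fun e he => by
    rw [← dist_eq_norm, dist_comm]; exact hE e he
  exact not_three_obtuse (hl.trans_le (len i hi)) (hl.trans_le (len j hj)) (hl.trans_le (len k hk))
    (inner_le_of_uncrossed hl (len i hi) (len j hj) (hab i j hij) (ha i hi j hj))
    (inner_le_of_uncrossed hl (len i hi) (len k hk) (hab i k hik) (ha i hi k hk))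
    (inner_le_of_uncrossed hl (len j hj) (len k hk) (hab j k hjk) (ha j hj k hk))

/-! ### Nets -/

/-- A packing of maximal cardinality is a covering, since an uncovered point could be added to it.
-/
theorem exists_isNet {d : ℕ} (P : Finset (Pt d)) {ε : ℝ} (hε : 0 < ε) : ∃ N, IsNet ε P N := by
  classical
  have hne : (P.powerset.filter fun N => ∀ x ∈ N, ∀ y ∈ N, x ≠ y → ε ≤ dist x y).Nonempty :=
    ⟨∅, by simp⟩
  obtain ⟨N, hN, hmax⟩ := Finset.exists_max_image _ Finset.card hne
  simp only [Finset.mem_filter, Finset.mem_powerset] at hN hmax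
  refine ⟨N, hN.1, fun x hx => ?_, hN.2⟩
  by_contra! hcon
  have hxN : x ∉ N := fun h => by
    have := hcon x h
    rw [dist_self] at this
    linarith
  have := hmax (insert x N) ⟨Finset.insert_subset hx hN.1, ?_⟩
  · rw [Finset.card_insert_of_notMem hxN] at this; omega
  · intro y hy z hz hyz
    rcases Finset.mem_insert.1 hy with hy' | hy'
    · rcases Finset.mem_insert.1 hz with hz' | hz'
      · exact absurd (hy'.trans hz'.symm) hyz
      · rw [hy']; exact (hcon z hz').le
    · rcases Finset.mem_insert.1 hz with hz' | hz'
      · rw [hz', dist_comm]; exact (hcon y hy').le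
      · exact hN.2 y hy' z hz' hyz

/-- The growth condition for a single point set. -/
def HasGrowth {d : ℕ} (P : Finset (Pt d)) (C s : ℝ) : Prop :=
  ∀ ε r : ℝ, 0 < ε → 2 * ε ≤ r → ∀ N : Finset (Pt d), IsNet ε P N →
    ∀ x : Pt d, (((N : Set (Pt d)) ∩ Metric.closedBall x r).ncard : ℝ) ≤ C * (r / ε) ^ s

/-- If the points of `E` map to points of `P` in a ball of radius `ρ`, and all those that map
close to one point are at most `k` in number, then `E` is small. -/
theorem card_le_of_growth {d : ℕ} {ι : Type*} {P : Finset (Pt d)} {C s : ℝ} (hP : HasGrowth P C s)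
    (a : ι → Pt d) (E : Finset ι) (haP : ∀ e ∈ E, a e ∈ P) {x : Pt d} {ε ρ : ℝ} (hε : 0 < ε)
    (hερ : ε ≤ ρ) (hx : ∀ e ∈ E, dist (a e) x ≤ ρ) (k : ℕ)
    (hk : ∀ y, (∀ E' ⊆ E, (∀ e ∈ E', dist (a e) y ≤ ε) → E'.card ≤ k)) :
    (E.card : ℝ) ≤ k * (C * ((ρ + ε) / ε) ^ s) := by
  classical
  obtain ⟨N, hN⟩ := exists_isNet P hε
  have hcov : ∀ e, ∃ y, e ∈ E → y ∈ N ∧ dist (a e) y ≤ ε := by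
    intro e
    by_cases he : e ∈ E
    · obtain ⟨y, hy, hy'⟩ := hN.covering _ (haP e he)
      exact ⟨y, fun _ => ⟨hy, hy'⟩⟩
    · exact ⟨a e, fun h => absurd h he⟩
  choose g hg using hcov
  have hfin : ((N : Set (Pt d)) ∩ Metric.closedBall x (ρ + ε)).Finite :=
    N.finite_toSet.subset Set.inter_subset_left
  have h1 : E.card ≤ k * hfin.toFinset.card := by
    refine Finset.card_le_mul_card_image_of_maps_to (f := g) (fun e he => ?_) k fun y _ => ?_
    · simp only [Set.Finite.mem_toFinset, Set.mem_inter_iff, Finset.mem_coe,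
        Metric.mem_closedBall]
      refine ⟨(hg e he).1, ?_⟩
      have := dist_triangle_left (g e) x (a e)
      linarith [(hg e he).2, hx e he]
    · refine hk y _ (Finset.filter_subset _ _) fun e he => ?_
      rw [Finset.mem_filter] at he
      rw [← he.2]
      exact (hg e he.1).2
  have h2 := hP ε (ρ + ε) hε (by linarith) N hN x
  rw [Set.ncard_eq_toFinset_card _ hfin] at h2
  calc (E.card : ℝ) ≤ k * (hfin.toFinset.card : ℝ) := by exact_mod_cast h1
    _ ≤ _ := mul_le_mul_of_nonneg_left h2 (by positivity)

/-- There are few long edges in a ball. -/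
theorem card_long_edges_le {d : ℕ} {ι : Type*} {P : Finset (Pt d)} {C s : ℝ}
    (hP : HasGrowth P C s) (hC : 0 ≤ C) (hs : 0 ≤ s) {a b : ι → Pt d} (hab : Uncrossed a b)
    (E : Finset ι) (haP : ∀ e ∈ E, a e ∈ P) {x : Pt d} {l r : ℝ} (hl : 0 < l) (hlr : l ≤ r)
    (hx : ∀ e ∈ E, dist (a e) x ≤ 2 * r) (hE : ∀ e ∈ E, l ≤ dist (a e) (b e)) :
    (E.card : ℝ) ≤ 2 * C * (96 * (r / l)) ^ s := by
  -- Points within `l / 32` of a net point are within `l / 16` of each other, so each net point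
  -- accounts for at most two edges. The ratio of the radii is at most `65 r / l`; the constant `96`
  -- leaves room.
  have h := card_le_of_growth hP a E haP (ε := l / 32) (ρ := 2 * r) (by positivity) (by linarith)
    hx 2 (fun y E' hE' h' => card_star_le hab hl E' (fun e he => hE e (hE' he))
      fun e he e' he' => by
        have := dist_triangle_right (a e) (a e') y
        linarith [h' e he, h' e' he'])
  refine h.trans ?_
  have hle : (2 * r + l / 32) / (l / 32) ≤ 96 * (r / l) := by
    rw [div_le_iff₀ (by positivity)]
    field_simp
    linarith
  have hr : 0 < r := hl.trans_le hlr
  rw [Nat.cast_ofNat, mul_assoc]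
  gcongr

/-! ### Separators -/

/-- If `r / 2 ^ i` is the largest scale not exceeding `l`, then it and the smaller scales, together
with the extra `r / 2 ^ I`, sum to twice `r / 2 ^ i`, which is at least `min l r`. If there is none,
the extra term suffices. The sum turns lengths into numbers of long edges, one for each scale. -/
theorem min_le_dyadic_sum (l r : ℝ) (hr : 0 < r) (I : ℕ) :
    min l r ≤ r / 2 ^ I + ∑ i ∈ Finset.range (I + 1), if r / 2 ^ i ≤ l then r / 2 ^ i else 0 := by
  induction I with
  | zero => simp; right; split_ifs <;> linarith
  | succ I ih =>
    have e : r / 2 ^ (I + 1) = r / 2 ^ I / 2 := by rw [pow_succ, div_mul_eq_div_div]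
    have hpos : 0 < r / 2 ^ I := by positivity
    rw [Finset.sum_range_succ]
    by_cases h : r / 2 ^ (I + 1) ≤ l
    · rw [if_pos h]; linarith
    · rw [if_neg h]
      push Not at h
      have h2 : 0 ≤ ∑ i ∈ Finset.range (I + 1), if r / 2 ^ i ≤ l then r / 2 ^ i else 0 :=
        Finset.sum_nonneg fun i _ => by split_ifs <;> positivity
      have := min_le_left l r
      linarith

/-- The index `e` is counted at the radius `t` for `t` in `[l e, u e)`, which meets `[r, 2 r]` in
measure at most `c e`. Some radius does no worse than the average over `[r, 2 r]`. -/
theorem exists_radius {ι : Type*} (E : Finset ι) (l u c : ι → ℝ) {r : ℝ} (hr : 0 < r)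
    (hc : ∀ e ∈ E, min (u e - l e) r ≤ c e) (hc0 : ∀ e ∈ E, 0 ≤ c e) :
    ∃ t ∈ Set.Icc r (2 * r), ((E.filter fun e => l e ≤ t ∧ t < u e).card : ℝ) * r ≤
      ∑ e ∈ E, c e := by
  classical
  let f : ℝ → ℝ := fun t => ∑ e ∈ E, (Set.Ico (l e) (u e)).indicator (fun _ => (1 : ℝ)) t
  have hvol : MeasureTheory.volume.real (Set.Icc r (2 * r)) = r := by
    rw [Real.volume_real_Icc_of_le (by linarith)]; ring
  have hint : ∀ e ∈ E, MeasureTheory.IntegrableOn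
      (fun t => (Set.Ico (l e) (u e)).indicator (fun _ => (1 : ℝ)) t) (Set.Icc r (2 * r)) := by
    intro e _
    refine MeasureTheory.Integrable.indicator ?_ measurableSet_Ico
    exact MeasureTheory.integrableOn_const (by simp)
  obtain ⟨t, ht, hft⟩ := MeasureTheory.exists_le_setAverage (μ := MeasureTheory.volume)
    (s := Set.Icc r (2 * r)) (f := f) (by simp [hr]) (by simp)
    (MeasureTheory.integrable_finsetSum _ hint)
  refine ⟨t, ht, ?_⟩
  have hcard : ((E.filter fun e => l e ≤ t ∧ t < u e).card : ℝ) = f t := by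
    simp only [f, Set.indicator_apply, Set.mem_Ico, Finset.sum_boole]
  rw [hcard]
  rw [MeasureTheory.setAverage_eq, hvol, smul_eq_mul, inv_mul_eq_div, le_div_iff₀ hr] at hft
  refine hft.trans ?_
  rw [MeasureTheory.integral_finsetSum _ hint]
  refine Finset.sum_le_sum fun e he => ?_
  rw [MeasureTheory.setIntegral_indicator measurableSet_Ico]
  simp only [MeasureTheory.integral_const, MeasurableSet.univ,
    MeasureTheory.measureReal_restrict_apply,
    Set.univ_inter, smul_eq_mul, mul_one]
  refine le_trans ?_ (max_le (hc e he) (hc0 e he))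
  rcases le_total (u e) (l e) with h | h
  · rw [Set.Ico_eq_empty (not_lt.2 h)]
    simp
  · refine le_max_of_le_left (le_min ?_ ?_)
    · rw [← Real.volume_real_Ico_of_le h]
      exact MeasureTheory.measureReal_mono Set.inter_subset_right (by simp)
    · exact (MeasureTheory.measureReal_mono Set.inter_subset_left (by simp)).trans_eq hvol

/-- The indices of the points of the ball around `p x` through `p y`. -/
noncomputable def ballThrough {d n : ℕ} (p : Fin n ↪ Pt d) (x y : Fin n) : Finset (Fin n) :=
  {z | dist (p x) (p z) ≤ dist (p x) (p y)}

theorem mem_ballThrough {d n : ℕ} {p : Fin n ↪ Pt d} {x y z : Fin n} :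
    z ∈ ballThrough p x y ↔ dist (p x) (p z) ≤ dist (p x) (p y) := by
  simp [ballThrough]

/-- Rules name a ball by its centre and a point on its boundary. Shrinking the radius to the
farthest point still inside does not change which points are inside. -/
theorem exists_ballThrough_eq {d n : ℕ} (p : Fin n ↪ Pt d) (x : Fin n) {t : ℝ} (ht : 0 ≤ t) :
    ∃ y, dist (p x) (p y) ≤ t ∧ ∀ z, z ∈ ballThrough p x y ↔ dist (p x) (p z) ≤ t := by
  obtain ⟨y, hy, hmax⟩ := Finset.exists_max_image
    (Finset.univ.filter fun z => dist (p x) (p z) ≤ t) (fun z => dist (p x) (p z))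
    ⟨x, by simpa using ht⟩
  simp only [Finset.mem_filter, Finset.mem_univ, true_and] at hy hmax
  exact ⟨y, hy, fun z => mem_ballThrough.trans ⟨fun h => h.trans hy, hmax z⟩⟩

/-- A ball of minimal radius that contains at least the fraction `1 / (k + 1)` of the points. -/
theorem exists_minimal_ball {d n : ℕ} (p : Fin n ↪ Pt d) (k : ℕ) (Q : Finset (Fin n))
    (hQ : k + 1 < Q.card) : ∃ x, ∃ r : ℝ, 0 < r ∧
      Q.card ≤ (Q.filter fun z => dist (p x) (p z) ≤ r).card * (k + 1) ∧
      ∀ z ∈ Q, ∀ t < r, (Q.filter fun z' => dist (p z) (p z') ≤ t).card * (k + 1) < Q.card := by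
  classical
  obtain ⟨q, hq⟩ : Q.Nonempty := Finset.card_pos.1 (by omega)
  -- Finitely many candidates suffice, with distances between points as radii: a ball of any other
  -- radius shrinks to a candidate without losing points.
  let S := (Q ×ˢ (Finset.univ : Finset (Fin n))).filter fun xy =>
    Q.card ≤ (Q.filter fun z => dist (p xy.1) (p z) ≤ dist (p xy.1) (p xy.2)).card * (k + 1)
  have hS : S.Nonempty := by
    obtain ⟨y, -, hy⟩ := Finset.exists_max_image Q (fun z => dist (p q) (p z)) ⟨q, hq⟩
    refine ⟨(q, y), ?_⟩
    simp only [S, Finset.mem_filter, Finset.mem_product, Finset.mem_univ, and_true]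
    refine ⟨hq, ?_⟩
    rw [Finset.filter_true_of_mem hy]
    exact Nat.le_mul_of_pos_right _ (by omega)
  obtain ⟨⟨x, y⟩, hxy, hmin⟩ := Finset.exists_min_image S (fun xy => dist (p xy.1) (p xy.2)) hS
  simp only [S, Finset.mem_filter, Finset.mem_product, Finset.mem_univ, and_true] at hxy hmin
  refine ⟨x, dist (p x) (p y), ?_, hxy.2, ?_⟩
  · rw [dist_pos]
    intro h
    have h1 : (Q.filter fun z => dist (p x) (p z) ≤ dist (p x) (p y)).card ≤ 1 := by
      refine Finset.card_le_one.2 fun a ha b hb => ?_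
      rw [Finset.mem_filter, h, dist_self, dist_le_zero] at ha hb
      exact p.injective (ha.2.symm.trans hb.2)
    have h2 : Q.card ≤ 1 * (k + 1) := hxy.2.trans (Nat.mul_le_mul_right (k + 1) h1)
    omega
  · intro z hz t ht
    by_contra! hcon
    have ht0 : 0 ≤ t := by
      by_contra! h
      rw [Finset.filter_false_of_mem fun z' _ => not_le.2 (h.trans_le dist_nonneg)] at hcon
      rw [Finset.card_empty, zero_mul] at hcon
      omega
    obtain ⟨y', hy', hb⟩ := exists_ballThrough_eq p z ht0
    have := hmin (z, y') ⟨hz, by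
      simp only [← mem_ballThrough, hb]; exact hcon⟩
    simp only at this
    linarith

/-- A net ball of radius `r / 3` that contains a point `z` of `Q` lies within distance `2 r / 3 < r`
of `z`, so by minimality it holds less than the fraction `1 / (k + 1)` of `Q`. At most `C * 9 ^ s ≤
k` of these cover the part of `Q` at distance at most `2 r`. Every radius in `[r, 2 r]` is thus
balanced, and averaging finds one that cuts few edges. -/
theorem exists_separator {d n : ℕ} (p : Fin n ↪ Pt d) (σ : Equiv.Perm (Fin n))
    (hσ : IsOptimalTour p σ) {C s : ℝ} (hP : HasGrowth (Finset.univ.map p) C s) (hC : 0 ≤ C)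
    (hs : 0 ≤ s) (k : ℕ) (hk : C * 9 ^ s ≤ k) (Q : Finset (Fin n)) (hQ : k + 1 < Q.card) (I : ℕ) :
    ∃ x y, (Q ∩ ballThrough p x y).card * (k + 1) ≤ k * Q.card ∧
      (Q \ ballThrough p x y).card * (k + 1) ≤ k * Q.card ∧
      ((cutEdges σ Q (ballThrough p x y)).card : ℝ) ≤ 2 * (Q.card / 2 ^ I +
        2 * C * ∑ i ∈ Finset.range (I + 1), (96 * 2 ^ i : ℝ) ^ s / 2 ^ i) := by
  classical
  obtain ⟨x, r, hr, hge, hmin⟩ := exists_minimal_ball p k Q hQ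
  have hmap : ∀ z, p z ∈ Finset.univ.map p := fun z => Finset.mem_map_of_mem _ (Finset.mem_univ z)
  set a : Fin n → Pt d := fun e => p (σ e) with ha
  set b : Fin n → Pt d := fun e => p (σ (finRotate n e)) with hb
  have hab : Uncrossed a b := fun i j hij => two_opt p σ hσ hij
  have hba : Uncrossed b a := fun i j hij => by
    have := hab i j hij
    rw [dist_comm (b i), dist_comm (b j)]; linarith
  -- the ball of twice the radius does not contain too many points
  have hle : (Q.filter fun z => dist (p x) (p z) ≤ 2 * r).card * (k + 1) ≤ k * Q.card := by
    have h1 := card_le_of_growth hP p (Q.filter fun z => dist (p x) (p z) ≤ 2 * r)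
      (fun e _ => hmap e) (x := p x) (ε := r / 3) (ρ := 2 * r + 2 * (r / 3) - r / 3)
      (by positivity) (by linarith) (fun e he => by
        rw [dist_comm]
        linarith [(Finset.mem_filter.1 he).2]) (Q.card / (k + 1)) (fun y E' hE' h' => by
        rcases E'.eq_empty_or_nonempty with rfl | ⟨z, hz⟩
        · simp
        · rw [Nat.le_div_iff_mul_le (by omega)]
          have hzQ := (Finset.mem_filter.1 (hE' hz)).1
          refine le_trans (Nat.mul_le_mul_right _ (Finset.card_le_card fun z' hz' => ?_))
            (hmin z hzQ (2 * (r / 3)) (by linarith)).le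
          rw [Finset.mem_filter]
          refine ⟨(Finset.mem_filter.1 (hE' hz')).1, ?_⟩
          have := dist_triangle_right (p z) (p z') y
          linarith [h' z hz, h' z' hz'])
    have h2 : C * ((2 * r + 2 * (r / 3) - r / 3 + r / 3) / (r / 3)) ^ s ≤ k := by
      refine le_trans ?_ hk
      have : (2 * r + 2 * (r / 3) - r / 3 + r / 3) / (r / 3) ≤ 9 := by
        rw [div_le_iff₀ (by positivity)]; linarith
      have h0 : 0 ≤ (2 * r + 2 * (r / 3) - r / 3 + r / 3) / (r / 3) := by
        apply div_nonneg <;> linarith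
      exact mul_le_mul_of_nonneg_left (Real.rpow_le_rpow h0 this hs) hC
    have h3 : (Q.filter fun z => dist (p x) (p z) ≤ 2 * r).card ≤ Q.card / (k + 1) * k := by
      have := h1.trans (mul_le_mul_of_nonneg_left h2 (by positivity))
      exact_mod_cast this
    calc _ ≤ Q.card / (k + 1) * k * (k + 1) := Nat.mul_le_mul_right _ h3
      _ = k * (Q.card / (k + 1) * (k + 1)) := by ring
      _ ≤ _ := Nat.mul_le_mul_left _ (Nat.div_mul_le_self _ _)
  -- choice of the radius
  set X : ℝ := Q.card / 2 ^ I + 2 * C * ∑ i ∈ Finset.range (I + 1), (96 * 2 ^ i : ℝ) ^ s / 2 ^ i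
    with hX
  -- The truncated lengths are summed scale by scale, with the packing bound for the edges that are
  -- long at each scale; the term `r / 2 ^ I` is charged to every edge. Both orientations are
  -- needed, since either end of a cut edge may be the one inside.
  have weight : ∀ (u v : Fin n → Pt d), Uncrossed u v → (∀ e, u e ∈ Finset.univ.map p) →
      ∀ E : Finset (Fin n), E.card ≤ Q.card → (∀ e ∈ E, dist (u e) (p x) ≤ 2 * r) →
      ∑ e ∈ E, min (dist (u e) (v e)) r ≤ r * X := by
    intro u v huv hu E hEQ hE
    calc ∑ e ∈ E, min (dist (u e) (v e)) r
        ≤ ∑ e ∈ E, (r / 2 ^ I + ∑ i ∈ Finset.range (I + 1),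
          if r / 2 ^ i ≤ dist (u e) (v e) then r / 2 ^ i else 0) :=
          Finset.sum_le_sum fun e _ => min_le_dyadic_sum _ _ hr I
      _ = E.card * (r / 2 ^ I) + ∑ i ∈ Finset.range (I + 1),
          (E.filter fun e => r / 2 ^ i ≤ dist (u e) (v e)).card * (r / 2 ^ i) := by
          rw [Finset.sum_add_distrib, Finset.sum_const, nsmul_eq_mul, Finset.sum_comm]
          congr 1
          refine Finset.sum_congr rfl fun i _ => ?_
          rw [← Finset.sum_filter, Finset.sum_const, nsmul_eq_mul]
      _ ≤ Q.card * (r / 2 ^ I) + ∑ i ∈ Finset.range (I + 1),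
          2 * C * (96 * 2 ^ i) ^ s * (r / 2 ^ i) := by
          gcongr with i _
          have h := card_long_edges_le hP hC hs huv
            (E.filter fun e => r / 2 ^ i ≤ dist (u e) (v e)) (fun e _ => hu e) (x := p x)
            (l := r / 2 ^ i) (r := r) (by positivity)
            (div_le_self hr.le (one_le_pow₀ (by norm_num)))
            (fun e he => hE e (Finset.mem_filter.1 he).1) fun e he => (Finset.mem_filter.1 he).2
          rwa [div_div_cancel₀ hr.ne'] at h
      _ = r * X := by
          rw [hX, mul_add, Finset.mul_sum, Finset.mul_sum]
          congr 1
          · ring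
          · exact Finset.sum_congr rfl fun i _ => by ring
  let E₀ : Finset (Fin n) := {e | σ e ∈ Q ∧ σ (finRotate n e) ∈ Q}
  have hE₀ : E₀.card ≤ Q.card :=
    Finset.card_le_card_of_injOn σ (fun e he => (Finset.mem_filter.1 he).2.1) σ.injective.injOn
  let E : Finset (Fin n) := E₀.filter fun e => dist (a e) (p x) ≤ 2 * r ∨ dist (b e) (p x) ≤ 2 * r
  obtain ⟨t, ht, hcard⟩ := exists_radius E (fun e => min (dist (p x) (a e)) (dist (p x) (b e)))
    (fun e => max (dist (p x) (a e)) (dist (p x) (b e))) (fun e => min (dist (a e) (b e)) r) hr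
    (fun e _ => by
      refine min_le_min_right _ ?_
      rw [max_sub_min_eq_abs, abs_sub_comm, dist_comm (p x) (a e), dist_comm (p x) (b e)]
      exact abs_dist_sub_le _ _ _)
    (fun e _ => le_min dist_nonneg hr.le)
  obtain ⟨y, -, hy⟩ := exists_ballThrough_eq p x (hr.le.trans ht.1)
  have hin : Q ∩ ballThrough p x y = Q.filter fun z => dist (p x) (p z) ≤ t := by
    ext z; rw [Finset.mem_inter, Finset.mem_filter, hy]
  have hge' : Q.card ≤ (Q ∩ ballThrough p x y).card * (k + 1) := by
    refine hge.trans (Nat.mul_le_mul_right _ (Finset.card_le_card fun z hz => ?_))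
    rw [hin]
    rw [Finset.mem_filter] at hz ⊢
    exact ⟨hz.1, hz.2.trans ht.1⟩
  refine ⟨x, y, ?_, ?_, ?_⟩
  · refine le_trans (Nat.mul_le_mul_right _ (Finset.card_le_card fun z hz => ?_)) hle
    rw [hin] at hz
    rw [Finset.mem_filter] at hz ⊢
    exact ⟨hz.1, hz.2.trans ht.2⟩
  · have h1 := Finset.card_sdiff_add_card_inter Q (ballThrough p x y)
    have h2 : (Q \ ballThrough p x y).card * (k + 1) + (Q ∩ ballThrough p x y).card * (k + 1) =
        k * Q.card + Q.card := by rw [← add_mul, h1]; ring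
    omega
  · have hsub : cutEdges σ Q (ballThrough p x y) ⊆ E.filter fun e =>
        min (dist (p x) (a e)) (dist (p x) (b e)) ≤ t ∧
          t < max (dist (p x) (a e)) (dist (p x) (b e)) := by
      intro e he
      simp only [cutEdges, Finset.mem_filter, Finset.mem_univ, true_and, hy] at he
      simp only [E, E₀, Finset.mem_filter, Finset.mem_univ, true_and, min_le_iff, lt_max_iff]
      obtain ⟨h1, h2, h3⟩ := he
      rw [dist_comm (a e), dist_comm (b e)]
      simp only [ha, hb] at *
      by_cases h4 : dist (p x) (p (σ e)) ≤ t
      · have h5 : ¬ dist (p x) (p (σ (finRotate n e))) ≤ t := fun h => h3 ⟨fun _ => h, fun _ => h4⟩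
        exact ⟨⟨⟨h1, h2⟩, Or.inl (h4.trans ht.2)⟩, Or.inl h4, Or.inr (not_le.1 h5)⟩
      · have h5 : dist (p x) (p (σ (finRotate n e))) ≤ t := by
          by_contra h5
          exact h3 ⟨fun h => absurd h h4, fun h => absurd h h5⟩
        exact ⟨⟨⟨h1, h2⟩, Or.inr (h5.trans ht.2)⟩, Or.inr h5, Or.inl (not_le.1 h4)⟩
    have hsum : ∑ e ∈ E, min (dist (a e) (b e)) r ≤ r * X + r * X := by
      have hE : E = (E₀.filter fun e => dist (a e) (p x) ≤ 2 * r) ∪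
          (E₀.filter fun e => dist (b e) (p x) ≤ 2 * r) := Finset.filter_or _ _ _
      have h0 : ∀ e, 0 ≤ min (dist (a e) (b e)) r := fun e => le_min dist_nonneg hr.le
      have h1 := weight a b hab (fun e => hmap _) (E₀.filter fun e => dist (a e) (p x) ≤ 2 * r)
        ((Finset.card_filter_le _ _).trans hE₀) (fun e he => (Finset.mem_filter.1 he).2)
      have h2 := weight b a hba (fun e => hmap _) (E₀.filter fun e => dist (b e) (p x) ≤ 2 * r)
        ((Finset.card_filter_le _ _).trans hE₀) (fun e he => (Finset.mem_filter.1 he).2)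
      simp only [dist_comm (b _) (a _)] at h2
      have h3 := Finset.sum_union_inter (s₁ := E₀.filter fun e => dist (a e) (p x) ≤ 2 * r)
        (s₂ := E₀.filter fun e => dist (b e) (p x) ≤ 2 * r)
        (f := fun e => min (dist (a e) (b e)) r)
      rw [← hE] at h3
      have h4 : 0 ≤ ∑ e ∈ (E₀.filter fun e => dist (a e) (p x) ≤ 2 * r) ∩
        (E₀.filter fun e => dist (b e) (p x) ≤ 2 * r), min (dist (a e) (b e)) r :=
        Finset.sum_nonneg fun e _ => h0 e
      linarith
    have h1 : ((cutEdges σ Q (ballThrough p x y)).card : ℝ) * r ≤ (2 * X) * r := by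
      refine le_trans ?_ ((hcard.trans hsum).trans_eq (by ring))
      gcongr
    exact le_of_mul_le_mul_right h1 hr

/-! ### Arrangements from recursive separation. -/

theorem acceptsList_concat (D : ℕ → ℕ → ℝ) (R : List Rule) (ρ : Rule) (z : ℕ) :
    acceptsList D (R ++ [ρ]) z = ruleStep D ρ.1 ρ.2.1 ρ.2.2 z (acceptsList D R z) := by
  simp [acceptsList]

theorem mem_cutEdges {n : ℕ} {σ : Equiv.Perm (Fin n)} {Q S : Finset (Fin n)} {e : Fin n} :
    e ∈ cutEdges σ Q S ↔ σ e ∈ Q ∧ σ (finRotate n e) ∈ Q ∧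
      ¬ (σ e ∈ S ↔ σ (finRotate n e) ∈ S) := by
  simp [cutEdges]

theorem card_cutEdges_le {n : ℕ} (σ : Equiv.Perm (Fin n)) (Q S : Finset (Fin n)) :
    (cutEdges σ Q S).card ≤ Q.card :=
  Finset.card_le_card_of_injOn σ (fun _ he => (mem_cutEdges.1 he).1) σ.injective.injOn

/-- In the applications `B` is a ball: an edge not cut by `B` lies on one side of it, and a segment
`S` of the glued ordering can cut it only on the side `Q'`, where `S` appears as a segment `S'`. -/
theorem card_cutEdges_le_add {n : ℕ} (σ : Equiv.Perm (Fin n)) {Q S B Q' S' : Finset (Fin n)}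
    (h : ∀ a ∈ Q, ∀ b ∈ Q, (a ∈ B ↔ b ∈ B) → ¬ (a ∈ S ↔ b ∈ S) →
      a ∈ Q' ∧ b ∈ Q' ∧ ¬ (a ∈ S' ↔ b ∈ S')) :
    (cutEdges σ Q S).card ≤ (cutEdges σ Q B).card + (cutEdges σ Q' S').card := by
  refine (Finset.card_le_card fun e he => ?_).trans (Finset.card_union_le _ _)
  rw [mem_cutEdges] at he
  rw [Finset.mem_union, mem_cutEdges, mem_cutEdges]
  by_cases hB : σ e ∈ B ↔ σ (finRotate n e) ∈ B
  · exact Or.inr (h _ he.1 _ he.2.1 hB he.2.2)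
  · exact Or.inl ⟨he.1, he.2.1, hB⟩

/-- An ordering of `Q` all of whose initial segments are described by at most `L` rules and
separated from the rest of `Q` by at most `G` edges of the tour. -/
def HasArrangement {n : ℕ} (D : ℕ → ℕ → ℝ) (σ : Equiv.Perm (Fin n)) (Q : Finset (Fin n))
    (L G : ℝ) : Prop :=
  ∃ l : List (Fin n), l.Nodup ∧ l.toFinset = Q ∧
    (∀ i, ∃ R : List Rule, (R.length : ℝ) ≤ L ∧ (∀ ρ ∈ R, ρ.1 ≤ n ∧ ρ.2.1 ≤ n ∧ ρ.2.2 ≤ n) ∧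
      ∀ z ∈ Q, acceptsList D R z = if z ∈ l.take i then 1 else 0) ∧
    ∀ i, ((cutEdges σ Q (l.take i).toFinset).card : ℝ) ≤ G

/-- A ball of radius `0` contains its centre alone, so any set can be listed point by point. This is
the base of the recursion, where `Q` has bounded size. -/
theorem hasArrangement_card {d n : ℕ} (hn : 2 ≤ n) {D : ℕ → ℕ → ℝ} {p : Fin n ↪ Pt d}
    (hD : ∀ i j : Fin n, D i j = dist (p i) (p j)) (σ : Equiv.Perm (Fin n)) (Q : Finset (Fin n)) :
    HasArrangement D σ Q Q.card Q.card := by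
  refine ⟨Q.toList, Q.nodup_toList, Q.toList_toFinset, fun i => ?_, fun i => ?_⟩
  · refine ⟨(Q.toList.take i).map fun q : Fin n => (1, (q : ℕ), (q : ℕ)), ?_, ?_, fun z _ => ?_⟩
    · rw [List.length_map]
      exact_mod_cast (List.length_take_le' i Q.toList).trans_eq (Finset.length_toList Q)
    · intro ρ hρ
      obtain ⟨q, -, rfl⟩ := List.mem_map.1 hρ
      exact ⟨by simp; omega, q.2.le, q.2.le⟩
    · induction Q.toList.take i using List.reverseRecOn with
      | nil => simp [acceptsList]
      | append_singleton l q ih =>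
        rw [List.map_append, List.map_singleton, acceptsList_concat, ih, ruleStep]
        simp only [hD, dist_self, dist_le_zero, if_true, List.mem_append, List.mem_singleton,
          p.injective.eq_iff]
        rcases eq_or_ne q z with rfl | h
        · simp
        · simp [h, h.symm]
  · exact_mod_cast card_cutEdges_le σ Q _

theorem HasArrangement.mono {n : ℕ} {D : ℕ → ℕ → ℝ} {σ : Equiv.Perm (Fin n)}
    {Q : Finset (Fin n)} {L G L' G' : ℝ} (h : HasArrangement D σ Q L G) (hL : L ≤ L')
    (hG : G ≤ G') : HasArrangement D σ Q L' G' := by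
  obtain ⟨l, h1, h2, h3, h4⟩ := h
  refine ⟨l, h1, h2, fun i => ?_, fun i => (h4 i).trans hG⟩
  obtain ⟨R, h5, h6⟩ := h3 i
  exact ⟨R, h5.trans hL, h6⟩

/-- Arrangements of the parts of `Q` inside and outside of a ball yield an arrangement of `Q`. -/
theorem HasArrangement.glue {d n : ℕ} (hn : 2 ≤ n) {D : ℕ → ℕ → ℝ} {p : Fin n ↪ Pt d}
    (hD : ∀ i j : Fin n, D i j = dist (p i) (p j)) {σ : Equiv.Perm (Fin n)} {Q : Finset (Fin n)}
    {L G g : ℝ} (x y : Fin n) (h₁ : HasArrangement D σ (Q ∩ ballThrough p x y) L G)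
    (h₂ : HasArrangement D σ (Q \ ballThrough p x y) L G)
    (hg : ((cutEdges σ Q (ballThrough p x y)).card : ℝ) ≤ g) :
    HasArrangement D σ Q (1 + L) (g + G) := by
  obtain ⟨l₁, hnd₁, hl₁, hR₁, hc₁⟩ := h₁
  obtain ⟨l₂, hnd₂, hl₂, hR₂, hc₂⟩ := h₂
  have hm₁ : ∀ z, z ∈ l₁ ↔ z ∈ Q ∧ z ∈ ballThrough p x y := fun z => by
    rw [← List.mem_toFinset, hl₁, Finset.mem_inter]
  have hm₂ : ∀ z, z ∈ l₂ ↔ z ∈ Q ∧ z ∉ ballThrough p x y := fun z => by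
    rw [← List.mem_toFinset, hl₂, Finset.mem_sdiff]
  have hrule : ∀ f r, ∀ z : Fin n, ruleStep D f x y z r =
      if f = 1 then (if z ∈ ballThrough p x y then 1 else r)
      else if f = 2 then (if z ∈ ballThrough p x y then r else 0) else r := by
    intro f r z
    simp only [ruleStep, hD, mem_ballThrough]
  refine ⟨l₁ ++ l₂, ?_, ?_, fun i => ?_, fun i => ?_⟩
  · refine List.nodup_append'.2 ⟨hnd₁, hnd₂, fun z h h' => ?_⟩
    exact ((hm₂ z).1 h').2 ((hm₁ z).1 h).2
  · rw [List.toFinset_append, hl₁, hl₂, Finset.union_comm, Finset.sdiff_union_inter]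
  -- The rules of a part are reliable on that part only, and one rule added at the end settles the
  -- rest: for a short segment it rejects all points outside of the ball, for a long one it accepts
  -- all points inside.
  · rcases le_or_gt i l₁.length with hi | hi
    · obtain ⟨R, h1, h2, h3⟩ := hR₁ i
      refine ⟨R ++ [(2, (x : ℕ), (y : ℕ))], ?_, ?_, fun z hz => ?_⟩
      · simp only [List.length_append, List.length_singleton]; push_cast; linarith
      · simp only [List.mem_append, List.mem_singleton]
        rintro ρ (h | rfl)
        · exact h2 ρ h
        · exact ⟨hn, x.2.le, y.2.le⟩
      · rw [acceptsList_concat, hrule, List.take_append_of_le_length hi]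
        by_cases hB : z ∈ ballThrough p x y
        · simp [hB, h3 z (Finset.mem_inter.2 ⟨hz, hB⟩)]
        · have : z ∉ l₁.take i := fun h => hB ((hm₁ z).1 (List.mem_of_mem_take h)).2
          simp [hB, this]
    · obtain ⟨R, h1, h2, h3⟩ := hR₂ (i - l₁.length)
      refine ⟨R ++ [(1, (x : ℕ), (y : ℕ))], ?_, ?_, fun z hz => ?_⟩
      · simp only [List.length_append, List.length_singleton]; push_cast; linarith
      · simp only [List.mem_append, List.mem_singleton]
        rintro ρ (h | rfl)
        · exact h2 ρ h
        · exact ⟨by simp; omega, x.2.le, y.2.le⟩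
      · rw [acceptsList_concat, hrule, List.take_append, List.take_of_length_le hi.le]
        by_cases hB : z ∈ ballThrough p x y
        · simp [hB, (hm₁ z).2 ⟨hz, hB⟩]
        · have : z ∉ l₁ := fun h => hB ((hm₁ z).1 h).2
          simp [hB, this, h3 z (Finset.mem_sdiff.2 ⟨hz, hB⟩)]
  · rcases le_or_gt i l₁.length with hi | hi
    · have := card_cutEdges_le_add σ (Q := Q) (S := ((l₁ ++ l₂).take i).toFinset)
        (B := ballThrough p x y) (Q' := Q ∩ ballThrough p x y) (S' := (l₁.take i).toFinset) (by
          intro a ha b hb hab hS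
          rw [List.take_append_of_le_length hi, List.mem_toFinset, List.mem_toFinset] at hS
          rw [List.mem_toFinset, List.mem_toFinset, Finset.mem_inter, Finset.mem_inter]
          have h1 : ∀ z, z ∈ l₁.take i → z ∈ ballThrough p x y := fun z h =>
            ((hm₁ z).1 (List.mem_of_mem_take h)).2
          have := h1 a
          have := h1 b
          tauto)
      have h2 := hc₁ i
      have h3 : ((cutEdges σ Q ((l₁ ++ l₂).take i).toFinset).card : ℝ) ≤ _ := Nat.cast_le.2 this
      push_cast at h3
      linarith
    · have := card_cutEdges_le_add σ (Q := Q) (S := ((l₁ ++ l₂).take i).toFinset)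
        (B := ballThrough p x y) (Q' := Q \ ballThrough p x y)
        (S' := (l₂.take (i - l₁.length)).toFinset) (by
          intro a ha b hb hab hS
          rw [List.take_append, List.take_of_length_le hi.le, List.mem_toFinset,
            List.mem_toFinset, List.mem_append, List.mem_append, hm₁, hm₁] at hS
          rw [List.mem_toFinset, List.mem_toFinset, Finset.mem_sdiff, Finset.mem_sdiff]
          tauto)
      have h2 := hc₂ (i - l₁.length)
      have h3 : ((cutEdges σ Q ((l₁ ++ l₂).take i).toFinset).card : ℝ) ≤ _ := Nat.cast_le.2 this
      push_cast at h3
      linarith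

/-- An initial segment splits only one of the two parts, so numbers of rules and cut edges add up
along a branch of the recursion and never over the whole tree. Both parts are proper, hence both are
nonempty, and the recurrences are needed for `m' ≥ 1` only. -/
theorem hasArrangement_of_separators {d n : ℕ} (hn : 2 ≤ n) {D : ℕ → ℕ → ℝ} {p : Fin n ↪ Pt d}
    (hD : ∀ i j : Fin n, D i j = dist (p i) (p j)) (σ : Equiv.Perm (Fin n)) (k : ℕ)
    (g G L : ℕ → ℝ)
    (hsep : ∀ Q : Finset (Fin n), k + 1 < Q.card → ∃ x y,
      (Q ∩ ballThrough p x y).card * (k + 1) ≤ k * Q.card ∧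
      (Q \ ballThrough p x y).card * (k + 1) ≤ k * Q.card ∧
      ((cutEdges σ Q (ballThrough p x y)).card : ℝ) ≤ g Q.card)
    (hG : ∀ m m' : ℕ, 1 ≤ m' → m' * (k + 1) ≤ k * m → g m + G m' ≤ G m)
    (hL : ∀ m m' : ℕ, 1 ≤ m' → m' * (k + 1) ≤ k * m → 1 + L m' ≤ L m)
    (hG0 : ∀ m : ℕ, m ≤ k + 1 → m ≤ G m) (hL0 : ∀ m : ℕ, m ≤ k + 1 → m ≤ L m)
    (Q : Finset (Fin n)) : HasArrangement D σ Q (L Q.card) (G Q.card) := by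
  induction h : Q.card using Nat.strong_induction_on generalizing Q with
  | _ m ih =>
    subst h
    rcases le_or_gt Q.card (k + 1) with hQ | hQ
    · exact (hasArrangement_card hn hD σ Q).mono (hL0 _ hQ) (hG0 _ hQ)
    · obtain ⟨x, y, h1, h2, h3⟩ := hsep Q hQ
      have hsum : (Q ∩ ballThrough p x y).card + (Q \ ballThrough p x y).card = Q.card :=
        Finset.card_inter_add_card_sdiff _ _
      have lt : ∀ a : ℕ, a * (k + 1) ≤ k * Q.card → a < Q.card := fun a ha => by
        by_contra! hcon
        have := Nat.mul_le_mul_right (k + 1) hcon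
        nlinarith
      have l1 := lt _ h1
      have l2 := lt _ h2
      have hG1 := hG _ _ (by omega) h1
      have hG2 := hG _ _ (by omega) h2
      have hL1 := hL _ _ (by omega) h1
      have hL2 := hL _ _ (by omega) h2
      have a1 := (ih _ l1 _ rfl).mono (show _ ≤ L Q.card - 1 by linarith)
        (show _ ≤ G Q.card - g Q.card by linarith)
      have a2 := (ih _ l2 _ rfl).mono (show _ ≤ L Q.card - 1 by linarith)
        (show _ ≤ G Q.card - g Q.card by linarith)
      exact (a1.glue hn hD x y a2 h3).mono (by linarith) (by linarith)

/-! ### Solving the recurrences -/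

theorem log_add_one_le {k m m' : ℕ} (hk : 1 ≤ k) (hm' : 1 ≤ m') (h : m' * (k + 1) ≤ k * m) :
    1 + Real.log m' / Real.log ((k + 1) / k) ≤ Real.log m / Real.log ((k + 1) / k) := by
  have hk0 : (0 : ℝ) < k := by exact_mod_cast hk
  have hm0 : (0 : ℝ) < m' := by exact_mod_cast hm'
  have h1 : 0 < Real.log ((k + 1) / k) := Real.log_pos (by rw [lt_div_iff₀ hk0]; linarith)
  have h2 : (m' : ℝ) * ((k + 1) / k) ≤ m := by
    rw [mul_div_assoc', div_le_iff₀ hk0]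
    have : ((m' * (k + 1) : ℕ) : ℝ) ≤ (k * m : ℕ) := Nat.cast_le.2 h
    push_cast at this
    linarith
  rw [one_add_div h1.ne', ← Real.log_mul (by positivity) (by positivity), mul_comm]
  exact div_le_div_of_nonneg_right (Real.log_le_log (by positivity) h2) h1.le

/-- The bound for the number of edges cut by a separator of a set of `m` points. -/
noncomputable def cutBound (C s : ℝ) (m I : ℕ) : ℝ :=
  2 * (m / 2 ^ I + 2 * C * ∑ i ∈ Finset.range (I + 1), (96 * 2 ^ i : ℝ) ^ s / 2 ^ i)

/-- The ratio `2 ^ (s - 1)` separates the three regimes: the sum is bounded for `s < 1`, has equal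
terms for `s = 1`, and is dominated by its last term for `s > 1`. -/
theorem sum_eq_geom (s : ℝ) (I : ℕ) : ∑ i ∈ Finset.range (I + 1), (96 * 2 ^ i : ℝ) ^ s / 2 ^ i =
    96 ^ s * ∑ i ∈ Finset.range (I + 1), ((2 : ℝ) ^ (s - 1)) ^ i := by
  rw [Finset.mul_sum]
  refine Finset.sum_congr rfl fun i _ => ?_
  rw [Real.mul_rpow (by norm_num) (by positivity), mul_div_assoc]
  congr 1
  rw [Real.rpow_sub_one two_ne_zero, div_pow, ← Real.rpow_natCast (2 ^ s),
    ← Real.rpow_mul two_pos.le,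
    mul_comm s, Real.rpow_mul two_pos.le, Real.rpow_natCast]

/-- `h` bounds the cuts at a node of the recursion tree up to a constant, `H` the sum of `h` along
its branches, and both are bounded in terms of `growth δ`. -/
structure Majorant (δ C s : ℝ) (k : ℕ) (I : ℕ → ℕ) (c κ : ℝ) (h H : ℕ → ℝ) : Prop where
  cut_le : ∀ m : ℕ, 1 ≤ m → cutBound C s m (I m) ≤ c * h m
  add_le : ∀ m m' : ℕ, 1 ≤ m' → m' * (k + 1) ≤ k * m → h m + H m' ≤ H m
  c_nonneg : 0 ≤ c
  nonneg : ∀ m, 0 ≤ H m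
  le_growth : ∀ n : ℕ, 2 ≤ n → H n ≤ κ * growth δ n
  log_le : ∀ n : ℕ, 2 ≤ n → Real.log n ≤ κ * growth δ n
  one_le : ∀ n : ℕ, 2 ≤ n → 1 ≤ κ * growth δ n

theorem half_le_log {n : ℕ} (hn : 2 ≤ n) : 1 / 2 ≤ Real.log n := by
  have h1 : Real.log 2 ≤ Real.log n := Real.log_le_log two_pos (by exact_mod_cast hn)
  linarith [Real.log_two_gt_d9]

/-- The geometric series converges, so additional scales cost nothing and `I = m` makes `m / 2 ^ I`
at most `1`. Each of the logarithmically many levels contributes a constant. -/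
theorem exists_majorant_of_lt {δ C s : ℝ} (hδ : 0 < δ) (hδ1 : δ < 1) (hs : s < 1) (hC : 0 ≤ C)
    {k : ℕ} (hk : 1 ≤ k) : ∃ I c κ h H, Majorant δ C s k I c κ h H := by
  have hgr : ∀ n, growth δ n = Real.log n := fun n => by
    rw [growth, if_neg (by linarith), if_neg hδ1.ne]
  set Λ := Real.log ((k + 1) / k) with hΛ
  have hk0 : (0 : ℝ) < k := by exact_mod_cast hk
  have hΛ0 : 0 < Λ := Real.log_pos (by rw [lt_div_iff₀ hk0]; linarith)
  have hq : (2 : ℝ) ^ (s - 1) < 1 := Real.rpow_lt_one_of_one_lt_of_neg one_lt_two (by linarith)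
  have hq0 : (0 : ℝ) < 2 ^ (s - 1) := by positivity
  have hq1 : 0 < 1 - (2 : ℝ) ^ (s - 1) := by linarith
  refine ⟨fun m => m, 2 * (1 + 2 * C * (96 ^ s * (1 - 2 ^ (s - 1))⁻¹)), 2 + 1 / Λ, fun _ => 1,
    fun m => Real.log m / Λ, ⟨fun m _ => ?_, fun m m' => log_add_one_le hk, by positivity,
    fun m => by positivity, fun n hn => ?_, fun n hn => ?_, fun n hn => ?_⟩⟩
  · rw [mul_one, cutBound, sum_eq_geom]
    have h1 : (m : ℝ) / 2 ^ m ≤ 1 := by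
      rw [div_le_one (by positivity)]
      exact_mod_cast Nat.lt_two_pow_self.le
    have h2 : ∑ i ∈ Finset.range (m + 1), ((2 : ℝ) ^ (s - 1)) ^ i ≤ (1 - 2 ^ (s - 1))⁻¹ := by
      rw [geom_sum_eq hq.ne, ← neg_div_neg_eq, neg_sub, neg_sub, inv_eq_one_div]
      exact div_le_div_of_nonneg_right (by linarith [pow_pos hq0 (m + 1)]) hq1.le
    gcongr
  all_goals
    rw [hgr]
    have := half_le_log hn
    have h3 : 0 < 1 / Λ := by positivity
  · rw [add_mul, one_div_mul_eq_div]; linarith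
  · nlinarith
  · nlinarith

theorem ceil_logb_two {x : ℝ} (hx : 1 ≤ x) :
    x ≤ 2 ^ ⌈Real.logb 2 x⌉₊ ∧ (2 : ℝ) ^ ⌈Real.logb 2 x⌉₊ ≤ 2 * x ∧
      (⌈Real.logb 2 x⌉₊ : ℝ) ≤ Real.logb 2 x + 1 := by
  have h0 : 0 ≤ Real.logb 2 x := Real.logb_nonneg one_lt_two hx
  have h1 : (⌈Real.logb 2 x⌉₊ : ℝ) ≤ Real.logb 2 x + 1 := (Nat.ceil_lt_add_one h0).le
  have h2 : (2 : ℝ) ^ Real.logb 2 x = x := Real.rpow_logb two_pos (by norm_num) (by linarith)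
  refine ⟨?_, ?_, h1⟩
  · rw [← Real.rpow_natCast]
    exact h2.symm.le.trans (Real.rpow_le_rpow_of_exponent_le one_le_two (Nat.le_ceil _))
  · rw [← Real.rpow_natCast]
    refine (Real.rpow_le_rpow_of_exponent_le one_le_two h1).trans_eq ?_
    rw [Real.rpow_add_one two_ne_zero, h2, mul_comm]

/-- About `log m` scales contribute equally, and the logarithmic depth of the recursion yields the
second logarithm. Along a branch each cut is estimated by the bound at the larger set. -/
theorem exists_majorant_of_eq {δ C : ℝ} (hδ : δ = 1) (hC : 0 ≤ C)
    {k : ℕ} (hk : 1 ≤ k) : ∃ I c κ h H, Majorant δ C δ k I c κ h H := by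
  subst hδ
  have hgr : ∀ n, growth 1 n = Real.log n ^ 2 := fun n => by
    rw [growth, if_neg (by linarith), if_pos rfl]
  set Λ := Real.log ((k + 1) / k) with hΛ
  have hk0 : (0 : ℝ) < k := by exact_mod_cast hk
  have hΛ0 : 0 < Λ := Real.log_pos (by rw [lt_div_iff₀ hk0]; linarith)
  have hlog0 : 0 < Real.log 2 := Real.log_pos one_lt_two
  refine ⟨fun m => ⌈Real.logb 2 m⌉₊, 2 * (1 + 2 * C * (96 * 2)), 4 + 4 / Λ,
    fun m => 1 + Real.log m / Real.log 2, fun m => (1 + Real.log m / Real.log 2) * (Real.log m / Λ),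
    ⟨fun m hm => ?_, fun m m' hm' hmm' => ?_, by positivity,
    fun m => by positivity, fun n hn => ?_, fun n hn => ?_, fun n hn => ?_⟩⟩
  · have hm1 : (1 : ℝ) ≤ m := by exact_mod_cast hm
    obtain ⟨h1, -, h2⟩ := ceil_logb_two hm1
    rw [cutBound, sum_eq_geom, sub_self, Real.rpow_zero, Real.rpow_one]
    simp only [one_pow, Finset.sum_const, Finset.card_range, nsmul_eq_mul, mul_one]
    have h3 : (m : ℝ) / 2 ^ ⌈Real.logb 2 m⌉₊ ≤ 1 := by rwa [div_le_one (by positivity)]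
    have h4 : 0 ≤ Real.logb 2 m := Real.logb_nonneg one_lt_two hm1
    rw [show Real.log m / Real.log 2 = Real.logb 2 m from rfl]
    push_cast
    have h5 : 2 * C * (96 * ((⌈Real.logb 2 m⌉₊ : ℝ) + 1)) ≤
        2 * C * (96 * 2) * (1 + Real.logb 2 m) := by
      have : (⌈Real.logb 2 m⌉₊ : ℝ) + 1 ≤ 2 * (1 + Real.logb 2 m) := by linarith
      calc _ ≤ 2 * C * (96 * (2 * (1 + Real.logb 2 m))) := by gcongr
        _ = _ := by ring
    linarith
  · have h1 := log_add_one_le hk hm' hmm'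
    have hm0 : (0 : ℝ) < m' := by exact_mod_cast hm'
    have h2 : Real.log m' ≤ Real.log m := by
      refine Real.log_le_log hm0 (Nat.cast_le.2 ?_)
      by_contra! h
      nlinarith
    have h3 : Real.log m' / Real.log 2 ≤ Real.log m / Real.log 2 :=
      div_le_div_of_nonneg_right h2 hlog0.le
    have h4 : 0 ≤ Real.log m' / Λ := by positivity
    have h5 : 0 ≤ Real.log m / Real.log 2 := by positivity
    calc _ ≤ (1 + Real.log m / Real.log 2) + (1 + Real.log m / Real.log 2) * (Real.log m' / Λ) := by
          gcongr
      _ = (1 + Real.log m / Real.log 2) * (1 + Real.log m' / Λ) := by ring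
      _ ≤ _ := by gcongr
  · rw [hgr]
    have h1 := half_le_log hn
    have h2 : Real.log n / Real.log 2 ≤ 2 * Real.log n := by
      rw [div_le_iff₀ hlog0]
      nlinarith [Real.log_two_gt_d9]
    calc _ ≤ (4 * Real.log n) * (Real.log n / Λ) := by gcongr; linarith
      _ = 4 / Λ * Real.log n ^ 2 := by ring
      _ ≤ _ := by rw [add_mul]; nlinarith
  all_goals
    rw [hgr]
    have := half_le_log hn
    have h3 : 0 < 4 / Λ := by positivity
    nlinarith [mul_nonneg h3.le (sq_nonneg (Real.log n))]

/-- The choice `2 ^ I ≈ m ^ (1 / δ)` balances the two terms: `m / 2 ^ I` and `(2 ^ I) ^ (δ - 1)` are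
both of order `m ^ (1 - 1 / δ)`. Along a branch these bounds decrease at least geometrically, with
ratio `ρ ^ a`, so that the root dominates. -/
theorem exists_majorant_of_gt {δ C : ℝ} (hδ : 1 < δ) (hC : 0 ≤ C)
    {k : ℕ} (hk : 1 ≤ k) : ∃ I c κ h H, Majorant δ C δ k I c κ h H := by
  have hgr : ∀ n, growth δ n = (n : ℝ) ^ (1 - 1 / δ) := fun n => by rw [growth, if_pos hδ]
  have hδ0 : 0 < δ := by linarith
  set a := 1 - 1 / δ with ha
  have ha0 : 0 < a := by
    have : 1 / δ < 1 := by rwa [div_lt_one hδ0]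
    linarith
  have hk0 : (0 : ℝ) < k := by exact_mod_cast hk
  set ρ : ℝ := k / (k + 1) with hρ
  have hρ0 : 0 ≤ ρ := by positivity
  have hρa : ρ ^ a < 1 := Real.rpow_lt_one hρ0 (by rw [div_lt_one (by positivity)]; linarith) ha0
  have hρ1 : 0 < 1 - ρ ^ a := by linarith
  have hr : 1 < (2 : ℝ) ^ (δ - 1) := Real.one_lt_rpow one_lt_two (by linarith)
  have hr1 : 0 < (2 : ℝ) ^ (δ - 1) - 1 := by linarith
  refine ⟨fun m => ⌈Real.logb 2 ((m : ℝ) ^ (1 / δ))⌉₊,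
    2 * (1 + 2 * C * (96 ^ δ * (4 ^ (δ - 1) / (2 ^ (δ - 1) - 1)))), 1 / (1 - ρ ^ a) + 1 / a + 1,
    fun m => (m : ℝ) ^ a, fun m => 1 / (1 - ρ ^ a) * (m : ℝ) ^ a,
    ⟨fun m hm => ?_, fun m m' hm' hmm' => ?_, by positivity,
    fun m => by positivity, fun n hn => ?_, fun n hn => ?_, fun n hn => ?_⟩⟩
  · have hm1 : (1 : ℝ) ≤ m := by exact_mod_cast hm
    have hm0 : (0 : ℝ) < m := by linarith
    obtain ⟨h1, h2, -⟩ := ceil_logb_two (Real.one_le_rpow hm1 (show 0 ≤ 1 / δ by positivity))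
    rw [cutBound, sum_eq_geom]
    set I := ⌈Real.logb 2 ((m : ℝ) ^ (1 / δ))⌉₊
    have h3 : (m : ℝ) / 2 ^ I ≤ (m : ℝ) ^ a := by
      rw [ha, Real.rpow_sub hm0, Real.rpow_one]
      exact div_le_div_of_nonneg_left hm0.le (by positivity) h1
    have h4 : ((2 : ℝ) ^ (δ - 1)) ^ (I + 1) ≤ 4 ^ (δ - 1) * (m : ℝ) ^ a := by
      have h5 : ((2 : ℝ) ^ (δ - 1)) ^ (I + 1) = ((2 : ℝ) ^ (I + 1)) ^ (δ - 1) := by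
        rw [← Real.rpow_natCast, ← Real.rpow_mul two_pos.le, mul_comm,
          Real.rpow_mul two_pos.le, Real.rpow_natCast]
      have h6 : (m : ℝ) ^ a = ((m : ℝ) ^ (1 / δ)) ^ (δ - 1) := by
        rw [← Real.rpow_mul hm0.le]
        congr 1
        rw [ha]; field_simp
      rw [h5, h6, ← Real.mul_rpow (by norm_num) (by positivity)]
      refine Real.rpow_le_rpow (by positivity) ?_ (by linarith)
      rw [pow_succ]; linarith
    have h7 : ∑ i ∈ Finset.range (I + 1), ((2 : ℝ) ^ (δ - 1)) ^ i ≤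
        4 ^ (δ - 1) / (2 ^ (δ - 1) - 1) * (m : ℝ) ^ a := by
      rw [geom_sum_eq hr.ne', div_mul_eq_mul_div]
      exact div_le_div_of_nonneg_right (by linarith) hr1.le
    calc _ ≤ 2 * ((m : ℝ) ^ a +
          2 * C * (96 ^ δ * (4 ^ (δ - 1) / (2 ^ (δ - 1) - 1) * (m : ℝ) ^ a))) := by gcongr
      _ = _ := by ring
  · have h1 : (m' : ℝ) ≤ ρ * m := by
      rw [hρ, div_mul_eq_mul_div, le_div_iff₀ (by positivity)]
      exact_mod_cast hmm'
    have h2 : (m' : ℝ) ^ a ≤ ρ ^ a * (m : ℝ) ^ a := by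
      rw [← Real.mul_rpow hρ0 (by positivity)]
      exact Real.rpow_le_rpow (by positivity) h1 ha0.le
    calc _ ≤ (m : ℝ) ^ a + 1 / (1 - ρ ^ a) * (ρ ^ a * (m : ℝ) ^ a) := by gcongr
      _ = _ := by field_simp; ring
  all_goals
    rw [hgr]
    have hn1 : (1 : ℝ) ≤ n := by exact_mod_cast (by omega : 1 ≤ n)
    have h1 := Real.one_le_rpow hn1 ha0.le
    have h2 := Real.log_le_rpow_div (Nat.cast_nonneg n) ha0
    rw [← one_div_mul_eq_div] at h2
    have h3 : 0 ≤ 1 / (1 - ρ ^ a) * (n : ℝ) ^ a := by positivity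
    have h4 : 0 ≤ 1 / a * (n : ℝ) ^ a := by positivity
    rw [add_mul, add_mul, one_mul]
    linarith

theorem exists_majorant {δ C s : ℝ} (hδ : 0 < δ) (hs : δ < 1 ∧ s < 1 ∨ 1 ≤ δ ∧ s = δ) (hC : 0 ≤ C)
    {k : ℕ} (hk : 1 ≤ k) : ∃ I c κ h H, Majorant δ C s k I c κ h H := by
  rcases hs with ⟨h1, h2⟩ | ⟨h1, rfl⟩
  · exact exists_majorant_of_lt hδ h1 h2 hC hk
  · rcases h1.eq_or_lt with h | h
    · exact exists_majorant_of_eq h.symm hC hk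
    · exact exists_majorant_of_gt h hC hk

/-- Optimal tours of point sets with the growth condition have arrangements of size
`O(growth δ n)`. -/
theorem exists_arrangement (d : ℕ) {δ C s : ℝ} (hδ : 0 < δ) (hs0 : 0 ≤ s)
    (hs : δ < 1 ∧ s < 1 ∨ 1 ≤ δ ∧ s = δ) (hC : 0 ≤ C) :
    ∃ K : ℕ, ∀ (n : ℕ) (D : ℕ → ℕ → ℝ) (p : Fin n ↪ Pt d) (σ : Equiv.Perm (Fin n)), 2 ≤ n →
      (∀ i j : Fin n, D i j = dist (p i) (p j)) → IsOptimalTour p σ →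
      HasGrowth (Finset.univ.map p) C s → ∃ L G : ℝ, HasArrangement D σ Finset.univ L G ∧
        L ≤ K * growth δ n ∧ 2 * G + 2 ≤ K * growth δ n := by
  obtain ⟨k, hk⟩ := exists_nat_ge (max (C * 9 ^ s) 1)
  have hk1 : 1 ≤ k := by exact_mod_cast (le_max_right _ _).trans hk
  obtain ⟨I, c, κ, h, H, hM⟩ := exists_majorant hδ hs hC hk1
  have hk0 : (0 : ℝ) < k := by exact_mod_cast hk1
  set Λ := Real.log ((k + 1) / k) with hΛ
  have hΛ0 : 0 < Λ := Real.log_pos (by rw [lt_div_iff₀ hk0]; linarith)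
  -- The summands `k + 1` of `L` and `G` pay for sets too small to be separated; `one_le` absorbs
  -- them into the growth.
  obtain ⟨K, hK⟩ := exists_nat_ge (max ((k + 1 + 1 / Λ) * κ) ((2 * k + 4 + 2 * c) * κ))
  refine ⟨K, fun n D p σ hn hD hσ hP => ?_⟩
  let L : ℕ → ℝ := fun m => k + 1 + Real.log m / Λ
  let G : ℕ → ℝ := fun m => k + 1 + c * H m
  have hc := hM.c_nonneg
  have hGn : 0 ≤ growth δ n := by
    rw [growth]; split_ifs <;> positivity
  have h1 := hM.one_le n hn
  have hkm : ∀ m : ℕ, m ≤ k + 1 → (m : ℝ) ≤ k + 1 := fun m hm => by exact_mod_cast hm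
  refine ⟨L n, G n, ?_, ?_, ?_⟩
  · have := hasArrangement_of_separators hn hD σ k
      (fun m => if 1 ≤ m then cutBound C s m (I m) else 0)
      G L (fun Q hQ => ?_) (fun m m' hm' hmm' => ?_) (fun m m' hm' hmm' => ?_) (fun m hm => ?_)
      (fun m hm => ?_) Finset.univ
    · simpa using this
    · obtain ⟨x, y, h1, h2, h3⟩ := exists_separator p σ hσ hP hC hs0 k ((le_max_left _ _).trans hk)
        Q hQ (I Q.card)
      refine ⟨x, y, h1, h2, ?_⟩
      rw [if_pos (by omega)]
      exact h3
    · have hm1 : 1 ≤ m := by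
        by_contra! h
        interval_cases m
        simp at hmm'
        omega
      rw [if_pos hm1]
      have h1 := hM.cut_le m hm1
      have h2 := mul_le_mul_of_nonneg_left (hM.add_le m m' hm' hmm') hc
      simp only [G]
      linarith
    · have := log_add_one_le hk1 hm' hmm'
      simp only [L]
      linarith
    · have h1 := mul_nonneg hc (hM.nonneg m)
      have := hkm m hm
      simp only [G]
      linarith
    · have h1 : 0 ≤ Real.log m / Λ := by positivity
      have := hkm m hm
      simp only [L]
      linarith
  · have h2 : 1 / Λ * Real.log n ≤ 1 / Λ * (κ * growth δ n) :=
      mul_le_mul_of_nonneg_left (hM.log_le n hn) (by positivity)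
    have h3 := mul_le_mul_of_nonneg_right ((le_max_left _ _).trans hK) hGn
    have h4 : (k + 1 : ℝ) * 1 ≤ (k + 1) * (κ * growth δ n) := by gcongr
    simp only [L]
    rw [← one_div_mul_eq_div]
    linarith
  · have h2 := mul_le_mul_of_nonneg_left (hM.le_growth n hn) hc
    have h3 := mul_le_mul_of_nonneg_right ((le_max_right _ _).trans hK) hGn
    have h4 : (2 * k + 4 : ℝ) * 1 ≤ (2 * k + 4) * (κ * growth δ n) := by gcongr
    simp only [G]
    linarith

/-! ### The complete program -/

theorem input_R_succ {d n : ℕ} (δ : ℝ) (p : Fin n ↪ Pt d) (i : Fin n) (k : Fin d) :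
    (input δ p).R (d * i + (k + 1)) = p i k := by
  have h : (finProdFinEquiv (i, k) : ℕ) = d * i + k := by
    rw [finProdFinEquiv_apply_val]; exact Nat.add_comm _ _
  have hlt : d * (i : ℕ) + k < n * d := h ▸ (finProdFinEquiv (i, k)).2
  have h2 : finProdFinEquiv.symm ⟨d * (i : ℕ) + k, hlt⟩ = (i, k) := by
    rw [Equiv.symm_apply_eq]
    exact Fin.ext h.symm
  rw [← add_assoc]
  simp only [input]
  rw [dif_pos hlt, h2]

theorem storedDist_input {d n : ℕ} {δ : ℝ} {p : Fin n ↪ Pt d} {R : ℕ → ℝ}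
    (hR : ∀ k < d * n, R (k + 1) = (input δ p).R (k + 1)) (i j : Fin n) :
    storedDist d R i j = dist (p i) (p j) := by
  have h : ∀ (i : Fin n) (k : Fin d), R (d * i + (k + 1)) = p i k := fun i k => by
    rw [← input_R_succ δ p i k, ← add_assoc]
    refine hR _ ?_
    calc d * (i : ℕ) + k < d * i + d := by omega
      _ = d * (i + 1) := by ring
      _ ≤ d * n := Nat.mul_le_mul_left _ i.2
  rw [EuclideanSpace.dist_eq, storedDist, Finset.sum_range]
  simp only [h, Real.dist_eq, sq_abs]

theorem input_arr_zero {d n : ℕ} (δ : ℝ) (p : Fin n ↪ Pt d) : (input δ p).arr cN 0 = n := by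
  simp [Memory.arr, input]

theorem input_arr {d n : ℕ} (δ : ℝ) (p : Fin n ↪ Pt d) {j : ℕ} (hj : j ≠ 0) (i : ℕ) :
    (input δ p).arr j i = 0 := by
  simp only [Memory.arr, input]
  rw [Function.update_of_ne (by omega)]
  rfl

theorem coe_finRotate {n : ℕ} (i : Fin n) : (finRotate n i : ℕ) = nextPos n i := by
  obtain ⟨m, rfl⟩ : ∃ m, n = m + 1 := ⟨n - 1, by have := i.2; omega⟩
  have hi := i.2
  rw [finRotate_apply, Fin.val_add_one, nextPos]
  by_cases h : i = Fin.last m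
  · subst h; simp
  · have : (i : ℕ) ≠ m := fun h' => h (Fin.ext h')
    rw [if_neg h, if_pos (by omega)]

theorem partialCost_eq_tourLength {d n : ℕ} {D : ℕ → ℕ → ℝ} {p : Fin n ↪ Pt d}
    (hD : ∀ i j : Fin n, D i j = dist (p i) (p j)) {T : ℕ → ℕ} {σ : Equiv.Perm (Fin n)}
    (hT : ∀ i : Fin n, T i = σ i + 1) : partialCost D n T = tourLength p σ := by
  rw [partialCost, Finset.sum_range, tourLength]
  refine Finset.sum_congr rfl fun i _ => ?_
  rw [edgeCost, ← coe_finRotate, hT, hT, if_neg (by omega), Nat.add_sub_cancel,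
    Nat.add_sub_cancel, hD]

theorem exists_isOptimalTour {d n : ℕ} (p : Fin n ↪ Pt d) : ∃ σ, IsOptimalTour p σ :=
  Finite.exists_min (tourLength p)

/-- The search finds an optimal tour if the width of the codes exceeds the size of some
arrangement. -/
theorem searchC_optimal {Z d n M : ℕ} {p : Fin n ↪ Pt d} {m : Memory} {L G : ℝ}
    {σ : Equiv.Perm (Fin n)} (hn : 2 ≤ n)
    (hD : ∀ i j : Fin n, storedDist d m.R i j = dist (p i) (p j)) (hσ : IsOptimalTour p σ)
    (hA : HasArrangement (storedDist d m.R) σ Finset.univ L G) (hL : L ≤ M) (hG : 2 * G + 2 ≤ M)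
    (hmn : m.arr cN 0 = n) (hM : m.arr cWidth 0 = M)
    (h0 : ∀ j ∈ [cTable, cSet, cOut], ∀ i, m.arr j i = 0) (hnZ : n ≤ Z) (hMZ : M ≤ Z) (h5 : 5 ≤ Z)
    (hZ : (n + 1) ^ (5 * M) ≤ Z) :
    wp Z (searchC d) (fun m' => ∃ τ : Equiv.Perm (Fin n), IsOptimalTour p τ ∧
      ∀ i : Fin n, m'.I i = τ i) m := by
  obtain ⟨l, hnd, hl, hR, hc⟩ := hA
  obtain ⟨w, x, y, c, hw, hx, hy, hstart, htr, hw0, hcn⟩ := exists_code_sequence (M := M) hn σ l hnd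
    hl (fun i => by
      obtain ⟨R, h1, h2, h3⟩ := hR i
      exact ⟨R, by exact_mod_cast h1.trans hL, h2, fun z => h3 z (Finset.mem_univ z)⟩)
    (fun i => by
      have : (2 * (cutEdges σ Finset.univ (l.take i).toFinset).card + 2 : ℝ) ≤ M := by
        linarith [hc i]
      exact_mod_cast this)
  refine wp_mono (searchC_spec w x y c rfl hmn hM h0 hnZ hMZ h5 hZ (by omega) hw hx hy hstart htr
    hw0) ?_
  rintro m' ⟨T, τ, hT, hle, hI⟩
  refine ⟨τ, fun ρ => ?_, hI⟩
  rw [hcn, partialCost_eq_tourLength hD hT, partialCost_eq_tourLength (σ := σ) hD (by simp)] at hle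
  exact hle.trans (hσ ρ)

/-! ### The running time in terms of the growth. -/

theorem one_le_growth {δ : ℝ} (hδ : 0 < δ) {n : ℕ} (hn : 2 ≤ n) : 1 ≤ 4 * growth δ n := by
  have h1 := half_le_log hn
  rw [growth]
  split_ifs with h
  · have hn1 : (1 : ℝ) ≤ n := by exact_mod_cast (by omega : 1 ≤ n)
    have : 1 / δ ≤ 1 := by rw [div_le_one hδ]; exact h.le
    linarith [Real.one_le_rpow hn1 (show 0 ≤ 1 - 1 / δ by linarith)]
  · nlinarith
  · linarith

theorem polynomial_bound (A a M n : ℕ) (hn : 2 ≤ n) :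
    A * ((n + 3) ^ (5 * M + 2)) ^ a ≤ n ^ (A + 3 * (5 * M + 2) * a) := by
  have h1 : n + 3 ≤ n ^ 3 := by nlinarith [Nat.mul_le_mul hn hn]
  have h2 : A ≤ n ^ A := (Nat.lt_pow_self (by omega)).le
  generalize 5 * M + 2 = e
  rw [pow_add, pow_mul n (3 * e), pow_mul n 3]
  exact Nat.mul_le_mul h2 (Nat.pow_le_pow_left (Nat.pow_le_pow_left h1 _) _)

/-- For `δ < 1` all exponents `s < 1` lead to the same bound, so it is enough that the infimum
provides one of them. For `δ ≥ 1` the bound depends on the exponent, and `δ` itself has to be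
attained. -/
theorem exists_exponent {d : ℕ} {δ : ℝ} {F : Set (Finset (Pt d))} (hδ0 : 0 < δ)
    (hdim : fractalDim F ≤ ENNReal.ofReal δ) (hatt : 1 ≤ δ → IsGrowthExponent F δ) :
    ∃ s C : ℝ, 0 ≤ s ∧ (δ < 1 ∧ s < 1 ∨ 1 ≤ δ ∧ s = δ) ∧ 0 ≤ C ∧ ∀ P ∈ F, HasGrowth P C s := by
  have key : ∀ s, IsGrowthExponent F s → ∃ C : ℝ, 0 ≤ C ∧ ∀ P ∈ F, HasGrowth P C s := by
    rintro s ⟨C, hC⟩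
    refine ⟨max C 0, le_max_right _ _, fun P hP ε r hε hr N hN x =>
      (hC P hP ε r hε hr N hN x).trans (mul_le_mul_of_nonneg_right (le_max_left _ _) ?_)⟩
    exact Real.rpow_nonneg (div_nonneg (by linarith) hε.le) _
  rcases lt_or_ge δ 1 with h | h
  · have h1 : fractalDim F < ENNReal.ofReal 1 :=
      hdim.trans_lt ((ENNReal.ofReal_lt_ofReal_iff one_pos).2 h)
    simp only [fractalDim, iInf_lt_iff] at h1
    obtain ⟨s, hs0, hs, hs1⟩ := h1
    obtain ⟨C, hC⟩ := key s hs
    exact ⟨s, C, hs0, Or.inl ⟨h, (ENNReal.ofReal_lt_ofReal_iff one_pos).1 hs1⟩, hC⟩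
  · obtain ⟨C, hC⟩ := key δ (hatt h)
    exact ⟨δ, C, hδ0.le, Or.inr ⟨h, rfl⟩, hC⟩

/-- The family enters the program only through the constant `K₀` in the width of the codes.
Separators, arrangements and the optimal tour `σ` belong to the analysis and are never computed. -/
theorem exists_program (d : ℕ) {δ : ℝ} (hδ0 : 0 < δ) {F : Set (Finset (Pt d))}
    (hdim : fractalDim F ≤ ENNReal.ofReal δ) (hatt : 1 ≤ δ → IsGrowthExponent F δ) :
    ∃ (A : Program) (K : ℝ), ∀ (n : ℕ) (p : Fin n ↪ Pt d), Finset.univ.map p ∈ F →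
      ∃ (t : ℕ) (m : Memory) (σ : Equiv.Perm (Fin n)), A.Runs (input δ p) t m ∧
        (∀ i : Fin n, m.I i = (σ i : ℕ)) ∧ IsOptimalTour p σ ∧
        (2 ≤ n → (t : ℝ) ≤ (n : ℝ) ^ (K * growth δ n)) := by
  obtain ⟨s, C, hs0, hs, hC, hF⟩ := exists_exponent hδ0 hdim hatt
  obtain ⟨K₀, hK₀⟩ := exists_arrangement d hδ0 hs0 hs hC
  obtain ⟨W, hW⟩ := exists_widthC d δ K₀
  -- For a single point, cell `0` still contains `n = 1` and has to be overwritten by the index `0`.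
  let main : Cmd := .ite (.nle (.mem (.lit 0)) (.lit 1)) (.nset (.lit 0) (.lit 0))
    (.seq W (searchC d))
  obtain ⟨A, a, hA⟩ := Cmd.exists_bound_le main
  refine ⟨⟨main, []⟩, (A + 6 * a) * 4 + 15 * a * (K₀ * 9), fun n p hp => ?_⟩
  obtain ⟨σ, hσ⟩ := exists_isOptimalTour p
  rcases lt_or_ge n 2 with hn | hn
  · have hb : (Test.nle (.mem (.lit 0)) (.lit 1)).holds (input δ p) := by
      simp [Test.holds, NExp.eval, input]; omega
    refine ⟨_, _, σ, .iteTrue hb (.nset _ _ _), fun i => ?_, hσ, fun h => absurd h (by omega)⟩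
    have h1 : (i : ℕ) = 0 := by omega
    have h2 : (σ i : ℕ) = 0 := by omega
    rw [h1, h2]
    simp [NExp.eval]
  · have hg := one_le_growth hδ0 hn
    set g := growth δ n with hgdef
    -- `B` bounds the width, which the program determines only up to the factor `9`. In `Z` the
    -- exponent `5 B` covers the number of codes, and the additional `2` covers the loops of length
    -- linear in `n`.
    set B := K₀ * ⌊9 * g⌋₊ with hB
    set Z := (n + 3) ^ (5 * B + 2) with hZ
    have hZ1 : (n + 3) ^ 2 ≤ Z := Nat.pow_le_pow_right (by omega) (by omega)
    have hZ2 : 2 * n + 5 ≤ Z := le_trans (by nlinarith) hZ1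
    have hZ3 : ∀ M ≤ B, (n + 1) ^ (5 * M) ≤ Z := fun M hM =>
      (Nat.pow_le_pow_left (by omega) _).trans (Nat.pow_le_pow_right (by omega) (by omega))
    have hZ4 : B ≤ Z := (show B ≤ 5 * B + 2 by omega).trans (Nat.lt_pow_self (by omega)).le
    have hb : ¬ (Test.nle (.mem (.lit 0)) (.lit 1)).holds (input δ p) := by
      simp [Test.holds, NExp.eval, input]; omega
    have hrun : wp Z main (fun m' => ∃ τ : Equiv.Perm (Fin n), IsOptimalTour p τ ∧
        ∀ i : Fin n, m'.I i = τ i) (input δ p) := by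
      refine wp_ite (fun h => absurd h hb) fun _ => wp_seq (wp_mono
        (hW Z n _ hn (input_arr_zero δ p) rfl (by omega)) ?_)
      rintro m ⟨hkeep, k, hk1, hk2, hM⟩
      have hD : ∀ i j : Fin n, storedDist d m.R i j = dist (p i) (p j) :=
        storedDist_input hkeep.real
      obtain ⟨L, G, hAr, hL, hG⟩ := hK₀ n (storedDist d m.R) p σ hn hD hσ (hF _ hp)
      have hKk : (K₀ : ℝ) * growth δ n ≤ (K₀ * k : ℕ) := by
        push_cast
        exact mul_le_mul_of_nonneg_left hk1 (Nat.cast_nonneg _)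
      have hMB : K₀ * k ≤ B := Nat.mul_le_mul_left _ (Nat.le_floor hk2)
      refine searchC_optimal hn hD hσ hAr (hL.trans hKk) (hG.trans hKk)
        ((hkeep.arr _ (by norm_num) (by simp) _).trans (input_arr_zero δ p)) hM ?_ (by omega)
        (hMB.trans hZ4) (by omega) (hZ3 _ hMB)
      intro j hj i
      simp only [List.mem_cons, List.not_mem_nil, or_false] at hj
      rcases hj with rfl | rfl | rfl <;>
      exact (hkeep.arr _ (by norm_num) (by simp) _).trans (input_arr δ p (by norm_num) _)
    obtain ⟨t, m, ht, htZ, τ, hτ, hI⟩ := hrun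
    refine ⟨t, m, τ, ht, hI, hτ, fun _ => ?_⟩
    have h1 : t ≤ n ^ (A + 3 * (5 * B + 2) * a) :=
      (htZ.trans (hA Z (by omega))).trans (polynomial_bound A a B n hn)
    have hn1 : (1 : ℝ) ≤ n := by exact_mod_cast (by omega : 1 ≤ n)
    have hB1 : (B : ℝ) ≤ K₀ * (9 * g) := by
      rw [hB]
      push_cast
      exact mul_le_mul_of_nonneg_left (Nat.floor_le (by linarith)) (Nat.cast_nonneg _)
    calc (t : ℝ) ≤ (n : ℝ) ^ (A + 3 * (5 * B + 2) * a) := by exact_mod_cast h1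
      _ = (n : ℝ) ^ (((A + 3 * (5 * B + 2) * a : ℕ) : ℝ)) := (Real.rpow_natCast _ _).symm
      _ ≤ _ := by
        refine Real.rpow_le_rpow_of_exponent_le hn1 ?_
        push_cast
        -- The exponent is `A + 6 a + 15 a B` with `B ≤ 9 K₀ g`; its constant part is absorbed by
        -- means of `1 ≤ 4 g`.
        have h2 : (A + 6 * a : ℝ) * 1 ≤ (A + 6 * a) * (4 * g) := by gcongr
        have h3 : 15 * (a : ℝ) * B ≤ 15 * a * (K₀ * (9 * g)) := by gcongr
        linarith

end FractalTSP

theorem theorem5 (d : ℕ) (hd : 2 ≤ d) (δ : ℝ) (hδ0 : 0 < δ) (hδd : δ ≤ d)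
    (F : Set (Finset (FractalTSP.Pt d)))
    (hdim : FractalTSP.fractalDim F ≤ ENNReal.ofReal δ)
    (hattained : 1 ≤ δ → FractalTSP.IsGrowthExponent F δ) :
    ∃ (A : FractalTSP.Program) (K : ℝ),
      ∀ (n : ℕ) (p : Fin n ↪ FractalTSP.Pt d), Finset.univ.map p ∈ F →
        ∃ (t : ℕ) (m : FractalTSP.Memory) (σ : Equiv.Perm (Fin n)),
          A.Runs (FractalTSP.input δ p) t m ∧
          (∀ i : Fin n, m.I i = (σ i : ℕ)) ∧
          FractalTSP.IsOptimalTour p σ ∧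
          (2 ≤ n →
            (1 < δ → (t : ℝ) ≤ (n : ℝ) ^ (K * (n : ℝ) ^ (1 - 1 / δ))) ∧
            (δ = 1 → (t : ℝ) ≤ (n : ℝ) ^ (K * Real.log n ^ 2)) ∧
            (δ < 1 → (t : ℝ) ≤ (n : ℝ) ^ (K * Real.log n))) := by
  obtain ⟨A, K, hA⟩ := FractalTSP.exists_program d hδ0 hdim hattained
  refine ⟨A, K, fun n p hp => ?_⟩
  obtain ⟨t, m, σ, h1, h2, h3, h4⟩ := hA n p hp
  refine ⟨t, m, σ, h1, h2, h3, fun hn => ⟨fun h => ?_, fun h => ?_, fun h => ?_⟩⟩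
  · simpa only [FractalTSP.growth, if_pos h] using h4 hn
  · simpa only [FractalTSP.growth, if_neg h.le.not_gt, if_pos h] using h4 hn
  · simpa only [FractalTSP.growth, if_neg h.not_gt, if_neg h.ne] using h4 hn
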